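/- Let $h(\theta)=2\theta$ on $S^1=\mathbb R/\mathbb Z$ and let $\alpha\in S^1$, $\alpha\neq 0$, be periodic under $h$ with period $n$, represented by a number in $(0,1)$. Let $A_\alpha$ be the open arc from $\alpha/2$ to $(\alpha+1)/2$ and $B_\alpha$ the complementary open arc. The kneading sequence $I^\alpha(\theta)=x_0x_1x_2\cdots$ has $x_i=0$ if $2^i\theta\in A_\alpha$, $x_i=1$ if $2^i\theta\in B_\alpha$, and $x_i=*$ otherwise. Write $I^\alpha(\alpha)=v*v*\cdots$ with $|v|=n-1$; let $\dot\alpha=h^{n-1}(\alpha)$, and let $\ddot\alpha$ be the other preimage of $\alpha$. For $s,t\in\{0,1\}$ let $l^{\alpha,t}_s$ be the inverse branch of $h$ that maps $S^1\setminus\{\alpha\}$ into $A_\alpha$ (if $s=0$) or $B_\alpha$ (if $s=1$), with $l^{\alpha,t}_s(\alpha)=\dot\alpha$ if $t=s$ and $\ddot\alpha$ if $t\ne s$. For a word $w=w_1\cdots w_k$ over $\{0,1\}$ put $l^{\alpha,t}_w=l^{\alpha,t}_{w_1}\circ\cdots\circ l^{\alpha,t}_{w_k}$, and let $S^{\alpha,t}_w$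 be the image of the chord $\dot\alpha\ddot\alpha$ under $l^{\alpha,t}_w$. Let $\mathcal L_\alpha$ be the set of all chords $S^{\alpha,t}_w$, and let $\partial\mathcal L_\alpha$ be the set of chords to which some sequence of pairwise distinct chords of $\mathcal L_\alpha$ converges. Write $\theta\approx^\alpha\theta'$ if $\theta$ and $\theta'$ are joined by a finite chain of chords of $\partial\mathcal L_\alpha$. Let $e\in\{0,1\}$ be the symbol for which the endpoints of $S^{\alpha,e}_{0v}$ are at circle distance less than $1/4$, and let $\overline\alpha=\lim_{k\to\infty}l^{\alpha}_{(v(1-e))^kv}(\ddot\alpha)$ be the companion angle of $\alpha$ (the superscript $t$ is irrelevant at $\ddot\alpha$). Let $\mathbf E_\alpha$ consist of the angles that are not iterated preimages of $\alpha$ (with no marker) and of $\theta^+,\theta^-$ for every iterated preimage $\theta$ of $\alpha$. For any angle $\theta$ let $I^\alpha(\theta^\pm)$ be the symbolwise limit of $I^\alpha(\theta')$ as $\theta'\to\theta$ from above, respectively below. On $\Sigma_2=\{0,1\}^{\mathbb N}$ put $s_1\sim s_2$ if $s_i=I^\alpha(\xi_i)$ for some $\xi_1,\xi_2\in\mathbf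 E_\alpha$ whose underlying angles are $\approx^\alpha$-equivalent. Let $\varphi_\alpha$ be the multivalued map $I^{\overline\alpha}\circ(I^\alpha)^{-1}$ on $\Sigma_2$: it sends $s$ to every $t$ such that $s=I^\alpha(\xi)$ and $t=I^{\overline\alpha}(\xi)$ for some $\xi\in\mathbf E_\alpha\cup\mathbf E_{\overline\alpha}$ for which both itineraries are defined as $0$-$1$ sequences. Then the limit defining $\overline\alpha$ exists; $I^\alpha$ is a well-defined map from $\mathbf E_\alpha$ onto $\Sigma_2$; the relation $\sim$ does not depend on the choice of the $\xi_i$, is an equivalence relation, and is the same for $\alpha$ and $\overline\alpha$. The multivalued maps $\varphi_\alpha$ and $\varphi_{\overline\alpha}$ are defined on all of $\Sigma_2$ and induce well-defined bijections $\Sigma_2/{\sim}\to\Sigma_2/{\sim}$, inverse to each other; $\varphi_\alpha$ has order exactly $2$ on $\Sigma_2/{\sim}$; and the one-sided shift descends to $\Sigma_2/{\sim}$ and commutes with $\varphi_\alpha$. -/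

import Mathlib

open Filter Topology

noncomputable section

namespace QuadLam

/-- The circle of angles `ℝ / ℤ`. -/
abbrev Angle : Type := UnitAddCircle

/-- The angle doubling map `h`. -/
def dbl (θ : Angle) : Angle := (2 : ℕ) • θ

/-- The representative of an angle in `[0, 1)`. -/
def rep (θ : Angle) : ℝ := (AddCircle.equivIco (1 : ℝ) 0 θ : ℝ)

/-- The preimage `θ / 2` of an angle under doubling. -/
def half0 (θ : Angle) : Angle := ((rep θ / 2 : ℝ) : Angle)

/-- The preimage `(θ + 1) / 2` of an angle under doubling. -/
def half1 (θ : Angle) : Angle := (((rep θ + 1) / 2 : ℝ) : Angle)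

/-- The open arc `A_α` from `α / 2` to `(α + 1) / 2` (symbol `0`). -/
def arcA (α : Angle) : Set Angle :=
  (fun x : ℝ => (x : Angle)) '' Set.Ioo (rep α / 2) ((rep α + 1) / 2)

/-- The open arc `B_α` from `(α + 1) / 2` to `α / 2` (symbol `1`). -/
def arcB (α : Angle) : Set Angle :=
  (fun x : ℝ => (x : Angle)) '' Set.Ioo ((rep α + 1) / 2) (rep α / 2 + 1)

open Classical in
/-- The `i`-th entry of the kneading (itinerary) sequence `I^α(θ)`; `none` plays the role of `*`. -/
def kneading (α θ : Angle) (i : ℕ) : Option (Fin 2) :=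
  if dbl^[i] θ ∈ arcA α then some 0
  else if dbl^[i] θ ∈ arcB α then some 1
  else none

/-- The period of `α` under doubling. -/
def per (α : Angle) : ℕ := Function.minimalPeriod dbl α

/-- `α̇`: the preimage of (a periodic) `α` that lies on the orbit of `α`. -/
def dotPt (α : Angle) : Angle := dbl^[per α - 1] α

open Classical in
/-- `α̈`: the other, preperiodic, preimage of `α`. -/
def ddotPt (α : Angle) : Angle := if dotPt α = half0 α then half1 α else half0 α

open Classical in
/-- The repetition word `v^α`: the first `per α - 1` symbols of `I^α(α) = v*v*v*⋯`. -/
def repWord (α : Angle) : List (Fin 2) :=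
  (List.range (per α - 1)).map fun i => if dbl^[i] α ∈ arcA α then 0 else 1

open Classical in
/-- The inverse branch `l^{α,t}_s` of doubling: off `α` it takes values in `A_α` (`s = 0`)
or `B_α` (`s = 1`); at `α` the value is `α̇` if `t = s` and `α̈` otherwise. -/
def branch (α : Angle) (t s : Fin 2) (θ : Angle) : Angle :=
  if θ = α then (if t = s then dotPt α else ddotPt α)
  else if half0 θ ∈ (if s = 0 then arcA α else arcB α) then half0 θ else half1 θ

/-- `l^{α,t}_w = l^{α,t}_{w₁} ∘ ⋯ ∘ l^{α,t}_{wₙ}`. -/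
def branchWord (α : Angle) (t : Fin 2) (w : List (Fin 2)) (θ : Angle) : Angle :=
  w.foldr (branch α t) θ

/-- The chord `S^{α,t}_w`, the image under `l^{α,t}_w` of the long chord `α̇α̈`.
Chords are unordered pairs of points of the circle. -/
def chordS (α : Angle) (t : Fin 2) (w : List (Fin 2)) : Sym2 Angle :=
  s(branchWord α t w (dotPt α), branchWord α t w (ddotPt α))

/-- The lamination `L_α` generated by the long chord `α̇α̈`. -/
def lam (α : Angle) : Set (Sym2 Angle) := {c | ∃ t w, c = chordS α t w}

/-- The limit lamination `∂L_α`: the chords to which a sequence of pairwise distinct chords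
of `L_α` accumulates. -/
def limitLam (α : Angle) : Set (Sym2 Angle) :=
  {c | ∃ (a b : Angle) (x y : ℕ → Angle), c = s(a, b) ∧
    Function.Injective (fun i => s(x i, y i)) ∧ (∀ i, s(x i, y i) ∈ lam α) ∧
    Tendsto x atTop (𝓝 a) ∧ Tendsto y atTop (𝓝 b)}

open Classical in
/-- The characteristic symbol `e^α`: the `t` for which `S^{α,t}_{0v}` has length `< 1/4`.
(The two chords `S^{α,0}_{0v}`, `S^{α,1}_{0v}` have lengths adding up to `1/2`.) -/
def charSym (α : Angle) : Fin 2 :=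
  if dist (branchWord α 0 (0 :: repWord α) (dotPt α))
      (branchWord α 0 (0 :: repWord α) (ddotPt α)) < 1 / 4 then 0 else 1

/-- The sequence `l^α_{(v(1-e))^n v}(α̈)`. The superscript is irrelevant here, because no
preimage of the non-periodic point `α̈` is equal to `α`. -/
def companionSeq (α : Angle) (n : ℕ) : Angle :=
  branchWord α 0
    ((List.replicate n (repWord α ++ [1 - charSym α])).flatten ++ repWord α) (ddotPt α)

/-- The companion angle (associated periodic point) `ᾱ = lim l^α_{(v(1-e))^n v}(α̈)`. -/
def companion (α : Angle) : Angle := limUnder atTop (companionSeq α)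

/-- Angles without a marker, or with a marker `+` or `-`. -/
inductive MarkedAngle : Type
  | plain (θ : Angle)
  | plus (θ : Angle)
  | minus (θ : Angle)

/-- Dropping the marker. -/
def MarkedAngle.angle : MarkedAngle → Angle
  | .plain θ => θ
  | .plus θ => θ
  | .minus θ => θ

/-- `θ` is an iterated preimage of `α` under doubling. -/
def IsPreimage (α θ : Angle) : Prop := ∃ k : ℕ, dbl^[k] θ = α

/-- The extended angles `E_α`: the angles that are not preimages of `α`, without marker, and
the preimages of `α`, with a marker. -/
def extAngles (α : Angle) : Set MarkedAngle :=
  {ξ | match ξ with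
    | .plain θ => ¬ IsPreimage α θ
    | .plus θ => IsPreimage α θ
    | .minus θ => IsPreimage α θ}

/-- One-sided sequences of two symbols. -/
abbrev Seq2 : Type := ℕ → Fin 2

/-- The one-sided shift. -/
def shift (s : Seq2) : Seq2 := fun i => s (i + 1)

/-- `I^α(ξ) = s`: for an unmarked angle, the kneading sequence is `s` (and has no `*`); for `θ⁺`
(resp. `θ⁻`), the kneading sequences `I^α(θ')` converge symbol by symbol to `s` as `θ'` tends
to `θ` from above (resp. below). -/
def HasItin (α : Angle) (ξ : MarkedAngle) (s : Seq2) : Prop :=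
  match ξ with
  | .plain θ => ∀ i, kneading α θ i = some (s i)
  | .plus θ => ∀ i, ∀ᶠ ε : ℝ in 𝓝[>] 0, kneading α (θ + (ε : Angle)) i = some (s i)
  | .minus θ => ∀ i, ∀ᶠ ε : ℝ in 𝓝[>] 0, kneading α (θ - (ε : Angle)) i = some (s i)

/-- Julia equivalence of angles: a finite chain of chords of `∂L_α` leads from `θ` to `θ'`. -/
def JuliaEquiv (α : Angle) : Angle → Angle → Prop :=
  Relation.ReflTransGen fun x y => s(x, y) ∈ limitLam α

/-- The relation `s ∼ t` on sequences: they have Julia-equivalent extended angles. -/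
def SeqEquiv (α : Angle) (s t : Seq2) : Prop :=
  ∃ ξ ∈ extAngles α, ∃ η ∈ extAngles α,
    HasItin α ξ s ∧ HasItin α η t ∧ JuliaEquiv α ξ.angle η.angle

/-- The multivalued map `φ_α = I^ᾱ ∘ (I^α)⁻¹` on sequences: `t` is a value of `φ_α` at `s` iff
some extended angle has itinerary `s` with respect to `α` and `t` with respect to `ᾱ`.
The extended angle may carry a marker if it is a preimage of `α` or of `ᾱ`; it has to carry one
if both itineraries are to exist. -/
def PhiRel (α : Angle) (s t : Seq2) : Prop :=
  ∃ ξ ∈ extAngles α ∪ extAngles (companion α), HasItin α ξ s ∧ HasItin (companion α) ξ t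

/-- The quotient `Σ₂ / ∼`. -/
def SeqQuot (α : Angle) : Type := Quot (SeqEquiv α)

/-- The class of a sequence. -/
def SeqQuot.mk (α : Angle) (s : Seq2) : SeqQuot α := Quot.mk (SeqEquiv α) s

end QuadLam

end

open QuadLam

noncomputable section

namespace QuadLam

/-! ### Positive arc lengths on the circle -/

/-! The angle `α` and its companion bound an arc that neither orbit enters. The reflection `θ ↦ -θ`
exchanges the two ends, so one may write `β` for the lower and `α` for the upper end; `PrePair α β`
records this. Such a pair is built in `exists_prePair`: pull the preperiodic preimage of `α` back
along the repetition word, show that the resulting chord at `α` is not crossed by its images, and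
extend it to the nearby fixed point of the `n`-th iterate, where `n = per α`. `PrePair.charSym_eq`
identifies the companion limit with this point.

Each angle has an itinerary from above, `KP`, and one from below, `KM`, which differ only along
preimages of the base angle. For the upper angle `α` the one from above is canonical, for the lower
angle `β` the one from below. The tail `KM α α` is never an itinerary from above (`PrePair.KP_ne`),
and from below it belongs to `α` only (`PrePair.eq_of_KM_eq`). Hence `collapse` recovers the
canonical itinerary from either one. It depends only on `KP α α` and `KM α α`, which are `KM β β`
and `KP β β`; this is why both angles give the same relation on sequences.

Julia equivalence is equality of canonical itineraries (`PrePair.juliaEquiv_iff`). The ends of a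
chord with a long word share a long prefix, so limit chords join points of one fibre. Conversely
fibres are finite, by expansion, and neighbours in a fibre bound a limit of gaps of cylinder sets,
which are bounded by chords of the lamination (`exists_gap`).

The symbols for `α` and `β` differ exactly at points whose double lies between `β` and `α`
(`PrePair.codeM_eq_iff`). Points with equal itineraries are not separated by this arc, so the two
canonical itineraries determine each other (`PrePair.KP_eq_iff`). Finally some angle has the two
itineraries of a given one exchanged (`PrePair.exists_exchange`), which makes the induced map an
involution; it is not the identity, because the two canonical itineraries of some angle differ. -/

/-- The length of the positively oriented arc from `p` to `q`. -/
def ar (p q : Angle) : ℝ := rep (q - p)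

lemma rep_coe (x : ℝ) : rep (x : Angle) = Int.fract x := by
  simp [rep]

lemma coe_rep (θ : Angle) : ((rep θ : ℝ) : Angle) = θ := AddCircle.coe_equivIco

lemma rep_nonneg (θ : Angle) : 0 ≤ rep θ := (AddCircle.equivIco (1 : ℝ) 0 θ).2.1

lemma rep_lt_one (θ : Angle) : rep θ < 1 :=
  (AddCircle.equivIco (1 : ℝ) 0 θ).2.2.trans_eq (zero_add 1)

lemma ar_nonneg (p q : Angle) : 0 ≤ ar p q := rep_nonneg _

lemma ar_lt_one (p q : Angle) : ar p q < 1 := rep_lt_one _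

lemma add_ar (p q : Angle) : p + ((ar p q : ℝ) : Angle) = q := by
  rw [ar, coe_rep]; abel

lemma ar_add_coe (p : Angle) (r : ℝ) : ar p (p + (r : Angle)) = Int.fract r := by
  rw [ar, add_sub_cancel_left, rep_coe]

lemma ar_add_of_mem {p : Angle} {r : ℝ} (h0 : 0 ≤ r) (h1 : r < 1) :
    ar p (p + (r : Angle)) = r := by
  rw [ar_add_coe, Int.fract_eq_self.2 ⟨h0, h1⟩]

lemma ar_sub_coe (p : Angle) {r : ℝ} (h0 : 0 ≤ r) (h1 : r < 1) :
    ar (p - (r : Angle)) p = r := by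
  have := ar_add_of_mem (p := p - (r : Angle)) h0 h1
  rwa [sub_add_cancel] at this

lemma eq_of_ar_eq_zero {p q : Angle} (h : ar p q = 0) : p = q := by
  have := add_ar p q
  rwa [h, AddCircle.coe_zero, add_zero] at this

lemma ar_self (p : Angle) : ar p p = 0 := by
  have := ar_add_of_mem (p := p) le_rfl one_pos
  rwa [AddCircle.coe_zero, add_zero] at this

lemma ar_pos {p q : Angle} (h : p ≠ q) : 0 < ar p q :=
  (ar_nonneg p q).lt_of_ne fun h' => h (eq_of_ar_eq_zero h'.symm)

lemma ar_right_inj {c p q : Angle} (h : ar c p = ar c q) : p = q := by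
  rw [← add_ar c p, ← add_ar c q, h]

/-- Cutting the circle at `c` turns it into `[0, 1)`, and an arc wraps past the cut at most once.
Circular order thereby becomes linear arithmetic. -/
lemma ar_cases (c p q : Angle) :
    (ar c p ≤ ar c q ∧ ar p q = ar c q - ar c p) ∨
    (ar c q < ar c p ∧ ar p q = ar c q - ar c p + 1) := by
  have hq : q = p + ((ar c q - ar c p : ℝ) : Angle) := by
    conv_lhs => rw [← add_ar c q]
    conv_rhs => enter [1]; rw [← add_ar c p]
    rw [AddCircle.coe_sub]
    abel
  have hq' : q = p + ((ar c q - ar c p + 1 : ℝ) : Angle) := by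
    rw [AddCircle.coe_add, AddCircle.coe_period, add_zero]; exact hq
  have a1 := ar_nonneg c p
  have a2 := ar_lt_one c p
  have a3 := ar_nonneg c q
  have a4 := ar_lt_one c q
  rcases le_or_gt (ar c p) (ar c q) with h | h
  · left
    refine ⟨h, ?_⟩
    nth_rewrite 1 [hq]
    exact ar_add_of_mem (by linarith) (by linarith)
  · right
    refine ⟨h, ?_⟩
    nth_rewrite 1 [hq']
    exact ar_add_of_mem (by linarith) (by linarith)

lemma ar_symm {p q : Angle} (h : p ≠ q) : ar q p = 1 - ar p q := by
  have h1 := ar_pos h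
  rcases ar_cases p q p with ⟨h2, h3⟩ | ⟨h2, h3⟩
  · rw [ar_self] at h2; linarith
  · rw [h3, ar_self]; ring

lemma ar_neg (p q : Angle) : ar (-p) (-q) = ar q p := by
  unfold ar; congr 1; abel

/-! ### Angle doubling -/

lemma dbl_add (p : Angle) (r : ℝ) : dbl (p + (r : Angle)) = dbl p + ((2 * r : ℝ) : Angle) := by
  have : ((2 * r : ℝ) : Angle) = (2 : ℕ) • (r : Angle) := by
    rw [two_mul, AddCircle.coe_add, two_nsmul]
  rw [dbl, dbl, nsmul_add, this]

lemma iter_dbl_add (i : ℕ) (p : Angle) (r : ℝ) :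
    dbl^[i] (p + (r : Angle)) = dbl^[i] p + ((2 ^ i * r : ℝ) : Angle) := by
  induction i with
  | zero => simp
  | succ i ih =>
    rw [Function.iterate_succ_apply', ih, dbl_add, Function.iterate_succ_apply']
    congr 2; ring

lemma dbl_neg (p : Angle) : dbl (-p) = -dbl p := by simp [dbl]

lemma iter_dbl_neg (i : ℕ) (p : Angle) : dbl^[i] (-p) = -dbl^[i] p := by
  induction i with
  | zero => simp
  | succ i ih => rw [Function.iterate_succ_apply', ih, dbl_neg, Function.iterate_succ_apply']

lemma iter_dbl_sub (i : ℕ) (p : Angle) (r : ℝ) :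
    dbl^[i] (p - (r : Angle)) = dbl^[i] p - ((2 ^ i * r : ℝ) : Angle) := by
  have := iter_dbl_add i p (-r)
  rw [mul_neg, AddCircle.coe_neg, AddCircle.coe_neg] at this
  rwa [sub_eq_add_neg, sub_eq_add_neg]

lemma ar_dbl_cases (p q : Angle) :
    (ar p q < 1 / 2 ∧ ar (dbl p) (dbl q) = 2 * ar p q) ∨
    (1 / 2 ≤ ar p q ∧ ar (dbl p) (dbl q) = 2 * ar p q - 1) := by
  have a1 := ar_nonneg p q
  have a2 := ar_lt_one p q
  have h : dbl q = dbl p + ((2 * ar p q : ℝ) : Angle) := by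
    rw [← dbl_add, add_ar]
  have h' : dbl q = dbl p + ((2 * ar p q - 1 : ℝ) : Angle) := by
    rw [AddCircle.coe_sub, AddCircle.coe_period, sub_zero]; exact h
  rcases lt_or_ge (ar p q) (1 / 2) with h2 | h2
  · left
    refine ⟨h2, ?_⟩
    nth_rewrite 1 [h]
    exact ar_add_of_mem (by linarith) (by linarith)
  · right
    refine ⟨h2, ?_⟩
    nth_rewrite 1 [h']
    exact ar_add_of_mem (by linarith) (by linarith)

lemma ar_iter {i : ℕ} {p q : Angle} (h : 2 ^ i * ar p q < 1) :
    ar (dbl^[i] p) (dbl^[i] q) = 2 ^ i * ar p q := by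
  have : dbl^[i] q = dbl^[i] p + ((2 ^ i * ar p q : ℝ) : Angle) := by
    rw [← iter_dbl_add, add_ar]
  rw [this]
  exact ar_add_of_mem (mul_nonneg (by positivity) (ar_nonneg _ _)) h

lemma half1_eq (θ : Angle) : half1 θ = half0 θ + ((1 / 2 : ℝ) : Angle) := by
  rw [half1, half0, ← AddCircle.coe_add]; congr 1; ring

lemma dbl_coe (r : ℝ) : dbl (r : Angle) = ((2 * r : ℝ) : Angle) := by
  have := dbl_add 0 r
  simpa [dbl] using this

lemma dbl_half0 (θ : Angle) : dbl (half0 θ) = θ := by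
  rw [half0, dbl_coe]
  convert coe_rep θ using 2
  ring

lemma dbl_half1 (θ : Angle) : dbl (half1 θ) = θ := by
  rw [half1_eq, dbl_add, dbl_half0]
  norm_num

lemma ar_half0_half1 (α : Angle) : ar (half0 α) (half1 α) = 1 / 2 := by
  rw [half1_eq]; exact ar_add_of_mem (by norm_num) (by norm_num)

/-! ### Codes with respect to the half-open semicircles -/

/-- The position of `θ` relative to `α / 2`. -/
def pos (α θ : Angle) : ℝ := ar (half0 α) θ

lemma pos_nonneg (α θ : Angle) : 0 ≤ pos α θ := ar_nonneg _ _
lemma pos_lt_one (α θ : Angle) : pos α θ < 1 := ar_lt_one _ _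
lemma pos_half0 (α : Angle) : pos α (half0 α) = 0 := ar_self _
lemma pos_half1 (α : Angle) : pos α (half1 α) = 1 / 2 := ar_half0_half1 α
lemma pos_inj {α p q : Angle} (h : pos α p = pos α q) : p = q := ar_right_inj h

lemma ar_pos_cases (α p q : Angle) :
    (pos α p ≤ pos α q ∧ ar p q = pos α q - pos α p) ∨
    (pos α q < pos α p ∧ ar p q = pos α q - pos α p + 1) := ar_cases _ p q

/-- The symbol of `θ` seen from above. -/
def codeP (α θ : Angle) : Fin 2 := if pos α θ < 1 / 2 then 0 else 1

/-- The symbol of `θ` seen from below. -/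
def codeM (α θ : Angle) : Fin 2 := if 0 < pos α θ ∧ pos α θ ≤ 1 / 2 then 0 else 1

lemma fin2_cases (s : Fin 2) : s = 0 ∨ s = 1 := by omega

/-- Doubling sends `half0 α` to `α`, so twice the position of `θ`, modulo one, is the position of
its double measured from `α`; the symbol is the carry. -/
lemma codeP_cases (α θ : Angle) :
    (codeP α θ = 0 ∧ pos α θ < 1 / 2 ∧ ar α (dbl θ) = 2 * pos α θ) ∨
    (codeP α θ = 1 ∧ 1 / 2 ≤ pos α θ ∧ ar α (dbl θ) = 2 * pos α θ - 1) := by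
  have := ar_dbl_cases (half0 α) θ
  rw [dbl_half0] at this
  unfold codeP
  rcases this with ⟨h, h'⟩ | ⟨h, h'⟩
  · left; exact ⟨if_pos h, h, h'⟩
  · right; exact ⟨if_neg (not_lt.2 h), h, h'⟩

lemma dbl_eq_self_iff_pos {α θ : Angle} : dbl θ = α ↔ pos α θ = 0 ∨ pos α θ = 1 / 2 := by
  constructor
  · intro h
    have := codeP_cases α θ
    rw [h, ar_self] at this
    rcases this with ⟨_, _, h3⟩ | ⟨_, _, h3⟩
    · left; linarith
    · right; linarith
  · rintro (h | h)
    · have : half0 α = θ := eq_of_ar_eq_zero h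
      rw [← this, dbl_half0]
    · have : half1 α = θ := pos_inj (α := α) (by rw [h, pos_half1])
      rw [← this, dbl_half1]

lemma codeM_cases (α θ : Angle) :
    (codeM α θ = 0 ∧ 0 < pos α θ ∧ pos α θ ≤ 1 / 2) ∨
    (codeM α θ = 1 ∧ 1 / 2 < pos α θ) ∨ (codeM α θ = 1 ∧ pos α θ = 0) := by
  have := pos_nonneg α θ
  unfold codeM
  split_ifs with h
  · exact .inl ⟨rfl, h⟩
  · rcases this.eq_or_lt with h1 | h1
    · exact .inr (.inr ⟨rfl, h1.symm⟩)
    · refine .inr (.inl ⟨rfl, ?_⟩)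
      by_contra h2
      exact h ⟨h1, not_lt.1 h2⟩

/-- The two half-open choices of semicircles differ only at their common ends, the two preimages of
`α`. -/
lemma codeM_eq_codeP_iff {α θ : Angle} : codeM α θ = codeP α θ ↔ dbl θ ≠ α := by
  rw [Ne, dbl_eq_self_iff_pos, not_or]
  rcases codeM_cases α θ with ⟨h, h1, h2⟩ | ⟨h, h1⟩ | ⟨h, h1⟩ <;>
  rcases codeP_cases α θ with ⟨k, k1, _⟩ | ⟨k, k1, _⟩ <;> rw [h, k] <;>
    simp <;> grind

lemma codeM_eq_codeP {α θ : Angle} (h : dbl θ ≠ α) : codeM α θ = codeP α θ :=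
  codeM_eq_codeP_iff.2 h

/-- A point is determined by its double and its symbol. -/
lemma eq_of_dbl_of_codeP {α p q : Angle} (h : dbl p = dbl q) (hc : codeP α p = codeP α q) :
    p = q := by
  apply pos_inj (α := α)
  rcases codeP_cases α p with ⟨k, k1, k2⟩ | ⟨k, k1, k2⟩ <;>
  rcases codeP_cases α q with ⟨l, l1, l2⟩ | ⟨l, l1, l2⟩ <;>
  rw [k, l] at hc <;> rw [h] at k2 <;> first | linarith | simp at hc

lemma eq_of_dbl_of_codeM {α p q : Angle} (h : dbl p = dbl q) (hc : codeM α p = codeM α q) :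
    p = q := by
  by_cases hα : dbl p = α
  · have hq : dbl q = α := h ▸ hα
    apply pos_inj (α := α)
    rw [dbl_eq_self_iff_pos] at hα hq
    rcases codeM_cases α p with ⟨k, k1⟩ | ⟨k, k1⟩ | ⟨k, k1⟩ <;>
    rcases codeM_cases α q with ⟨l, l1⟩ | ⟨l, l1⟩ | ⟨l, l1⟩ <;>
    rw [k, l] at hc <;> first | (simp at hc; done) | grind
  · refine eq_of_dbl_of_codeP (α := α) h ?_
    rw [← codeM_eq_codeP hα, ← codeM_eq_codeP (h ▸ hα), hc]

lemma exists_codeP (α θ : Angle) (s : Fin 2) : ∃ ζ, dbl ζ = θ ∧ codeP α ζ = s := by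
  have e : ∀ r : ℝ, pos α (half0 α + (r : Angle)) = Int.fract r := fun r => ar_add_coe _ _
  have h0 := ar_nonneg α θ
  have h1 := ar_lt_one α θ
  have key : ∀ r : ℝ, dbl (half0 α + ((ar α θ / 2 + r : ℝ) : Angle)) =
      θ + ((2 * r : ℝ) : Angle) := by
    intro r
    have : ((2 * (ar α θ / 2 + r) : ℝ)) = ar α θ + 2 * r := by ring
    rw [dbl_add, dbl_half0, this, AddCircle.coe_add, ← add_assoc, add_ar]
  rcases fin2_cases s with rfl | rfl
  · refine ⟨half0 α + ((ar α θ / 2 + 0 : ℝ) : Angle), by rw [key]; simp, ?_⟩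
    have : pos α (half0 α + ((ar α θ / 2 + 0 : ℝ) : Angle)) = ar α θ / 2 + 0 :=
      ar_add_of_mem (by linarith) (by linarith)
    rw [codeP, this, if_pos (by linarith)]
  · refine ⟨half0 α + ((ar α θ / 2 + 1 / 2 : ℝ) : Angle), by rw [key]; norm_num, ?_⟩
    have : pos α (half0 α + ((ar α θ / 2 + 1 / 2 : ℝ) : Angle)) = ar α θ / 2 + 1 / 2 :=
      ar_add_of_mem (by linarith) (by linarith)
    rw [codeP, this, if_neg (by linarith)]

/-- Doubling preserves the order of points with equal symbols. -/
lemma ar_lt_ar_dbl {α p q r : Angle} (hq : codeP α q = codeP α p) (hr : codeP α r = codeP α p) :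
    ar p q < ar p r ↔ ar (dbl p) (dbl q) < ar (dbl p) (dbl r) := by
  have h1 := ar_cases α (dbl p) (dbl q)
  have h2 := ar_cases α (dbl p) (dbl r)
  have h3 := ar_pos_cases α p q
  have h4 := ar_pos_cases α p r
  have b1 := pos_nonneg α p
  have b2 := pos_nonneg α q
  have b3 := pos_nonneg α r
  have b4 := pos_lt_one α p
  have b5 := pos_lt_one α q
  have b6 := pos_lt_one α r
  rcases codeP_cases α p with ⟨k, k1, k2⟩ | ⟨k, k1, k2⟩ <;>
  rcases codeP_cases α q with ⟨l, l1, l2⟩ | ⟨l, l1, l2⟩ <;>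
  rcases codeP_cases α r with ⟨m, m1, m2⟩ | ⟨m, m1, m2⟩ <;>
  rw [k] at hq hr <;> rw [l] at hq <;> rw [m] at hr <;>
  first
  | (exfalso; revert hq; decide)
  | (exfalso; revert hr; decide)
  | (rw [k2, l2] at h1; rw [k2, m2] at h2
     rcases h1 with ⟨h1, h1'⟩ | ⟨h1, h1'⟩ <;> rcases h2 with ⟨h2, h2'⟩ | ⟨h2, h2'⟩ <;>
     rcases h3 with ⟨h3, h3'⟩ | ⟨h3, h3'⟩ <;> rcases h4 with ⟨h4, h4'⟩ | ⟨h4, h4'⟩ <;>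
     rw [h1', h2', h3', h4'] <;> constructor <;> intro <;> linarith)

/-! ### Itineraries from above and from below -/

/-- The itinerary of `θ` seen from above. -/
def KP (α θ : Angle) : Seq2 := fun i => codeP α (dbl^[i] θ)

/-- The itinerary of `θ` seen from below. -/
def KM (α θ : Angle) : Seq2 := fun i => codeM α (dbl^[i] θ)

lemma KP_iter (α θ : Angle) (k i : ℕ) : KP α (dbl^[k] θ) i = KP α θ (k + i) := by
  rw [KP, KP, ← Function.iterate_add_apply, add_comm]

lemma KM_iter (α θ : Angle) (k i : ℕ) : KM α (dbl^[k] θ) i = KM α θ (k + i) := by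
  rw [KM, KM, ← Function.iterate_add_apply, add_comm]

lemma ar_lt_ar_iter {α p q r : Angle} (k : ℕ) (hq : ∀ i < k, KP α q i = KP α p i)
    (hr : ∀ i < k, KP α r i = KP α p i) :
    ar p q < ar p r ↔ ar (dbl^[k] p) (dbl^[k] q) < ar (dbl^[k] p) (dbl^[k] r) := by
  induction k with
  | zero => rfl
  | succ k ih =>
    rw [ih (fun i hi => hq i (by omega)) (fun i hi => hr i (by omega))]
    simp only [Function.iterate_succ_apply']
    exact ar_lt_ar_dbl (hq k (by omega)) (hr k (by omega))

lemma eq_of_iter_of_KP {α p q : Angle} (k : ℕ) (h : dbl^[k] p = dbl^[k] q)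
    (hc : ∀ i < k, KP α p i = KP α q i) : p = q := by
  induction k with
  | zero => exact h
  | succ k ih =>
    rw [Function.iterate_succ_apply', Function.iterate_succ_apply'] at h
    exact ih (eq_of_dbl_of_codeP h (hc k (by omega))) fun i hi => hc i (by omega)

lemma exists_KP (α θ : Angle) (s : Seq2) (k : ℕ) :
    ∃ ζ, dbl^[k] ζ = θ ∧ ∀ i < k, KP α ζ i = s i := by
  induction k generalizing s with
  | zero => exact ⟨θ, rfl, by simp⟩
  | succ k ih =>
    obtain ⟨η, h1, h2⟩ := ih (shift s)
    obtain ⟨ζ, h3, h4⟩ := exists_codeP α η (s 0)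
    refine ⟨ζ, by rw [Function.iterate_succ_apply, h3, h1], fun i hi => ?_⟩
    cases i with
    | zero => exact h4
    | succ i =>
      have := h2 i (by omega)
      rw [← h3] at this
      simpa [KP, shift] using this

lemma KM_eq_KP_of_not_isPreimage {α θ : Angle} (h : ¬ IsPreimage α θ) : KM α θ = KP α θ := by
  funext i
  refine codeM_eq_codeP fun h' => h ⟨i + 1, ?_⟩
  rw [Function.iterate_succ_apply', h']

/-! ### Kneading symbols in terms of the codes -/

lemma mem_arcA {α θ : Angle} : θ ∈ arcA α ↔ 0 < pos α θ ∧ pos α θ < 1 / 2 := by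
  constructor
  · rintro ⟨x, ⟨h1, h2⟩, rfl⟩
    have : pos α (x : Angle) = x - rep α / 2 := by
      have := ar_add_of_mem (p := half0 α) (r := x - rep α / 2) (by linarith) (by linarith)
      rw [half0, ← AddCircle.coe_add] at this
      rw [pos, half0, ← this]; congr 2; ring
    constructor <;> linarith
  · rintro ⟨h1, h2⟩
    refine ⟨rep α / 2 + pos α θ, ⟨by linarith, by linarith⟩, ?_⟩
    simp only
    rw [AddCircle.coe_add]
    exact add_ar (half0 α) θ

lemma mem_arcB {α θ : Angle} : θ ∈ arcB α ↔ 1 / 2 < pos α θ := by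
  constructor
  · rintro ⟨x, ⟨h1, h2⟩, rfl⟩
    have : pos α (x : Angle) = x - rep α / 2 := by
      have := ar_add_of_mem (p := half0 α) (r := x - rep α / 2) (by linarith) (by linarith)
      rw [half0, ← AddCircle.coe_add] at this
      rw [pos, half0, ← this]; congr 2; ring
    linarith
  · intro h1
    have := pos_lt_one α θ
    refine ⟨rep α / 2 + pos α θ, ⟨by linarith, by linarith⟩, ?_⟩
    simp only
    rw [AddCircle.coe_add]
    exact add_ar (half0 α) θ

lemma kneading_of_ne {α θ : Angle} {i : ℕ} (h : dbl^[i + 1] θ ≠ α) :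
    kneading α θ i = some (KP α θ i) := by
  rw [Function.iterate_succ_apply', Ne, dbl_eq_self_iff_pos, not_or] at h
  have h0 := pos_nonneg α (dbl^[i] θ)
  rw [kneading, mem_arcA, mem_arcB]
  change _ = some (codeP α (dbl^[i] θ))
  rcases codeP_cases α (dbl^[i] θ) with ⟨k, k1, _⟩ | ⟨k, k1, _⟩
  · rw [if_pos ⟨lt_of_le_of_ne h0 (Ne.symm h.1), k1⟩, k]
  · rw [if_neg (by rintro ⟨_, h3⟩; linarith), if_pos (lt_of_le_of_ne k1 (Ne.symm h.2)), k]

lemma kneading_of_eq {α θ : Angle} {i : ℕ} (h : dbl^[i + 1] θ = α) :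
    kneading α θ i = none := by
  rw [Function.iterate_succ_apply', dbl_eq_self_iff_pos] at h
  rw [kneading, mem_arcA, mem_arcB, if_neg, if_neg]
  · rcases h with h | h <;> rw [h] <;> norm_num
  · rcases h with h | h <;> rw [h] <;> norm_num

lemma kneading_eq_some_iff {α θ : Angle} {i : ℕ} {s : Fin 2} :
    kneading α θ i = some s ↔ dbl^[i + 1] θ ≠ α ∧ KP α θ i = s := by
  by_cases h : dbl^[i + 1] θ = α
  · simp [kneading_of_eq h, h]
  · rw [kneading_of_ne h, Option.some_inj]
    exact ⟨fun k => ⟨h, k⟩, And.right⟩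

/-! ### One-sided behaviour of symbols -/

/-- A rise by `δ` moves the double up by `2 * δ`, and the symbol can change only when the double
reaches `α`; `1 - ar α (dbl p)` is the room left. -/
lemma codeP_add {α p : Angle} {δ : ℝ} (h0 : 0 < δ) (h1 : 2 * δ < 1 - ar α (dbl p)) :
    codeP α (p + (δ : Angle)) = codeP α p ∧ dbl (p + (δ : Angle)) ≠ α := by
  have hp : p + (δ : Angle) = half0 α + ((pos α p + δ : ℝ) : Angle) := by
    rw [AddCircle.coe_add, ← add_assoc, pos, add_ar]
  have hn := pos_nonneg α p
  rw [Ne, dbl_eq_self_iff_pos]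
  rcases codeP_cases α p with ⟨k, k1, k2⟩ | ⟨k, k1, k2⟩ <;> rw [k2] at h1
  · have : pos α (p + (δ : Angle)) = pos α p + δ := by
      rw [hp]; exact ar_add_of_mem (by linarith) (by linarith)
    rw [k, this]
    refine ⟨?_, by rintro (h | h) <;> linarith⟩
    rw [codeP, this, if_pos (by linarith)]
  · have : pos α (p + (δ : Angle)) = pos α p + δ := by
      rw [hp]; exact ar_add_of_mem (by linarith) (by linarith)
    rw [k, this]
    refine ⟨?_, by rintro (h | h) <;> linarith⟩
    rw [codeP, this, if_neg (by linarith)]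

/-- Going down, the double must not pass `α`. If it starts at `α`, there is room for almost a full
turn, and the symbol from below is the one that persists. -/
lemma codeP_sub {α p : Angle} {δ : ℝ} (h0 : 0 < δ) (hδ : δ < 1 / 2)
    (h1 : dbl p = α ∨ 2 * δ < ar α (dbl p)) :
    codeP α (p - (δ : Angle)) = codeM α p ∧ dbl (p - (δ : Angle)) ≠ α := by
  have hp : p - (δ : Angle) = half0 α + ((pos α p - δ : ℝ) : Angle) := by
    rw [AddCircle.coe_sub, ← add_sub_assoc, pos, add_ar]
  have hp' : p - (δ : Angle) = half0 α + ((pos α p - δ + 1 : ℝ) : Angle) := by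
    rw [AddCircle.coe_add, AddCircle.coe_period, add_zero, hp]
  have hlt := pos_lt_one α p
  have hcase : (pos α p = 0 ∧ dbl p = α) ∨ (δ < pos α p ∧ pos α p ≤ 1 / 2) ∨
      (1 / 2 < pos α p ∧ 1 / 2 + δ < pos α p) := by
    rcases h1 with h1 | h1
    · have h2 := h1
      rw [dbl_eq_self_iff_pos] at h2
      rcases h2 with h2 | h2
      · exact .inl ⟨h2, h1⟩
      · right; left; constructor <;> linarith
    · rcases codeP_cases α p with ⟨k, k1, k2⟩ | ⟨k, k1, k2⟩ <;> rw [k2] at h1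
      · right; left; constructor <;> linarith
      · right; right; constructor <;> linarith
  rw [Ne, dbl_eq_self_iff_pos]
  rcases hcase with ⟨h, _⟩ | ⟨h, h'⟩ | ⟨h, h'⟩
  · have e : pos α (p - (δ : Angle)) = pos α p - δ + 1 := by
      rw [hp']; exact ar_add_of_mem (by linarith) (by linarith)
    rw [e]
    refine ⟨?_, by rintro (h | h) <;> linarith⟩
    rw [codeP, codeM, e, if_neg (by linarith), if_neg (by rintro ⟨_, _⟩; linarith)]
  · have e : pos α (p - (δ : Angle)) = pos α p - δ := by
      rw [hp]; exact ar_add_of_mem (by linarith) (by linarith)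
    rw [e]
    refine ⟨?_, by rintro (h | h) <;> linarith⟩
    rw [codeP, codeM, e, if_pos (by linarith), if_pos ⟨by linarith, h'⟩]
  · have e : pos α (p - (δ : Angle)) = pos α p - δ := by
      rw [hp]; exact ar_add_of_mem (by linarith) (by linarith)
    rw [e]
    refine ⟨?_, by rintro (h | h) <;> linarith⟩
    rw [codeP, codeM, e, if_neg (by linarith), if_neg (by rintro ⟨_, _⟩; linarith)]

lemma eventually_lt_const_mul {C r : ℝ} (hr : 0 < r) : ∀ᶠ ε : ℝ in 𝓝[>] 0, C * ε < r := by
  have : Tendsto (fun ε : ℝ => C * ε) (𝓝 0) (𝓝 (C * 0)) :=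
    Continuous.tendsto (by fun_prop) 0
  rw [mul_zero] at this
  exact (this.eventually (gt_mem_nhds hr)).filter_mono nhdsWithin_le_nhds

lemma eventually_kneading_add (α θ : Angle) (i : ℕ) :
    ∀ᶠ ε : ℝ in 𝓝[>] 0, kneading α (θ + (ε : Angle)) i = some (KP α θ i) := by
  have hr : 0 < 1 - ar α (dbl (dbl^[i] θ)) := by
    have := ar_lt_one α (dbl (dbl^[i] θ)); linarith
  filter_upwards [eventually_lt_const_mul (C := 2 * 2 ^ i) hr, self_mem_nhdsWithin] with ε h1 h0
  have h0 : 0 < ε := h0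
  have := codeP_add (α := α) (p := dbl^[i] θ) (δ := 2 ^ i * ε) (by positivity) (by linarith)
  rw [← iter_dbl_add] at this
  rw [kneading_eq_some_iff, Function.iterate_succ_apply']
  exact ⟨this.2, this.1⟩

lemma eventually_kneading_sub (α θ : Angle) (i : ℕ) :
    ∀ᶠ ε : ℝ in 𝓝[>] 0, kneading α (θ - (ε : Angle)) i = some (KM α θ i) := by
  obtain ⟨r, hr, hr'⟩ : ∃ r : ℝ, 0 < r ∧ ∀ δ, 2 * δ < r → δ < 1 / 2 ∧
      (dbl (dbl^[i] θ) = α ∨ 2 * δ < ar α (dbl (dbl^[i] θ))) := by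
    by_cases h : dbl (dbl^[i] θ) = α
    · exact ⟨1, one_pos, fun δ hδ => ⟨by linarith, .inl h⟩⟩
    · refine ⟨_, ar_pos (Ne.symm h), fun δ hδ => ⟨?_, .inr hδ⟩⟩
      have := ar_lt_one α (dbl (dbl^[i] θ))
      linarith
  filter_upwards [eventually_lt_const_mul (C := 2 * 2 ^ i) hr, self_mem_nhdsWithin] with ε h1 h0
  have h0 : 0 < ε := h0
  obtain ⟨h2, h3⟩ := hr' (2 ^ i * ε) (by linarith)
  have := codeP_sub (α := α) (p := dbl^[i] θ) (δ := 2 ^ i * ε) (by positivity) h2 h3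
  rw [← iter_dbl_sub] at this
  rw [kneading_eq_some_iff, Function.iterate_succ_apply']
  exact ⟨this.2, this.1⟩

lemma eventually_nhds_of_add {θ : Angle} {P : Angle → Prop}
    (h : ∀ᶠ r : ℝ in 𝓝 0, P (θ + (r : Angle))) : ∀ᶠ z in 𝓝 θ, P z := by
  have h1 : Tendsto (fun z : Angle => z - θ) (𝓝 θ) (𝓝 ((0 : ℝ) : Angle)) := by
    have : Tendsto (fun z : Angle => z - θ) (𝓝 θ) (𝓝 (θ - θ)) :=
      Continuous.tendsto (by fun_prop) θ
    simpa using this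
  have h2 : ∀ᶠ z : Angle in 𝓝 ((0 : ℝ) : Angle), P (θ + z) := by
    have : 𝓝 ((0 : ℝ) : Angle) = map ((↑) : ℝ → Angle) (𝓝 0) := QuotientAddGroup.nhds_eq _ _
    rw [this]
    exact h
  filter_upwards [h1.eventually h2] with z hz
  simpa using hz

/-- The first `N` symbols of both itineraries of `z` agree with `s`. -/
def Agree (α : Angle) (N : ℕ) (s : Seq2) (z : Angle) : Prop :=
  ∀ i < N, KP α z i = s i ∧ KM α z i = s i

lemma eventually_agree_add (α θ : Angle) (N : ℕ) :
    ∀ᶠ ε : ℝ in 𝓝[>] 0, Agree α N (KP α θ) (θ + (ε : Angle)) := by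
  have : ∀ᶠ ε : ℝ in 𝓝[>] 0, ∀ i ∈ Finset.range N,
      kneading α (θ + (ε : Angle)) i = some (KP α θ i) :=
    (Finset.eventually_all _).2 fun i _ => eventually_kneading_add α θ i
  filter_upwards [this] with ε h i hi
  have := kneading_eq_some_iff.1 (h i (Finset.mem_range.2 hi))
  rw [Function.iterate_succ_apply'] at this
  exact ⟨this.2, (codeM_eq_codeP this.1).trans this.2⟩

lemma eventually_agree_sub (α θ : Angle) (N : ℕ) :
    ∀ᶠ ε : ℝ in 𝓝[>] 0, Agree α N (KM α θ) (θ - (ε : Angle)) := by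
  have : ∀ᶠ ε : ℝ in 𝓝[>] 0, ∀ i ∈ Finset.range N,
      kneading α (θ - (ε : Angle)) i = some (KM α θ i) :=
    (Finset.eventually_all _).2 fun i _ => eventually_kneading_sub α θ i
  filter_upwards [this] with ε h i hi
  have := kneading_eq_some_iff.1 (h i (Finset.mem_range.2 hi))
  rw [Function.iterate_succ_apply'] at this
  exact ⟨this.2, (codeM_eq_codeP this.1).trans this.2⟩

lemma eventually_agree (α θ : Angle) (N : ℕ) :
    ∀ᶠ z in 𝓝 θ, z = θ ∨ Agree α N (KP α θ) z ∨ Agree α N (KM α θ) z := by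
  apply eventually_nhds_of_add
  obtain ⟨a, ha, ha'⟩ := mem_nhdsGT_iff_exists_Ioo_subset.1 (eventually_agree_add α θ N)
  obtain ⟨b, hb, hb'⟩ := mem_nhdsGT_iff_exists_Ioo_subset.1 (eventually_agree_sub α θ N)
  have ha : 0 < a := ha
  have hb : 0 < b := hb
  filter_upwards [Ioo_mem_nhds (neg_lt_zero.2 hb) ha] with r hr
  rcases lt_trichotomy r 0 with h | h | h
  · right; right
    have := hb' (show -r ∈ Set.Ioo 0 b from ⟨by linarith, by linarith [hr.1]⟩)
    simpa using this
  · left; simp [h]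
  · right; left
    exact ha' ⟨h, hr.2⟩

/-- If `P` fails at `m` and `Q` fails at `n`, both fail at the maximum. This passes from
alternatives on finite prefixes to alternatives on whole sequences. -/
lemma forall_or_of_forall_or {P Q : ℕ → Prop} (hP : ∀ m n, m ≤ n → P n → P m)
    (hQ : ∀ m n, m ≤ n → Q n → Q m) (h : ∀ n, P n ∨ Q n) : (∀ n, P n) ∨ ∀ n, Q n := by
  by_contra! hc
  obtain ⟨⟨m, hm⟩, n, hn⟩ := hc
  rcases h (max m n) with h | h
  · exact hm (hP _ _ (le_max_left _ _) h)
  · exact hn (hQ _ _ (le_max_right _ _) h)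

/-- The itineraries of a limit of points whose itineraries converge to `s`. -/
lemma KP_or_KM_of_forall_nhds {α θ : Angle} {s : Seq2}
    (h : ∀ N, ∀ U ∈ 𝓝 θ, ∃ z ∈ U, (∀ i < N, KP α z i = s i) ∨ ∀ i < N, KM α z i = s i) :
    KP α θ = s ∨ KM α θ = s := by
  have key : (∀ N, ∀ i < N, KP α θ i = s i) ∨ ∀ N, ∀ i < N, KM α θ i = s i := by
    refine forall_or_of_forall_or (fun m n hmn h i hi => h i (by omega))
      (fun m n hmn h i hi => h i (by omega)) fun N => ?_
    obtain ⟨z, hz, hz'⟩ := h N _ (eventually_agree α θ N)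
    rcases hz with rfl | hz | hz
    · exact hz'
    · left
      rcases hz' with h' | h'
      · exact fun i hi => (hz i hi).1.symm.trans (h' i hi)
      · exact fun i hi => (hz i hi).2.symm.trans (h' i hi)
    · right
      rcases hz' with h' | h'
      · exact fun i hi => (hz i hi).1.symm.trans (h' i hi)
      · exact fun i hi => (hz i hi).2.symm.trans (h' i hi)
  rcases key with h | h
  · exact .inl (funext fun i => h (i + 1) i (by omega))
  · exact .inr (funext fun i => h (i + 1) i (by omega))

lemma KP_or_KM_of_tendsto {α θ : Angle} {s : Seq2} {x : ℕ → Angle}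
    (hx : Tendsto x atTop (𝓝 θ))
    (h : ∀ N, ∀ᶠ k in atTop, (∀ i < N, KP α (x k) i = s i) ∨ ∀ i < N, KM α (x k) i = s i) :
    KP α θ = s ∨ KM α θ = s := by
  apply KP_or_KM_of_forall_nhds
  intro N U hU
  obtain ⟨k, h1, h2⟩ := ((hx.eventually hU).and (h N)).exists
  exact ⟨x k, h1, h2⟩

/-! ### Itineraries of marked angles -/

lemma hasItin_plain {α θ : Angle} {s : Seq2} :
    HasItin α (.plain θ) s ↔ (∀ i, dbl^[i + 1] θ ≠ α) ∧ KP α θ = s := by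
  simp only [HasItin, kneading_eq_some_iff, forall_and, funext_iff]

lemma hasItin_plus {α θ : Angle} {s : Seq2} : HasItin α (.plus θ) s ↔ KP α θ = s := by
  constructor
  · intro h
    funext i
    obtain ⟨ε, h1, h2⟩ := ((h i).and (eventually_kneading_add α θ i)).exists
    exact Option.some_injective _ (h2.symm.trans h1)
  · rintro rfl i
    exact eventually_kneading_add α θ i

lemma hasItin_minus {α θ : Angle} {s : Seq2} : HasItin α (.minus θ) s ↔ KM α θ = s := by
  constructor
  · intro h
    funext i
    obtain ⟨ε, h1, h2⟩ := ((h i).and (eventually_kneading_sub α θ i)).exists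
    exact Option.some_injective _ (h2.symm.trans h1)
  · rintro rfl i
    exact eventually_kneading_sub α θ i

lemma KP_or_KM_of_hasItin {α : Angle} {ξ : MarkedAngle} {s : Seq2} (h : HasItin α ξ s) :
    KP α ξ.angle = s ∨ KM α ξ.angle = s := by
  cases ξ with
  | plain θ => exact .inl (hasItin_plain.1 h).2
  | plus θ => exact .inl (hasItin_plus.1 h)
  | minus θ => exact .inr (hasItin_minus.1 h)

lemma existsUnique_hasItin {α : Angle} {ξ : MarkedAngle} (hξ : ξ ∈ extAngles α) :
    ∃! s : Seq2, HasItin α ξ s := by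
  cases ξ with
  | plain θ =>
    have hξ : ¬ IsPreimage α θ := hξ
    simp only [hasItin_plain]
    exact ⟨KP α θ, ⟨fun i h => hξ ⟨_, h⟩, rfl⟩, fun s hs => hs.2.symm⟩
  | plus θ => simp only [hasItin_plus]; exact ⟨_, rfl, fun s hs => hs.symm⟩
  | minus θ => simp only [hasItin_minus]; exact ⟨_, rfl, fun s hs => hs.symm⟩

lemma exists_hasItin (α : Angle) {θ : Angle} {s : Seq2} (h : KP α θ = s ∨ KM α θ = s) :
    ∃ ξ ∈ extAngles α, ξ.angle = θ ∧ HasItin α ξ s := by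
  by_cases hp : IsPreimage α θ
  · rcases h with h | h
    · exact ⟨.plus θ, hp, rfl, hasItin_plus.2 h⟩
    · exact ⟨.minus θ, hp, rfl, hasItin_minus.2 h⟩
  · rw [KM_eq_KP_of_not_isPreimage hp, or_self] at h
    exact ⟨.plain θ, hp, rfl, hasItin_plain.2 ⟨fun i h => hp ⟨_, h⟩, h⟩⟩

/-- Every sequence is an itinerary. -/
lemma exists_KP_or_KM (α : Angle) (s : Seq2) : ∃ θ, KP α θ = s ∨ KM α θ = s := by
  -- Points realising longer and longer prefixes of `s` accumulate somewhere; the limit has `s` as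
  -- one of its one-sided itineraries.
  choose x _ hx using fun k => exists_KP α 0 s k
  obtain ⟨θ, -, φ, hφ, hlim⟩ := isCompact_univ.tendsto_subseq (x := x) fun _ => Set.mem_univ _
  refine ⟨θ, KP_or_KM_of_tendsto hlim fun N => ?_⟩
  filter_upwards [eventually_ge_atTop N] with k hk
  exact .inl fun i hi => hx (φ k) i (by have := hφ.id_le k; simp at this; omega)

/-! ### Inverse branches -/

variable {α : Angle}

lemma half0_ne_half1 (θ : Angle) : half0 θ ≠ half1 θ := by
  intro h
  have := ar_half0_half1 θ
  rw [h, ar_self] at this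
  norm_num at this

lemma eq_half_of_dbl {ζ θ : Angle} (h : dbl ζ = θ) : ζ = half0 θ ∨ ζ = half1 θ := by
  rw [dbl_eq_self_iff_pos] at h
  rcases h with h | h
  · exact .inl (pos_inj (α := θ) (h.trans (pos_half0 θ).symm))
  · exact .inr (pos_inj (α := θ) (h.trans (pos_half1 θ).symm))

lemma codeP_ne_of_dbl_eq {p q : Angle} (h : dbl p = dbl q) (hpq : p ≠ q) :
    codeP α p ≠ codeP α q := fun h' => hpq (eq_of_dbl_of_codeP h h')

lemma codeM_ne_of_dbl_eq {p q : Angle} (h : dbl p = dbl q) (hpq : p ≠ q) :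
    codeM α p ≠ codeM α q := fun h' => hpq (eq_of_dbl_of_codeM h h')

lemma dbl_dotPt (hper : α ∈ Function.periodicPts dbl) : dbl (dotPt α) = α := by
  have h := Function.minimalPeriod_pos_of_mem_periodicPts hper
  rw [dotPt, ← Function.iterate_succ_apply' dbl, per]
  have : (Function.minimalPeriod dbl α - 1).succ = Function.minimalPeriod dbl α := by omega
  rw [this]
  exact Function.iterate_minimalPeriod

lemma dbl_ddotPt (α : Angle) : dbl (ddotPt α) = α := by
  unfold ddotPt; split_ifs
  · exact dbl_half1 α
  · exact dbl_half0 α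

lemma dotPt_ne_ddotPt (α : Angle) : dotPt α ≠ ddotPt α := by
  unfold ddotPt; split_ifs with h
  · rw [h]; exact half0_ne_half1 α
  · exact h

lemma eq_ddotPt (hper : α ∈ Function.periodicPts dbl) {ζ : Angle} (h : dbl ζ = α)
    (h' : ζ ≠ dotPt α) : ζ = ddotPt α := by
  have a := eq_half_of_dbl h
  have b := eq_half_of_dbl (dbl_dotPt hper)
  have c := eq_half_of_dbl (dbl_ddotPt α)
  have d := dotPt_ne_ddotPt α
  grind

lemma dbl_branch (hper : α ∈ Function.periodicPts dbl) (t s : Fin 2) (θ : Angle) :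
    dbl (branch α t s θ) = θ := by
  unfold branch
  by_cases h1 : θ = α
  · rw [if_pos h1, h1]
    split_ifs
    · exact dbl_dotPt hper
    · exact dbl_ddotPt α
  · rw [if_neg h1]
    by_cases h2 : half0 θ ∈ (if s = 0 then arcA α else arcB α)
    · rw [if_pos h2, dbl_half0]
    · rw [if_neg h2, dbl_half1]

lemma codeP_branch_of_ne (t s : Fin 2) {θ : Angle} (h : θ ≠ α) :
    codeP α (branch α t s θ) = s := by
  have hmem : half0 θ ∈ (if s = 0 then arcA α else arcB α) ↔ codeP α (half0 θ) = s := by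
    have h1 : dbl (half0 θ) ≠ α := by rwa [dbl_half0]
    rw [Ne, dbl_eq_self_iff_pos, not_or] at h1
    have h0 := pos_nonneg α (half0 θ)
    rcases fin2_cases s with rfl | rfl
    · rw [if_pos rfl, mem_arcA]
      rcases codeP_cases α (half0 θ) with ⟨k, k1, _⟩ | ⟨k, k1, _⟩ <;> rw [k]
      · simp only [iff_true]; exact ⟨lt_of_le_of_ne h0 (Ne.symm h1.1), k1⟩
      · simp; intro _; linarith
    · rw [if_neg (by simp), mem_arcB]
      rcases codeP_cases α (half0 θ) with ⟨k, k1, _⟩ | ⟨k, k1, _⟩ <;> rw [k]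
      · simp; linarith
      · simp only [iff_true]; exact lt_of_le_of_ne k1 (Ne.symm h1.2)
  unfold branch
  rw [if_neg h]
  by_cases h2 : codeP α (half0 θ) = s
  · rw [if_pos (hmem.2 h2), h2]
  · rw [if_neg (fun h3 => h2 (hmem.1 h3))]
    have := codeP_ne_of_dbl_eq (α := α) ((dbl_half0 θ).trans (dbl_half1 θ).symm)
      (half0_ne_half1 θ)
    omega

/-- The superscript only matters at `α`. Taking for it the symbol of `dotPt α` from above makes the
branch the inverse of doubling on a half-open semicircle, without exception; the symbol from below
plays the same role for `codeM`. -/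
lemma codeP_branch (hper : α ∈ Function.periodicPts dbl) (s : Fin 2) (θ : Angle) :
    codeP α (branch α (codeP α (dotPt α)) s θ) = s := by
  by_cases h : θ = α
  · unfold branch
    rw [if_pos h]
    have := codeP_ne_of_dbl_eq (α := α) ((dbl_dotPt hper).trans (dbl_ddotPt α).symm)
      (dotPt_ne_ddotPt α)
    split_ifs <;> omega
  · exact codeP_branch_of_ne _ _ h

lemma codeM_branch (hper : α ∈ Function.periodicPts dbl) (s : Fin 2) (θ : Angle) :
    codeM α (branch α (codeM α (dotPt α)) s θ) = s := by
  by_cases h : θ = α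
  · unfold branch
    rw [if_pos h]
    have := codeM_ne_of_dbl_eq (α := α) ((dbl_dotPt hper).trans (dbl_ddotPt α).symm)
      (dotPt_ne_ddotPt α)
    split_ifs <;> omega
  · rw [codeM_eq_codeP (by rwa [dbl_branch hper]), codeP_branch_of_ne _ _ h]

lemma codeM_ne_codeP {θ : Angle} (h : dbl θ = α) : codeM α θ ≠ codeP α θ :=
  fun h' => codeM_eq_codeP_iff.1 h' h

lemma eq_branch_of_ne (hper : α ∈ Function.periodicPts dbl) (t : Fin 2) {ζ : Angle}
    (h : dbl ζ ≠ α) : branch α t (codeP α ζ) (dbl ζ) = ζ :=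
  eq_of_dbl_of_codeP (dbl_branch hper _ _ _) (codeP_branch_of_ne _ _ h)

lemma iter_branchWord (hper : α ∈ Function.periodicPts dbl) (t : Fin 2) (w : List (Fin 2))
    (θ : Angle) : dbl^[w.length] (branchWord α t w θ) = θ := by
  induction w with
  | nil => rfl
  | cons s w ih =>
    rw [List.length_cons, Function.iterate_succ_apply]
    change dbl^[w.length] (dbl (branch α t s (branchWord α t w θ))) = θ
    rw [dbl_branch hper, ih]

lemma KP_branchWord (hper : α ∈ Function.periodicPts dbl) (w : List (Fin 2)) (θ : Angle)
    (i : ℕ) (hi : i < w.length) : KP α (branchWord α (codeP α (dotPt α)) w θ) i = w[i] := by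
  induction w generalizing i with
  | nil => simp at hi
  | cons s w ih =>
    change KP α (branch α _ s (branchWord α _ w θ)) i = _
    cases i with
    | zero => exact codeP_branch hper _ _
    | succ i =>
      have := ih i (by simpa using hi)
      simp only [List.getElem_cons_succ]
      rw [← this, add_comm, ← KP_iter]
      simp only [Function.iterate_one]
      rw [dbl_branch hper]

lemma KM_branchWord (hper : α ∈ Function.periodicPts dbl) (w : List (Fin 2)) (θ : Angle)
    (i : ℕ) (hi : i < w.length) : KM α (branchWord α (codeM α (dotPt α)) w θ) i = w[i] := by
  induction w generalizing i with
  | nil => simp at hi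
  | cons s w ih =>
    change KM α (branch α _ s (branchWord α _ w θ)) i = _
    cases i with
    | zero => exact codeM_branch hper _ _
    | succ i =>
      have := ih i (by simpa using hi)
      simp only [List.getElem_cons_succ]
      rw [← this, add_comm, ← KM_iter]
      simp only [Function.iterate_one]
      rw [dbl_branch hper]

/-- A point none of whose first images is `α` is recovered from its itinerary by the branches. -/
lemma branchWord_eq (hper : α ∈ Function.periodicPts dbl) (t : Fin 2) (w : List (Fin 2))
    (ζ : Angle) (hw : ∀ i (hi : i < w.length), w[i] = KP α ζ i)
    (hne : ∀ i < w.length, dbl^[i + 1] ζ ≠ α) :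
    branchWord α t w (dbl^[w.length] ζ) = ζ := by
  induction w generalizing ζ with
  | nil => rfl
  | cons s w ih =>
    rw [List.length_cons, Function.iterate_succ_apply]
    change branch α t s (branchWord α t w _) = ζ
    rw [ih (dbl ζ)]
    · have h0 := hw 0 (by simp)
      simp only [List.getElem_cons_zero] at h0
      rw [h0]
      exact eq_branch_of_ne hper t (hne 0 (by simp))
    · intro i hi
      have := hw (i + 1) (by simpa using hi)
      simp only [List.getElem_cons_succ] at this
      rw [this, add_comm, ← KP_iter]; rfl
    · intro i hi
      rw [← Function.iterate_succ_apply]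
      exact hne (i + 1) (by simpa using hi)

/-! ### Open arcs between two angles -/

variable {β : Angle}

/-- `θ` lies in the open arc from `β` to `α`. -/
def Between (β α θ : Angle) : Prop := 0 < ar β θ ∧ ar β θ < ar β α

/-- Measuring from `α` instead of `β` puts the arc at the end of `[0, 1)`, in the form that combines
with `codeP_cases`. -/
lemma between_iff (h : β ≠ α) {θ : Angle} : Between β α θ ↔ 1 - ar β α < ar α θ := by
  have h1 := ar_symm h
  have h2 := ar_cases α β θ
  have h3 := ar_lt_one α θ
  have h4 := ar_nonneg α θ
  unfold Between
  rw [h1] at h2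
  rcases h2 with ⟨h2, h2'⟩ | ⟨h2, h2'⟩ <;> rw [h2']
  · constructor
    · rintro ⟨h5, h6⟩; linarith
    · intro h5; constructor <;> linarith
  · constructor
    · rintro ⟨h5, h6⟩; linarith
    · intro h5; linarith

lemma between_neg {θ : Angle} : Between (-α) (-β) (-θ) ↔ Between β α θ := by
  unfold Between
  rw [ar_neg, ar_neg]
  have h1 := ar_cases β θ α
  have a := ar_nonneg β θ
  have b := ar_lt_one β θ
  have c := ar_lt_one β α
  rcases h1 with ⟨h1, h1'⟩ | ⟨h1, h1'⟩ <;> rw [h1']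
  · constructor <;> rintro ⟨h2, h3⟩ <;> refine ⟨by linarith, ?_⟩
    · rcases h1.eq_or_lt with h | h <;> linarith
    · linarith
  · constructor <;> rintro ⟨h2, h3⟩ <;> exfalso <;> linarith

/-! ### Periodic angles -/

lemma per_pos (hper : α ∈ Function.periodicPts dbl) : 0 < per α :=
  Function.minimalPeriod_pos_of_mem_periodicPts hper

lemma iter_per (α : Angle) : dbl^[per α] α = α := Function.iterate_minimalPeriod

lemma iter_eq_self_iff {k : ℕ} : dbl^[k] α = α ↔ per α ∣ k :=
  Function.isPeriodicPt_iff_minimalPeriod_dvd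

lemma two_le_per (hper : α ∈ Function.periodicPts dbl) (h0 : α ≠ 0) : 2 ≤ per α := by
  have h1 := per_pos hper
  by_contra! h
  have h2 : per α = 1 := by omega
  have h3 := iter_per α
  rw [h2, Function.iterate_one, dbl, two_nsmul] at h3
  exact h0 (by simpa using h3)

lemma ne_zero_of_two_le_per (h : 2 ≤ per α) : α ≠ 0 := by
  rintro rfl
  have : per 0 ∣ 1 := iter_eq_self_iff.1 (by simp [dbl])
  have := Nat.le_of_dvd one_pos this
  omega

lemma iter_dotPt (hper : α ∈ Function.periodicPts dbl) {k : ℕ} (h : dbl^[k + 1] α = α) :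
    dbl^[k] α = dotPt α := by
  rw [iter_eq_self_iff] at h
  obtain ⟨q, hq⟩ := h
  have hp := per_pos hper
  cases q with
  | zero => omega
  | succ q =>
    have : k = per α - 1 + per α * q := by
      have : per α * (q + 1) = per α * q + per α := by ring
      omega
    rw [this, Function.iterate_add_apply, iter_eq_self_iff.2 (Dvd.intro q rfl), dotPt]

/-- A periodic orbit contains only one preimage of each of its points, so the other preimage of `α`
is strictly preperiodic. -/
lemma iter_ne_ddotPt (hper : α ∈ Function.periodicPts dbl) (k : ℕ) : dbl^[k] α ≠ ddotPt α := by
  intro h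
  have h1 : dbl^[k + 1] α = α := by rw [Function.iterate_succ_apply', h, dbl_ddotPt]
  exact dotPt_ne_ddotPt α ((iter_dotPt hper h1).symm.trans h)

lemma pos_self (α : Angle) : pos α α = rep α / 2 := by
  have h0 := rep_nonneg α
  have h1 := rep_lt_one α
  have := ar_add_of_mem (p := half0 α) (r := rep α / 2) (by linarith) (by linarith)
  have h2 : half0 α + ((rep α / 2 : ℝ) : Angle) = α := by
    rw [half0, ← AddCircle.coe_add, add_halves, coe_rep]
  rwa [h2] at this

lemma codeP_self (α : Angle) : codeP α α = 0 := by
  have := rep_lt_one α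
  rw [codeP, pos_self, if_pos (by linarith)]

/-! ### The order of points with other symbols -/

/-- A chord with both ends in one semicircle has the whole opposite semicircle on a single side. -/
lemma ar_lt_iff_of_codeP_ne {p q r r' : Angle} (hq : codeP α q = codeP α p)
    (hr : codeP α r ≠ codeP α p) (hr' : codeP α r' ≠ codeP α p) :
    ar p r < ar p q ↔ ar p r' < ar p q := by
  have h2 := ar_pos_cases α p r
  have h3 := ar_pos_cases α p r'
  have h4 := ar_pos_cases α p q
  have b1 := pos_nonneg α p
  have b2 := pos_nonneg α q
  have b3 := pos_nonneg α r
  have b3' := pos_nonneg α r'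
  have b4 := pos_lt_one α p
  have b5 := pos_lt_one α q
  have b6 := pos_lt_one α r
  have b6' := pos_lt_one α r'
  rcases codeP_cases α p with ⟨k, k1, -⟩ | ⟨k, k1, -⟩ <;>
  rcases codeP_cases α q with ⟨l, l1, -⟩ | ⟨l, l1, -⟩ <;>
  rcases codeP_cases α r with ⟨m, m1, -⟩ | ⟨m, m1, -⟩ <;>
  rcases codeP_cases α r' with ⟨o, o1, -⟩ | ⟨o, o1, -⟩ <;>
  simp only [k, l, m, o, ne_eq, not_true_eq_false, one_ne_zero, zero_ne_one] at hq hr hr' <;>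
  rcases h2 with ⟨h2, h2'⟩ | ⟨h2, h2'⟩ <;> rcases h3 with ⟨h3, h3'⟩ | ⟨h3, h3'⟩ <;>
  rcases h4 with ⟨h4, h4'⟩ | ⟨h4, h4'⟩ <;>
  first
  | (exfalso; linarith)
  | (rw [h2', h3', h4']; constructor <;> intro <;> linarith)

/-- On a half-open semicircle doubling is injective and keeps the circular order, so it preserves
sides of chords. -/
lemma between_dbl {p q r : Angle} (hq : codeP α q = codeP α p) (hr : codeP α r = codeP α p) :
    Between p q r ↔ Between (dbl p) (dbl q) (dbl r) := by
  unfold Between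
  rw [ar_lt_ar_dbl hr hq]
  refine and_congr_left fun _ => ?_
  constructor
  · intro h
    refine ar_pos fun h' => ?_
    rw [eq_of_dbl_of_codeP h' hr.symm, ar_self] at h
    exact lt_irrefl _ h
  · intro h
    refine ar_pos fun h' => ?_
    rw [h', ar_self] at h
    exact lt_irrefl _ h

lemma between_iff_of_codeP_ne {p q r r' : Angle} (hq : codeP α q = codeP α p)
    (hr : codeP α r ≠ codeP α p) (hr' : codeP α r' ≠ codeP α p) :
    Between p q r ↔ Between p q r' := by
  unfold Between
  rw [ar_lt_iff_of_codeP_ne hq hr hr']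
  refine and_congr_left fun _ => ⟨fun _ => ar_pos ?_, fun _ => ar_pos ?_⟩
  · rintro rfl; exact hr' rfl
  · rintro rfl; exact hr rfl

/-! ### Companion pairs -/

/-- `β` is fixed by the `n`-th iterate of doubling, where `n` is the period of `α`, and the arc
from `β` to `α` contains no point of the orbit of `α`. -/
structure WeakPair (α β : Angle) : Prop where
  periodic : α ∈ Function.periodicPts dbl
  ne_zero : α ≠ 0
  iter_fix : dbl^[per α] β = β
  ne : β ≠ α
  not_between : ∀ i, ¬ Between β α (dbl^[i] α)

lemma iter_fix_of_dvd {k N : ℕ} (h : dbl^[k] β = β) (hN : k ∣ N) : dbl^[N] β = β := by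
  obtain ⟨q, rfl⟩ := hN
  exact Function.IsPeriodicPt.mul_const h q

lemma two_pow_mul_le {i N : ℕ} {δ : ℝ} (h0 : 0 ≤ δ) (h : i ≤ N) : 2 ^ i * δ ≤ 2 ^ N * δ :=
  mul_le_mul_of_nonneg_right (pow_le_pow_right₀ one_le_two h) h0

/-- Points slightly above `β` follow the orbit of `β`. -/
lemma WeakPair.KP_add (h : WeakPair α β) {N i : ℕ} {δ : ℝ} (hN : per α ∣ N) (h0 : 0 ≤ δ)
    (hδ : 2 ^ N * δ ≤ ar β α) (hi : i < N) :
    KP α (β + (δ : Angle)) i = KP α β i ∨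
      (2 ^ N * δ = ar β α ∧ dbl^[i + 1] (β + (δ : Angle)) = α) := by
  rcases h0.eq_or_lt with rfl | h0
  · left; simp
  have hlt := ar_lt_one β α
  by_cases hc : 2 * (2 ^ i * δ) < 1 - ar α (dbl (dbl^[i] β))
  · left
    have := (codeP_add (α := α) (p := dbl^[i] β) (δ := 2 ^ i * δ) (by positivity) hc).1
    rw [← iter_dbl_add] at this
    exact this
  · right
    rw [← Function.iterate_succ_apply' dbl] at hc
    set q := dbl^[i + 1] β with hq
    change ¬ _ < 1 - ar α q at hc
    have hle := two_pow_mul_le h0.le (show i + 1 ≤ N by omega)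
    rw [pow_succ] at hle
    have hqα : q ≠ α := by
      intro h'
      rw [h', ar_self] at hc
      linarith
    have h1 : ar q α ≤ 2 ^ (i + 1) * δ := by
      rw [ar_symm hqα] at hc; rw [pow_succ]; linarith
    have h2 : 2 ^ (N - (i + 1)) * ar q α ≤ 2 ^ N * δ := by
      calc (2 : ℝ) ^ (N - (i + 1)) * ar q α ≤ 2 ^ (N - (i + 1)) * (2 ^ (i + 1) * δ) := by gcongr
        _ = 2 ^ N * δ := by rw [← mul_assoc, ← pow_add]; congr 2; omega
    have h3 := ar_iter (i := N - (i + 1)) (p := q) (q := α) (by linarith)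
    have h4 : dbl^[N - (i + 1)] q = β := by
      rw [hq, ← Function.iterate_add_apply]
      have : N - (i + 1) + (i + 1) = N := by omega
      rw [this]; exact iter_fix_of_dvd h.iter_fix hN
    rw [h4] at h3
    have h5 := h.not_between (N - (i + 1))
    have h6 : 0 < ar β (dbl^[N - (i + 1)] α) := by
      rw [h3]; exact mul_pos (by positivity) (ar_pos hqα)
    have h7 : ar β α ≤ ar β (dbl^[N - (i + 1)] α) := by
      by_contra! h7; exact h5 ⟨h6, h7⟩
    have h8 : 2 ^ N * δ = ar β α := by linarith
    refine ⟨h8, ?_⟩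
    have h9 : ar q α = 2 ^ (i + 1) * δ := by
      refine le_antisymm h1 ?_
      by_contra! hc'
      have : 2 ^ (N - (i + 1)) * ar q α < 2 ^ (N - (i + 1)) * (2 ^ (i + 1) * δ) :=
        mul_lt_mul_of_pos_left hc' (by positivity)
      rw [← mul_assoc, ← pow_add] at this
      have e : N - (i + 1) + (i + 1) = N := by omega
      rw [e] at this
      linarith
    rw [iter_dbl_add, ← h9]
    exact add_ar q α

lemma WeakPair.KP_add_of_lt (h : WeakPair α β) {N i : ℕ} {δ : ℝ} (hN : per α ∣ N) (h0 : 0 ≤ δ)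
    (hδ : 2 ^ N * δ < ar β α) (hi : i < N) : KP α (β + (δ : Angle)) i = KP α β i :=
  (h.KP_add hN h0 hδ.le hi).resolve_right fun h' => by linarith [h'.1]

/-- Points slightly below `α` follow the orbit of `α` seen from below. -/
lemma WeakPair.KP_sub (h : WeakPair α β) {N i : ℕ} {δ : ℝ} (hN : per α ∣ N) (h0 : 0 < δ)
    (hδ : 2 ^ N * δ < ar β α) (hi : i < N) : KP α (α - (δ : Angle)) i = KM α α i := by
  have hlt := ar_lt_one β α
  have hle := two_pow_mul_le h0.le (show i + 1 ≤ N by omega)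
  have hle' := hle
  rw [pow_succ] at hle
  have key : dbl (dbl^[i] α) = α ∨ 2 * (2 ^ i * δ) < ar α (dbl (dbl^[i] α)) := by
    by_contra! hc
    obtain ⟨hqα, hc⟩ := hc
    rw [← Function.iterate_succ_apply' dbl] at hc hqα
    set q := dbl^[i + 1] α with hq
    change ar α q ≤ _ at hc
    have h2 : 2 ^ (N - (i + 1)) * ar α q ≤ 2 ^ N * δ := by
      calc (2 : ℝ) ^ (N - (i + 1)) * ar α q ≤ 2 ^ (N - (i + 1)) * (2 ^ (i + 1) * δ) := by
            gcongr; rw [pow_succ]; linarith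
        _ = 2 ^ N * δ := by rw [← mul_assoc, ← pow_add]; congr 2; omega
    -- The expanded arc now runs down from `α` to a point of its orbit and is shorter than `ar β α`.
    have h3 := ar_iter (i := N - (i + 1)) (p := α) (q := q) (by linarith)
    have h4 : dbl^[N - (i + 1)] q = α := by
      rw [hq, ← Function.iterate_add_apply]
      have : N - (i + 1) + (i + 1) = N := by omega
      rw [this]; exact iter_eq_self_iff.2 hN
    rw [h4] at h3
    have h5 := h.not_between (N - (i + 1))
    have h6 : 0 < ar (dbl^[N - (i + 1)] α) α := by
      rw [h3]; exact mul_pos (by positivity) (ar_pos (Ne.symm hqα))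
    rw [← between_neg] at h5
    apply h5
    unfold Between
    rw [ar_neg, ar_neg]
    exact ⟨h6, by linarith⟩
  have := (codeP_sub (α := α) (p := dbl^[i] α) (δ := 2 ^ i * δ) (by positivity) (by linarith)
    key).1
  rw [← iter_dbl_sub] at this
  exact this

lemma exists_lt_two_pow_mul {δ C : ℝ} (h : 0 < δ) : ∃ k : ℕ, C < 2 ^ k * δ := by
  obtain ⟨k, hk⟩ := pow_unbounded_of_one_lt (C / δ) (one_lt_two (α := ℝ))
  exact ⟨k, by rwa [div_lt_iff₀ h] at hk⟩

/-- A weak pair whose members have equal itineraries. -/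
structure PrePair (α β : Angle) : Prop extends WeakPair α β where
  KP_eq : KP α β = KP α α
  ar_lt : ar β α < 1 / 2

/-- The period map fixes both ends and preserves order among points with this itinerary, so the
image stays in the arc. Pulling it back affinely near `β` gives a point with the same symbols and
image as `a`, hence `a` itself; so the distance to `β` is multiplied exactly. -/
lemma PrePair.scale (h : PrePair α β) {a : Angle} (ha : KP α a = KP α α)
    (hV : Between β α a) :
    Between β α (dbl^[per α] a) ∧ ar β (dbl^[per α] a) = 2 ^ per α * ar β a := by
  have hb : Between β α (dbl^[per α] a) := by
    have h1 := ar_lt_ar_iter (α := α) (p := β) (q := a) (r := α) (per α)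
      (fun i _ => by rw [ha, h.KP_eq]) (fun i _ => by rw [h.KP_eq])
    rw [h.iter_fix, iter_per] at h1
    refine ⟨ar_pos fun h' => ?_, h1.1 hV.2⟩
    have h2 : β = a := by
      refine eq_of_iter_of_KP (α := α) (per α) ?_ fun i _ => by rw [ha, h.KP_eq]
      rw [h.iter_fix, ← h']
    rw [h2] at hV
    exact absurd hV.1 (by rw [ar_self]; exact lt_irrefl _)
  refine ⟨hb, ?_⟩
  set δ := ar β (dbl^[per α] a) with hδ
  have hpow : (0 : ℝ) < 2 ^ per α := by positivity
  have e : 2 ^ per α * (δ / 2 ^ per α) = δ := by field_simp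
  have h0 : 0 ≤ δ / 2 ^ per α := by have := hb.1; positivity
  have hlt1 := ar_lt_one β α
  have h2 : β + ((δ / 2 ^ per α : ℝ) : Angle) = a := by
    refine eq_of_iter_of_KP (α := α) (per α) ?_ fun i hi => ?_
    · rw [iter_dbl_add, h.iter_fix, e, hδ, add_ar]
    · rw [h.KP_add_of_lt dvd_rfl h0 (by rw [e]; exact hb.2) hi, ha, h.KP_eq]
  have h3 : ar β a = δ / 2 ^ per α := by
    conv_lhs => rw [← h2]
    refine ar_add_of_mem h0 ?_
    calc δ / 2 ^ per α ≤ δ := div_le_self hb.1.le (one_le_pow₀ one_le_two)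
      _ < 1 := hb.2.trans hlt1
  rw [h3, e]

/-- No point between `β` and `α` has the itinerary of `α`. -/
lemma PrePair.not_between_of_KP_eq (h : PrePair α β) {a : Angle} (ha : KP α a = KP α α) :
    ¬ Between β α a := by
  intro hV
  have hKP : ∀ a, KP α a = KP α α → KP α (dbl^[per α] a) = KP α α := by
    intro a ha
    funext i
    rw [KP_iter, ha, ← KP_iter, iter_per]
  -- Repeated scaling would make the distance to `β` exceed the length of the circle.
  have key : ∀ k : ℕ, ∃ b, KP α b = KP α α ∧ Between β α b ∧ 2 ^ k * ar β a ≤ ar β b := by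
    intro k
    induction k with
    | zero => exact ⟨a, ha, hV, by simp⟩
    | succ k ih =>
      obtain ⟨b, h1, h2, h3⟩ := ih
      obtain ⟨h4, h5⟩ := h.scale h1 h2
      refine ⟨_, hKP b h1, h4, ?_⟩
      have : (2 : ℝ) ^ 1 ≤ 2 ^ per α := pow_le_pow_right₀ one_le_two (per_pos h.periodic)
      rw [h5, pow_succ]
      have := mul_le_mul_of_nonneg_right this (ar_nonneg β b)
      linarith
  obtain ⟨k, hk⟩ := exists_lt_two_pow_mul (C := 1) hV.1
  obtain ⟨b, -, h2, h3⟩ := key k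
  linarith [ar_lt_one β b]

/-- Points with equal itineraries are not separated by the pair. -/
lemma PrePair.between_of_KP_eq (h : PrePair α β) {a b : Angle} (hab : KP α a = KP α b)
    (ha : Between β α a) : Between β α b := by
  by_contra hb
  -- If `a` and `b` are separated by the pair, their images stay separated by the image chords. Were
  -- `a` ever in the semicircle opposite to the chord, so would be `b`, and nothing would be
  -- separated. So `a` shares the itinerary of the pair and cannot lie between its members.
  have key : ∀ i, Between (dbl^[i] β) (dbl^[i] α) (dbl^[i] a) ∧
      ¬ Between (dbl^[i] β) (dbl^[i] α) (dbl^[i] b) := by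
    intro i
    induction i with
    | zero => exact ⟨ha, hb⟩
    | succ i ih =>
      have e1 : codeP α (dbl^[i] α) = codeP α (dbl^[i] β) := (congrFun h.KP_eq i).symm
      have e2 : codeP α (dbl^[i] b) = codeP α (dbl^[i] a) := (congrFun hab i).symm
      simp only [Function.iterate_succ_apply']
      by_cases hc : codeP α (dbl^[i] a) = codeP α (dbl^[i] β)
      · rwa [← between_dbl e1 hc, ← between_dbl e1 (e2.trans hc)]
      · exact absurd ((between_iff_of_codeP_ne e1 hc (by rwa [e2])).1 ih.1) ih.2
  refine h.not_between_of_KP_eq ?_ ha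
  funext i
  rw [← h.KP_eq]
  have e1 : codeP α (dbl^[i] α) = codeP α (dbl^[i] β) := (congrFun h.KP_eq i).symm
  have e2 : codeP α (dbl^[i] b) = codeP α (dbl^[i] a) := (congrFun hab i).symm
  by_contra hc
  exact (key i).2 ((between_iff_of_codeP_ne e1 hc (by rwa [e2])).1 (key i).1)

lemma PrePair.between_iff_of_KP_eq (h : PrePair α β) {a b : Angle} (hab : KP α a = KP α b) :
    Between β α a ↔ Between β α b :=
  ⟨h.between_of_KP_eq hab, h.between_of_KP_eq hab.symm⟩

lemma PrePair.not_between' (h : PrePair α β) (i : ℕ) : ¬ Between β α (dbl^[i] β) := by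
  intro h'
  refine h.not_between i (h.between_of_KP_eq ?_ h')
  funext j
  rw [KP_iter, KP_iter, h.KP_eq]

/-- If `j = per β` were not a period of `α`, the points `dbl^[j * m] α` would all share the
itinerary of `β`. Since `dbl^[j]` fixes `β` and preserves order among them, they would move away
from `β` strictly monotonically, against periodicity. -/
lemma PrePair.per_eq (h : PrePair α β) : per β = per α := by
  have hn := per_pos h.periodic
  have hdvd : per β ∣ per α := iter_eq_self_iff.1 h.iter_fix
  refine Nat.dvd_antisymm hdvd ?_
  set j := per β with hj
  rw [← iter_eq_self_iff]
  by_contra hne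
  have hKP : ∀ m, KP α (dbl^[j * m] α) = KP α α := by
    intro m
    funext i
    rw [KP_iter, ← h.KP_eq, ← KP_iter, iter_fix_of_dvd (iter_per β) (Dvd.intro m rfl)]
  have hmono : ∀ m, ar β (dbl^[j * m] α) < ar β (dbl^[j * (m + 1)] α) := by
    intro m
    induction m with
    | zero =>
      simp only [mul_zero, Function.iterate_zero, id, zero_add, mul_one]
      have h1 := h.not_between j
      have hβ : dbl^[j] α ≠ β := by
        intro h'
        obtain ⟨q, hq⟩ := hdvd
        have h2 : dbl^[per α] α = β := by
          cases q with
          | zero => omega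
          | succ q =>
            have : per α = j * q + j := by rw [hq]; ring
            rw [this, Function.iterate_add_apply, h', iter_fix_of_dvd (iter_per β)
              (Dvd.intro q rfl)]
        rw [iter_per] at h2
        exact h.ne h2.symm
      have h2 : ar β α ≤ ar β (dbl^[j] α) := by
        by_contra! h3
        exact h1 ⟨ar_pos hβ.symm, h3⟩
      refine h2.lt_of_ne fun h3 => hne (ar_right_inj h3).symm
    | succ m ih =>
      have h1 := ar_lt_ar_iter (α := α) (p := β) (q := dbl^[j * m] α) (r := dbl^[j * (m + 1)] α) j
        (fun i _ => by rw [hKP, h.KP_eq]) (fun i _ => by rw [hKP, h.KP_eq])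
      rw [h1, hj, iter_per β, ← hj, ← Function.iterate_add_apply, ← Function.iterate_add_apply]
        at ih
      convert ih using 4 <;> ring
  have hmono' := strictMono_nat_of_lt_succ (f := fun m => ar β (dbl^[j * m] α)) hmono
  have := hmono' hn
  simp only [mul_zero, Function.iterate_zero, id] at this
  rw [iter_eq_self_iff.2 (Dvd.intro_left j rfl)] at this
  exact lt_irrefl _ this

/-! ### Reflection of the circle -/

lemma rep_neg (h : α ≠ 0) : rep (-α) = 1 - rep α := by
  have h0 : 0 < rep α := by
    refine (rep_nonneg α).lt_of_ne fun h' => h ?_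
    rw [← coe_rep α, ← h', AddCircle.coe_zero]
  have h1 : (-α : Angle) = ((1 - rep α : ℝ) : Angle) := by
    rw [AddCircle.coe_sub, AddCircle.coe_period, zero_sub, coe_rep]
  rw [h1, rep_coe, Int.fract_eq_self.2 ⟨by linarith [rep_lt_one α], by linarith⟩]

lemma half0_neg (h : α ≠ 0) : half0 (-α) = -half1 α := by
  rw [half0, half1, rep_neg h, ← AddCircle.coe_neg]
  have : (1 - rep α) / 2 = -((rep α + 1) / 2) + 1 := by ring
  rw [this, AddCircle.coe_add, AddCircle.coe_period, add_zero]

/-- Reflection reverses orientation, so it carries a semicircle closed below to one closed above.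
The angle `0` is excluded because its representative is not reflected to `1`. -/
lemma codeP_neg (h : α ≠ 0) (θ : Angle) : codeP (-α) (-θ) = codeM α θ := by
  have h1 : pos (-α) (-θ) = ar θ (half1 α) := by rw [pos, half0_neg h, ar_neg]
  have h2 := ar_pos_cases α θ (half1 α)
  rw [pos_half1] at h2
  have h3 := pos_lt_one α θ
  rw [codeP, h1]
  rcases codeM_cases α θ with ⟨k, k1⟩ | ⟨k, k1⟩ | ⟨k, k1⟩ <;>
  rcases h2 with ⟨h2, h2'⟩ | ⟨h2, h2'⟩ <;> rw [k, h2']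
  · rw [if_pos (by linarith)]
  · exfalso; linarith
  · exfalso; linarith
  · rw [if_neg (by linarith)]
  · rw [if_neg (by linarith)]
  · exfalso; linarith

lemma codeM_neg (h : α ≠ 0) (θ : Angle) : codeM (-α) (-θ) = codeP α θ := by
  have := codeP_neg (neg_ne_zero.2 h) (-θ)
  rw [neg_neg, neg_neg] at this
  exact this.symm

lemma KP_neg (h : α ≠ 0) (θ : Angle) : KP (-α) (-θ) = KM α θ := by
  funext i; rw [KP, KM, iter_dbl_neg, codeP_neg h]

lemma KM_neg (h : α ≠ 0) (θ : Angle) : KM (-α) (-θ) = KP α θ := by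
  funext i; rw [KP, KM, iter_dbl_neg, codeM_neg h]

lemma per_neg (α : Angle) : per (-α) = per α := by
  have : ∀ k, dbl^[k] (-α) = -α ↔ dbl^[k] α = α := fun k => by rw [iter_dbl_neg, neg_inj]
  apply Nat.dvd_antisymm
  · rw [← iter_eq_self_iff, this, iter_per]
  · rw [← iter_eq_self_iff, ← this, iter_per]

lemma periodic_neg (h : α ∈ Function.periodicPts dbl) : -α ∈ Function.periodicPts dbl :=
  Function.mk_mem_periodicPts (per_pos h) (by
    rw [Function.IsPeriodicPt, Function.IsFixedPt, iter_dbl_neg, iter_per])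

/-! ### Comparison of the two codings of a pair -/

/-- Both members have symbol `0` and the arc is shorter than `1 / 2`, so there is no wrap past
`half0 α`. -/
lemma PrePair.pos_right (h : PrePair α β) : pos α β = pos α α - ar β α := by
  have h1 : codeP α β = codeP α α := congrFun h.KP_eq 0
  rw [codeP_self] at h1
  have h2 := codeP_cases α β
  have h3 := ar_pos_cases α β α
  have h4 := pos_nonneg α α
  have h5 := h.ar_lt
  rw [h1] at h2
  simp only [zero_ne_one, false_and, or_false, true_and] at h2
  rcases h3 with ⟨h3, h3'⟩ | ⟨h3, h3'⟩ <;> linarith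

lemma PrePair.rep_right (h : PrePair α β) : rep β = rep α - ar β α := by
  have h1 := h.pos_right
  have h2 := pos_nonneg α β
  have h3 := ar_nonneg β α
  have h4 := rep_lt_one α
  rw [pos_self] at h1
  have h5 : β = ((rep α - ar β α : ℝ) : Angle) := by
    rw [AddCircle.coe_sub, coe_rep, eq_sub_iff_add_eq, add_ar]
  conv_lhs => rw [h5]
  rw [rep_coe, Int.fract_eq_self.2 ⟨by linarith, by linarith⟩]

lemma PrePair.pos_cases (h : PrePair α β) (θ : Angle) :
    (ar β α / 2 ≤ pos β θ ∧ pos α θ = pos β θ - ar β α / 2) ∨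
    (pos β θ < ar β α / 2 ∧ pos α θ = pos β θ - ar β α / 2 + 1) := by
  have h1 : pos β (half0 α) = ar β α / 2 := by
    have e : half0 α = half0 β + ((ar β α / 2 : ℝ) : Angle) := by
      rw [half0, half0, ← AddCircle.coe_add, h.rep_right]; congr 1; ring
    have h3 := ar_nonneg β α
    have h4 := ar_lt_one β α
    rw [pos, e]
    exact ar_add_of_mem (by linarith) (by linarith)
  have := ar_pos_cases β (half0 α) θ
  rwa [h1] at this

/-- The symbol for `β`, seen from below, differs from the symbol for `α`, seen from above,
exactly at the preimages of the arc from `β` to `α`. -/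
lemma PrePair.codeM_eq_iff (h : PrePair α β) {θ : Angle} :
    codeM β θ = codeP α θ ↔ ¬ Between β α (dbl θ) := by
  rw [between_iff h.ne]
  have h1 := h.pos_cases θ
  have h2 := ar_pos h.ne
  have h3 := h.ar_lt
  have h4 := pos_lt_one β θ
  have h5 := pos_nonneg β θ
  rcases codeM_cases β θ with ⟨k, k1, k2⟩ | ⟨k, k1⟩ | ⟨k, k1⟩ <;>
  rcases codeP_cases α θ with ⟨l, l1, l2⟩ | ⟨l, l1, l2⟩ <;>
  rcases h1 with ⟨h1, h1'⟩ | ⟨h1, h1'⟩ <;> rw [k, l, l2] <;>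
  simp only [true_iff, false_iff, not_lt, zero_ne_one, one_ne_zero] <;> linarith

lemma PrePair.KM_eq_of_not_between (h : PrePair α β) {θ : Angle}
    (hθ : ∀ i, ¬ Between β α (dbl^[i] θ)) : KM β θ = KP α θ := by
  funext i
  refine h.codeM_eq_iff.2 ?_
  rw [← Function.iterate_succ_apply' dbl]
  exact hθ _

lemma PrePair.periodic_right (h : PrePair α β) : β ∈ Function.periodicPts dbl :=
  Function.mk_mem_periodicPts (per_pos h.periodic) h.iter_fix

lemma PrePair.ne_zero_right (h : PrePair α β) : β ≠ 0 := by
  apply ne_zero_of_two_le_per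
  rw [h.per_eq]
  exact two_le_per h.periodic h.ne_zero

/-- Reflection exchanges the roles of the members of a pair. -/
lemma PrePair.neg (h : PrePair α β) : PrePair (-β) (-α) where
  periodic := periodic_neg h.periodic_right
  ne_zero := neg_ne_zero.2 h.ne_zero_right
  iter_fix := by rw [per_neg, h.per_eq, iter_dbl_neg, iter_per]
  ne := fun h' => h.ne (neg_injective h').symm
  not_between i := by rw [iter_dbl_neg, between_neg]; exact h.not_between' i
  KP_eq := by
    rw [KP_neg h.ne_zero_right, KP_neg h.ne_zero_right, h.KM_eq_of_not_between h.not_between,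
      h.KM_eq_of_not_between h.not_between', h.KP_eq]
  ar_lt := by rw [ar_neg]; exact h.ar_lt

/-! ### Existence of the companion -/

/-- The two preimages of `α` are the ends of the semicircles, so they lie on the same side of any
chord inside an open semicircle; the order of positions decides which. -/
lemma between_iff_of_dbl_eq {p q r : Angle} (hc : codeP α q = codeP α p) (hp : dbl p ≠ α)
    (hq : dbl q ≠ α) (hr : dbl r = α) : Between p q r ↔ pos α q < pos α p := by
  rw [Ne, dbl_eq_self_iff_pos, not_or] at hp hq
  rw [dbl_eq_self_iff_pos] at hr
  obtain ⟨p0, p1⟩ := hp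
  obtain ⟨q0, q1⟩ := hq
  replace p0 := lt_of_le_of_ne (pos_nonneg α p) (Ne.symm p0)
  replace q0 := lt_of_le_of_ne (pos_nonneg α q) (Ne.symm q0)
  have b3 := pos_lt_one α p
  have b4 := pos_lt_one α q
  have c1 := ar_pos_cases α p q
  have c2 := ar_pos_cases α p r
  have side : (pos α p < 1 / 2 ∧ pos α q < 1 / 2) ∨ (1 / 2 < pos α p ∧ 1 / 2 < pos α q) := by
    rcases codeP_cases α p with ⟨k, k1, -⟩ | ⟨k, k1, -⟩ <;>
    rcases codeP_cases α q with ⟨k', k1', -⟩ | ⟨k', k1', -⟩ <;> rw [k, k'] at hc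
    · exact .inl ⟨k1, k1'⟩
    · simp at hc
    · simp at hc
    · exact .inr ⟨lt_of_le_of_ne k1 (Ne.symm p1), lt_of_le_of_ne k1' (Ne.symm q1)⟩
  unfold Between
  constructor
  · rintro ⟨d1, d2⟩
    by_contra! d3
    rcases hr with hr | hr <;> rw [hr] at c2 <;> rcases side with ⟨s1, s2⟩ | ⟨s1, s2⟩ <;>
    rcases c1 with ⟨c1, c1'⟩ | ⟨c1, c1'⟩ <;> rcases c2 with ⟨c2, c2'⟩ | ⟨c2, c2'⟩ <;> linarith
  · intro d3
    rcases hr with hr | hr <;> rw [hr] at c2 <;> rcases side with ⟨s1, s2⟩ | ⟨s1, s2⟩ <;>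
    rcases c1 with ⟨c1, c1'⟩ | ⟨c1, c1'⟩ <;> rcases c2 with ⟨c2, c2'⟩ | ⟨c2, c2'⟩ <;>
    constructor <;> linarith

/-- `c` follows the orbit of the periodic point `α` up to the other preimage of `α`. -/
structure Shadow (α c : Angle) : Prop where
  periodic : α ∈ Function.periodicPts dbl
  ne_zero : α ≠ 0
  iter_eq : dbl^[per α - 1] c = ddotPt α
  KP_eq : ∀ i < per α - 1, KP α c i = KP α α i
  ar_lt : ar c α < 1 / 2

namespace Shadow

variable {c : Angle}

lemma ne (h : Shadow α c) : c ≠ α := by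
  rintro rfl
  exact dotPt_ne_ddotPt c h.iter_eq

lemma iter_per (h : Shadow α c) : dbl^[per α] c = α := by
  have h1 := per_pos h.periodic
  have : per α = (per α - 1) + 1 := by omega
  rw [this, Function.iterate_succ_apply', h.iter_eq, dbl_ddotPt]

lemma iter_ne (h : Shadow α c) {i : ℕ} (hi : i < per α) : dbl^[i] c ≠ α := by
  intro h'
  have : dbl^[per α - 1] c = dbl^[per α - 1 - i] (dbl^[i] c) := by
    rw [← Function.iterate_add_apply]; congr 2; omega
  rw [h'] at this
  exact iter_ne_ddotPt h.periodic _ (this.symm.trans h.iter_eq)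

/-- The chords in the orbit of the chord from `c` to `α` do not cross that chord. -/
lemma unlinked (h : Shadow α c) {j : ℕ} (hj : 0 < j) (hj' : j ≤ per α - 1) :
    Between c α (dbl^[j] α) ↔ Between c α (dbl^[j] c) := by
  -- Both chords are pushed forward until the second one becomes the chord from `dotPt α` to `ddotPt
  -- α`, whose ends are on the same side of the first.
  have key : ∀ m l, l + m + j = per α - 1 → (Between (dbl^[l] c) (dbl^[l] α) (dbl^[j + l] α) ↔
      Between (dbl^[l] c) (dbl^[l] α) (dbl^[j + l] c)) := by
    intro m
    induction m with
    | zero =>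
      intro l hl
      have e : j + l = per α - 1 := by omega
      have hc : codeP α (dbl^[l] c) = codeP α (dbl^[l] α) := h.KP_eq l (by omega)
      rw [e, h.iter_eq]
      change Between _ _ (dotPt α) ↔ _
      have a3 : dbl (dbl^[l] c) ≠ α := by
        rw [← Function.iterate_succ_apply' dbl]; exact h.iter_ne (by omega)
      have a4 : dbl (dbl^[l] α) ≠ α := by
        rw [← Function.iterate_succ_apply' dbl, Ne, iter_eq_self_iff]
        intro h'
        have := Nat.le_of_dvd (by omega) h'
        omega
      rw [between_iff_of_dbl_eq hc.symm a3 a4 (dbl_dotPt h.periodic),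
        between_iff_of_dbl_eq hc.symm a3 a4 (dbl_ddotPt α)]
    | succ m ih =>
      intro l hl
      have h1 := ih (l + 1) (by omega)
      have e1 : codeP α (dbl^[l] α) = codeP α (dbl^[l] c) := (h.KP_eq l (by omega)).symm
      have e2 : codeP α (dbl^[j + l] c) = codeP α (dbl^[j + l] α) := h.KP_eq _ (by omega)
      rw [← add_assoc] at h1
      simp only [Function.iterate_succ_apply'] at h1
      by_cases hc : codeP α (dbl^[j + l] α) = codeP α (dbl^[l] c)
      · rwa [between_dbl e1 hc, between_dbl e1 (e2.trans hc)]
      · exact between_iff_of_codeP_ne e1 hc (by rwa [e2])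
  exact key (per α - 1 - j) 0 (by omega)

/-- The chords in the orbit of the chord from `c` to `α` are not shorter than that chord. -/
lemma ar_mem (h : Shadow α c) {j : ℕ} (hj : j ≤ per α - 1) :
    ar c α ≤ ar (dbl^[j] α) (dbl^[j] c) ∧ ar (dbl^[j] α) (dbl^[j] c) ≤ 1 - ar c α := by
  have hρ := h.ar_lt
  have hρ0 := ar_pos h.ne
  induction j with
  | zero =>
    simp only [Function.iterate_zero, id]
    rw [ar_symm h.ne]
    constructor <;> linarith
  | succ j ih =>
    obtain ⟨i1, i2⟩ := ih (by omega)
    have hc : codeP α (dbl^[j] c) = codeP α (dbl^[j] α) := h.KP_eq j (by omega)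
    have hu := h.unlinked (j := j + 1) (by omega) hj
    rw [between_iff h.ne, between_iff h.ne] at hu
    simp only [Function.iterate_succ_apply'] at hu ⊢
    have c1 := ar_pos_cases α (dbl^[j] α) (dbl^[j] c)
    have c2 := ar_cases α (dbl (dbl^[j] α)) (dbl (dbl^[j] c))
    have b1 := ar_nonneg α (dbl (dbl^[j] α))
    have b2 := ar_nonneg α (dbl (dbl^[j] c))
    have b3 := ar_lt_one α (dbl (dbl^[j] α))
    have b4 := ar_lt_one α (dbl (dbl^[j] c))
    -- The complement of the doubled chord's inner arc contains `α`. If it were shorter than `ar c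
    -- α`, exactly one end of the doubled chord would lie between `c` and `α`.
    have hu' : (1 - ar c α < ar α (dbl (dbl^[j] α)) ∧ 1 - ar c α < ar α (dbl (dbl^[j] c))) ∨
        (ar α (dbl (dbl^[j] α)) ≤ 1 - ar c α ∧ ar α (dbl (dbl^[j] c)) ≤ 1 - ar c α) := by
      by_cases hh : 1 - ar c α < ar α (dbl (dbl^[j] α))
      · exact .inl ⟨hh, hu.1 hh⟩
      · exact .inr ⟨not_lt.1 hh, not_lt.1 fun h' => hh (hu.2 h')⟩
    rcases codeP_cases α (dbl^[j] c) with ⟨k, k1, k2⟩ | ⟨k, k1, k2⟩ <;>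
    rcases codeP_cases α (dbl^[j] α) with ⟨l, l1, l2⟩ | ⟨l, l1, l2⟩ <;>
    rw [k, l] at hc <;> first | (exfalso; revert hc; decide) | skip
    all_goals
      rcases c1 with ⟨c1, c1'⟩ | ⟨c1, c1'⟩ <;> rcases c2 with ⟨c2, c2'⟩ | ⟨c2, c2'⟩ <;>
      rcases hu' with ⟨u1, u2⟩ | ⟨u1, u2⟩ <;> constructor <;> linarith

lemma not_between (h : Shadow α c) (i : ℕ) : ¬ Between c α (dbl^[i] α) := by
  have hn := per_pos h.periodic
  have e : dbl^[i] α = dbl^[i % per α] α := by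
    conv_lhs => rw [← Nat.mod_add_div i (per α), Function.iterate_add_apply,
      iter_eq_self_iff.2 (Dvd.intro _ rfl)]
  rw [e]
  have hlt := Nat.mod_lt i hn
  set j := i % per α
  rcases Nat.eq_zero_or_pos j with h0 | h0
  · rw [h0]
    exact fun h' => lt_irrefl _ h'.2
  · intro h1
    have h2 := (h.unlinked h0 (by omega)).1 h1
    rw [between_iff h.ne] at h1 h2
    have h3 := h.ar_mem (j := j) (by omega)
    have h4 := ar_cases α (dbl^[j] α) (dbl^[j] c)
    have b3 := ar_lt_one α (dbl^[j] α)
    have b4 := ar_lt_one α (dbl^[j] c)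
    rcases h4 with ⟨h4, h4'⟩ | ⟨h4, h4'⟩ <;> linarith [h3.1, h3.2]

/-- The `n`-th iterate stretches the arc from `c` to `α` away from a fixed point `β` slightly below
`c`, and sends `c` to `α`. The absence of orbit points passes from the arc above `c` to the arc
above `β`, and the itinerary of `β` is read off from that of `c`. -/
lemma exists_prePair (h : Shadow α c) : ∃ β, PrePair α β := by
  have hn2 := two_le_per h.periodic h.ne_zero
  have hρ := h.ar_lt
  have hρ0 := ar_pos h.ne
  have hN : (4 : ℝ) ≤ 2 ^ per α := by
    calc (4 : ℝ) = 2 ^ 2 := by norm_num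
      _ ≤ 2 ^ per α := pow_le_pow_right₀ one_le_two hn2
  -- `L` solves `L - L / 2 ^ n = ar c α` with `n = per α`: the point `L` below `α` is then fixed by
  -- the `n`-th iterate and has `c` at distance `L / 2 ^ n` above it.
  obtain ⟨L, hL⟩ : ∃ L : ℝ, L * 2 ^ per α = L + ar c α * 2 ^ per α := by
    refine ⟨ar c α * 2 ^ per α / (2 ^ per α - 1), ?_⟩
    field_simp
    have : (2 : ℝ) ^ per α - 1 ≠ 0 := by linarith
    field_simp
    ring
  have hLlow : ar c α < L := by
    by_contra! h'
    nlinarith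
  have hL0 : 0 < L := hρ0.trans hLlow
  have hLhigh : 3 * L ≤ 4 * ar c α := by
    by_contra! h'
    nlinarith
  obtain ⟨β, hβ⟩ : ∃ β : Angle, β = α - (L : Angle) := ⟨_, rfl⟩
  have hβα : ar β α = L := by rw [hβ]; exact ar_sub_coe α (by linarith) (by linarith)
  have hne : β ≠ α := by
    rintro h'
    rw [h', ar_self] at hβα
    linarith
  have hcα : c = α - (ar c α : Angle) := by rw [eq_sub_iff_add_eq, add_ar]
  have hfix : dbl^[per α] β = β := by
    have h1 := h.iter_per
    rw [hcα, iter_dbl_sub, QuadLam.iter_per, sub_eq_self] at h1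
    rw [hβ, iter_dbl_sub, QuadLam.iter_per, mul_comm, hL, AddCircle.coe_add,
      mul_comm (ar c α), h1, add_zero]
  have hcβ : c = β + ((L / 2 ^ per α : ℝ) : Angle) := by
    have e : L / 2 ^ per α = L - ar c α := by field_simp; linarith
    rw [e, AddCircle.coe_sub, hβ]
    conv_lhs => rw [hcα]
    abel
  have hcβ' : ar β c = L / 2 ^ per α := by
    conv_lhs => rw [hcβ]
    refine ar_add_of_mem (by positivity) ?_
    calc L / 2 ^ per α ≤ L := div_le_self (by linarith) (by linarith)
      _ < 1 := by linarith
  have hnb : ∀ i, ¬ Between β α (dbl^[i] α) := by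
    rintro i ⟨h1, h2⟩
    have h3 := h.not_between i
    have h4 := ar_cases β c (dbl^[i] α)
    have h5 := ar_cases β c α
    have e : L / 2 ^ per α = L - ar c α := by field_simp; linarith
    rw [hcβ', hβα] at h5
    -- An orbit point in the remaining part up to `c` would be moved away from `β` by the period
    -- map, which fixes it.
    rcases le_or_gt (ar β (dbl^[i] α)) (L / 2 ^ per α) with h6 | h6
    · have h7 : 2 ^ per α * ar β (dbl^[i] α) ≤ L := by
        rw [le_div_iff₀ (by positivity)] at h6; linarith
      have h8 := ar_iter (i := per α) (p := β) (q := dbl^[i] α) (by linarith)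
      rw [hfix, ← Function.iterate_add_apply, add_comm, Function.iterate_add_apply,
        QuadLam.iter_per] at h8
      nlinarith
    · apply h3
      rcases h4 with ⟨h4, h4'⟩ | ⟨h4, h4'⟩
      · unfold Between
        rw [h4']
        constructor <;> rcases h5 with ⟨h5, h5'⟩ | ⟨h5, h5'⟩ <;> linarith
      · linarith
  have hW : WeakPair α β := ⟨h.periodic, h.ne_zero, hfix, hne, hnb⟩
  have hcode : ∀ i < per α - 1, KP α β i = KP α α i := by
    intro i hi
    have h1 := hW.KP_add (N := per α) (i := i) (δ := L / 2 ^ per α) dvd_rfl (by positivity)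
      (by rw [hβα]; field_simp; rfl) (by omega)
    rw [← hcβ] at h1
    rw [← h.KP_eq i hi]
    exact (h1.resolve_right fun h' => h.iter_ne (by omega) h'.2).symm
  -- The image of `β` lies `L / 2` below `ddotPt α`, inside the semicircle that starts at the
  -- antipodal point `dotPt α`.
  have hlast : KP α β (per α - 1) = KP α α (per α - 1) := by
    change codeP α (dbl^[per α - 1] β) = codeP α (dotPt α)
    have h1 : ddotPt α = dbl^[per α - 1] β + ((L / 2 : ℝ) : Angle) := by
      rw [← h.iter_eq, hcβ, iter_dbl_add]
      congr 2
      have : (2 : ℝ) ^ per α = 2 ^ (per α - 1) * 2 := by rw [← pow_succ]; congr 1; omega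
      rw [this]
      field_simp
    have h2 : ar (dbl^[per α - 1] β) (ddotPt α) = L / 2 := by
      rw [h1]; exact ar_add_of_mem (by linarith) (by linarith)
    have h3 := ar_pos_cases α (dbl^[per α - 1] β) (ddotPt α)
    have a1 := dbl_eq_self_iff_pos.1 (dbl_dotPt h.periodic)
    have a2 := dbl_eq_self_iff_pos.1 (dbl_ddotPt α)
    have a3 : pos α (dotPt α) ≠ pos α (ddotPt α) := fun h' => dotPt_ne_ddotPt α (pos_inj h')
    have b1 := pos_nonneg α (dbl^[per α - 1] β)
    have b2 := pos_lt_one α (dbl^[per α - 1] β)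
    rcases a1 with a1 | a1 <;> rcases a2 with a2 | a2 <;> rw [a1, a2] at a3 <;>
      first | exact absurd rfl a3 | skip
    · have e1 : codeP α (dotPt α) = 0 := by rw [codeP, a1, if_pos (by norm_num)]
      rw [e1, codeP, if_pos]
      rw [a2] at h3
      rcases h3 with ⟨h3, h3'⟩ | ⟨h3, h3'⟩ <;> linarith
    · have e1 : codeP α (dotPt α) = 1 := by rw [codeP, a1, if_neg (by norm_num)]
      rw [e1, codeP, if_neg]
      rw [a2] at h3
      rcases h3 with ⟨h3, h3'⟩ | ⟨h3, h3'⟩ <;> linarith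
  have hKP : KP α β = KP α α := by
    funext i
    have hn := per_pos h.periodic
    have e1 : KP α β i = KP α β (i % per α) := by
      conv_lhs => rw [← Nat.mod_add_div i (per α), add_comm, ← KP_iter,
        iter_fix_of_dvd hfix (Dvd.intro _ rfl)]
    have e2 : KP α α i = KP α α (i % per α) := by
      conv_lhs => rw [← Nat.mod_add_div i (per α), add_comm, ← KP_iter,
        iter_eq_self_iff.2 (Dvd.intro _ rfl)]
    rw [e1, e2]
    have := Nat.mod_lt i hn
    rcases Nat.lt_or_ge (i % per α) (per α - 1) with h' | h'
    · exact hcode _ h'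
    · rw [show i % per α = per α - 1 by omega]; exact hlast
  refine ⟨β, hW, hKP, ?_⟩
  have c1 : codeP α c = 0 := (h.KP_eq 0 (by omega)).trans (codeP_self α)
  have c2 : codeP α β = 0 := (congrFun hKP 0).trans (codeP_self α)
  have d1 := codeP_cases α c
  have d2 := codeP_cases α β
  have d3 := codeP_cases α α
  rw [c1] at d1
  rw [c2] at d2
  rw [codeP_self] at d3
  simp only [zero_ne_one, false_and, or_false, true_and] at d1 d2 d3
  obtain ⟨d1, -⟩ := d1
  obtain ⟨d2, -⟩ := d2
  obtain ⟨d3, -⟩ := d3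
  have f1 := ar_pos_cases α c α
  have f2 := ar_pos_cases α β α
  have b1 := pos_nonneg α c
  have b2 := pos_nonneg α β
  have b3 := pos_nonneg α α
  rw [hβα] at f2 ⊢
  rcases f1 with ⟨f1, f1'⟩ | ⟨f1, f1'⟩ <;> rcases f2 with ⟨f2, f2'⟩ | ⟨f2, f2'⟩ <;> linarith

end Shadow

/-- Every periodic angle has a companion. -/
lemma exists_prePair (hper : α ∈ Function.periodicPts dbl) (h0 : α ≠ 0) :
    ∃ β, PrePair α β ∨ PrePair β α := by
  have hn2 := two_le_per hper h0
  obtain ⟨c, hc, hcode⟩ := exists_KP α (ddotPt α) (KP α α) (per α - 1)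
  have hne : c ≠ α := by
    rintro rfl
    exact dotPt_ne_ddotPt c hc
  have hhalf : ar c α ≠ 1 / 2 := by
    intro h
    have h1 : dbl c = dbl α := by
      have := add_ar c α
      rw [h] at this
      rw [← this, dbl_add]
      norm_num
    exact hne (eq_of_dbl_of_codeP h1 (hcode 0 (by omega)))
  rcases lt_or_gt_of_ne hhalf with h | h
  · obtain ⟨β, hβ⟩ := (Shadow.mk hper h0 hc hcode h).exists_prePair
    exact ⟨β, .inl hβ⟩
  -- Here `c` is on the upper side of `α`, so the construction is applied to the mirror image.
  -- Before time `per α - 1` neither orbit meets a preimage of `α`, so reflection does not disturb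
  -- the symbols.
  · have hne' : ∀ i < per α - 1, dbl^[i + 1] c ≠ α ∧ dbl^[i + 1] α ≠ α := by
      intro i hi
      constructor
      · intro h'
        have : dbl^[per α - 1] c = dbl^[per α - 1 - (i + 1)] (dbl^[i + 1] c) := by
          rw [← Function.iterate_add_apply]; congr 2; omega
        rw [h'] at this
        exact iter_ne_ddotPt hper _ (this.symm.trans hc)
      · rw [Ne, iter_eq_self_iff]
        intro h'
        have := Nat.le_of_dvd (by omega) h'
        omega
    have hS : Shadow (-α) (-c) := by
      refine ⟨periodic_neg hper, neg_ne_zero.2 h0, ?_, ?_, ?_⟩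
      · rw [per_neg, iter_dbl_neg, hc]
        refine eq_ddotPt (periodic_neg hper) (by rw [dbl_neg, dbl_ddotPt]) fun h' => ?_
        rw [dotPt, per_neg, iter_dbl_neg] at h'
        exact dotPt_ne_ddotPt α (neg_injective h').symm
      · intro i hi
        rw [per_neg] at hi
        rw [KP_neg h0, KP_neg h0]
        obtain ⟨h1, h2⟩ := hne' i hi
        rw [Function.iterate_succ_apply'] at h1 h2
        exact (codeM_eq_codeP h1).trans ((hcode i hi).trans (codeM_eq_codeP h2).symm)
      · rw [ar_neg, ar_symm hne]; linarith
    obtain ⟨β, hβ⟩ := hS.exists_prePair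
    have := hβ.neg
    rw [neg_neg] at this
    exact ⟨-β, .inr this⟩

/-! ### The companion angle -/

lemma KP_self_periodic (α : Angle) (i : ℕ) : KP α α (per α + i) = KP α α i := by
  rw [← KP_iter, iter_per]

lemma repWord_eq (α : Angle) : repWord α = (List.range (per α - 1)).map (KP α α) := by
  unfold repWord
  refine List.map_congr_left fun i hi => ?_
  rw [List.mem_range] at hi
  have h1 : dbl (dbl^[i] α) ≠ α := by
    rw [← Function.iterate_succ_apply' dbl, Ne, iter_eq_self_iff]
    intro h'
    have := Nat.le_of_dvd (by omega) h'
    omega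
  rw [Ne, dbl_eq_self_iff_pos, not_or] at h1
  have h0 := pos_nonneg α (dbl^[i] α)
  change _ = codeP α (dbl^[i] α)
  rw [mem_arcA]
  rcases codeP_cases α (dbl^[i] α) with ⟨k, k1, _⟩ | ⟨k, k1, _⟩
  · rw [if_pos ⟨lt_of_le_of_ne h0 (Ne.symm h1.1), k1⟩, k]
  · rw [if_neg (by rintro ⟨_, h3⟩; linarith), k]

lemma companionWord_eq (hper : α ∈ Function.periodicPts dbl) (k : ℕ) :
    (List.replicate k (repWord α ++ [codeP α (dotPt α)])).flatten ++ repWord α =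
      (List.range (per α * k + (per α - 1))).map (KP α α) := by
  have hn := per_pos hper
  induction k with
  | zero => simp [repWord_eq]
  | succ k ih =>
    have h1 : repWord α ++ [codeP α (dotPt α)] = (List.range (per α)).map (KP α α) := by
      obtain ⟨m, hm⟩ : ∃ m, per α = m + 1 := ⟨per α - 1, by omega⟩
      rw [repWord_eq, hm, List.range_succ, List.map_append, Nat.add_sub_cancel]
      simp [KP, dotPt, hm]
    have h2 : per α * (k + 1) + (per α - 1) = per α + (per α * k + (per α - 1)) := by ring
    have h3 : ∀ m, (List.range (per α + m)).map (KP α α) =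
        (List.range (per α)).map (KP α α) ++ (List.range m).map (KP α α) := by
      intro m
      rw [List.range_add, List.map_append, List.map_map]
      congr 1
      exact List.map_congr_left fun i _ => KP_self_periodic α i
    rw [List.replicate_succ, List.flatten_cons, List.append_assoc, ih, h1, h2, h3]

lemma dist_lt_iff (p q : Angle) :
    dist p q < 1 / 4 ↔ ar p q < 1 / 4 ∨ 3 / 4 < ar p q := by
  have h0 := ar_nonneg p q
  have h1 := ar_lt_one p q
  have e1 : dist p q = ‖((ar p q : ℝ) : Angle)‖ := by
    rw [dist_comm, dist_eq_norm, ar, coe_rep]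
  have e2 : ((ar p q : ℝ) : Angle) = ((ar p q - 1 : ℝ) : Angle) := by
    rw [AddCircle.coe_sub, AddCircle.coe_period, sub_zero]
  rcases le_or_gt (ar p q) (1 / 2) with h | h
  · have := (AddCircle.norm_coe_eq_abs_iff (p := (1 : ℝ)) (x := ar p q) one_ne_zero).2
      (by rw [abs_of_nonneg h0]; simpa using h)
    rw [e1, this, abs_of_nonneg h0]
    constructor
    · exact Or.inl
    · rintro (h2 | h2) <;> linarith
  · have := (AddCircle.norm_coe_eq_abs_iff (p := (1 : ℝ)) (x := ar p q - 1) one_ne_zero).2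
      (by rw [abs_of_nonpos (by linarith)]; simp; linarith)
    rw [e1, e2, this, abs_of_nonpos (by linarith)]
    constructor
    · intro h2; right; linarith
    · rintro (h2 | h2) <;> linarith

namespace PrePair

/-- The points of the arc from `β` to `α` that follow `α` up to its preperiodic preimage. -/
def shadow (α β : Angle) (k : ℕ) : Angle :=
  β + ((ar β α / 2 ^ (per α * (k + 1)) : ℝ) : Angle)

/-- The point is a preimage of `α`. It is not `dotPt α`: that point is the lower end of its
half-open semicircle, so a point slightly below it would have the other symbol, while `β` and `α`
have equal itineraries. -/
lemma iter_right_add (h : PrePair α β) :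
    dbl^[per α - 1] β + ((ar β α / 2 : ℝ) : Angle) = ddotPt α := by
  have hn := per_pos h.periodic
  have hpos := ar_pos h.ne
  have hlt := h.ar_lt
  have h1 : dbl (dbl^[per α - 1] β + ((ar β α / 2 : ℝ) : Angle)) = α := by
    rw [dbl_add, ← Function.iterate_succ_apply' dbl]
    have : (per α - 1).succ = per α := by omega
    rw [this, h.iter_fix]
    convert add_ar β α using 3
    ring
  refine eq_ddotPt h.periodic h1 fun h2 => ?_
  have hc : codeP α (dbl^[per α - 1] β) = codeP α (dotPt α) := congrFun h.KP_eq (per α - 1)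
  have h3 : ar (dbl^[per α - 1] β) (dotPt α) = ar β α / 2 := by
    rw [← h2]; exact ar_add_of_mem (by linarith) (by linarith)
  have h4 := ar_pos_cases α (dbl^[per α - 1] β) (dotPt α)
  have a1 := dbl_eq_self_iff_pos.1 (dbl_dotPt h.periodic)
  have b1 := pos_nonneg α (dbl^[per α - 1] β)
  have b2 := pos_lt_one α (dbl^[per α - 1] β)
  rcases codeP_cases α (dbl^[per α - 1] β) with ⟨k, k1, -⟩ | ⟨k, k1, -⟩ <;>
  rcases codeP_cases α (dotPt α) with ⟨l, l1, -⟩ | ⟨l, l1, -⟩ <;> rw [k, l] at hc <;>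
  first | (exfalso; revert hc; decide) | skip
  all_goals
    rcases a1 with a1 | a1 <;> rw [a1] at l1 h4 <;> rcases h4 with ⟨h4, h4'⟩ | ⟨h4, h4'⟩ <;>
    linarith

lemma iter_shadow (h : PrePair α β) (k : ℕ) :
    dbl^[per α * (k + 1) - 1] (shadow α β k) = ddotPt α := by
  have hn := per_pos h.periodic
  have hN : per α * (k + 1) = (per α * (k + 1) - 1) + 1 := by
    have : 0 < per α * (k + 1) := by positivity
    omega
  have h1 : dbl^[per α * (k + 1) - 1] β = dbl^[per α - 1] β := by
    have e : per α * (k + 1) - 1 = (per α - 1) + per α * k := by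
      have : per α * (k + 1) = per α * k + per α := by ring
      omega
    rw [e, Function.iterate_add_apply, iter_fix_of_dvd h.iter_fix (Dvd.intro _ rfl)]
  rw [shadow, iter_dbl_add, h1, ← h.iter_right_add]
  congr 2
  conv_lhs => enter [2, 2]; rw [hN]
  rw [pow_succ]
  field_simp

lemma iter_shadow_ne (h : PrePair α β) {k i : ℕ} (hi : i < per α * (k + 1)) :
    dbl^[i] (shadow α β k) ≠ α := by
  intro h'
  have : dbl^[per α * (k + 1) - 1] (shadow α β k) =
      dbl^[per α * (k + 1) - 1 - i] (dbl^[i] (shadow α β k)) := by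
    rw [← Function.iterate_add_apply]; congr 2; omega
  rw [h', h.iter_shadow] at this
  exact iter_ne_ddotPt h.periodic _ this.symm

lemma KP_shadow (h : PrePair α β) {k i : ℕ} (hi : i + 1 < per α * (k + 1)) :
    KP α (shadow α β k) i = KP α α i := by
  rw [← h.KP_eq]
  refine (h.KP_add (N := per α * (k + 1)) (Dvd.intro _ rfl) ?_ ?_ (by omega)).resolve_right
    fun h' => h.iter_shadow_ne hi h'.2
  · have := ar_nonneg β α; positivity
  · field_simp; rfl

lemma branchWord_shadow (h : PrePair α β) (t : Fin 2) (k : ℕ) :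
    branchWord α t ((List.replicate k (repWord α ++ [codeP α (dotPt α)])).flatten ++ repWord α)
      (ddotPt α) = shadow α β k := by
  have hn := per_pos h.periodic
  have e : per α * k + (per α - 1) = per α * (k + 1) - 1 := by
    have : per α * (k + 1) = per α * k + per α := by ring
    omega
  rw [companionWord_eq h.periodic, e]
  have := branchWord_eq h.periodic t
    ((List.range (per α * (k + 1) - 1)).map (KP α α)) (shadow α β k) ?_ ?_
  · rw [List.length_map, List.length_range, h.iter_shadow] at this
    exact this
  · intro i hi
    rw [List.length_map, List.length_range] at hi
    rw [List.getElem_map, List.getElem_range, h.KP_shadow (by omega)]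
  · intro i hi
    rw [List.length_map, List.length_range] at hi
    exact h.iter_shadow_ne (by omega)

lemma ar_shadow_zero (h : PrePair α β) :
    ar (shadow α β 0) α = ar β α - ar β α / 2 ^ per α := by
  have h0 := ar_pos h.ne
  have h1 := ar_lt_one β α
  have h2 : ar β α / 2 ^ per α ≤ ar β α := div_le_self h0.le (one_le_pow₀ one_le_two)
  have h3 : ar β (shadow α β 0) = ar β α / 2 ^ per α := by
    rw [shadow, zero_add, mul_one]
    exact ar_add_of_mem (by positivity) (by linarith)
  have h4 := ar_cases β (shadow α β 0) α
  rw [h3] at h4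
  rcases h4 with ⟨_, h5⟩ | ⟨h4, _⟩
  · exact h5
  · linarith

/-- The first shadow point is just below `α`, so its preimage in the semicircle with symbol `0` is
within `1 / 4` of `half1 α`, and not of `half0 α`. The chord is therefore short exactly when `dotPt
α` is `half1 α`, that is, when its symbol from above is `1`. Hence `v(1-e)` is one period of `KP α
α`. -/
lemma charSym_eq (h : PrePair α β) : 1 - charSym α = codeP α (dotPt α) := by
  have e1 : branchWord α 0 (0 :: repWord α) (dotPt α) = dotPt α := by
    have h1 : branchWord α 0 (repWord α) (dotPt α) = α := by
      have := branchWord_eq h.periodic 0 (repWord α) α ?_ ?_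
      · rw [repWord_eq, List.length_map, List.length_range] at this
        rw [repWord_eq]
        exact this
      · simp [repWord_eq]
      · intro i hi
        rw [repWord_eq, List.length_map, List.length_range] at hi
        rw [Ne, iter_eq_self_iff]
        intro h'
        have := Nat.le_of_dvd (by omega) h'
        omega
    change branch α 0 0 (branchWord α 0 (repWord α) (dotPt α)) = _
    rw [h1, branch, if_pos rfl, if_pos rfl]
  have e2 : branchWord α 0 (0 :: repWord α) (ddotPt α) = branch α 0 0 (shadow α β 0) := by
    change branch α 0 0 (branchWord α 0 (repWord α) (ddotPt α)) = _
    have := h.branchWord_shadow 0 0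
    rw [List.replicate_zero, List.flatten_nil, List.nil_append] at this
    rw [this]
  have hne : shadow α β 0 ≠ α := by
    have := h.iter_shadow_ne (k := 0) (i := 0) (by have := per_pos h.periodic; omega)
    exact this
  have hq1 := dbl_branch h.periodic 0 0 (shadow α β 0)
  have hq2 := codeP_branch_of_ne (α := α) 0 0 hne
  have hd := dist_lt_iff (dotPt α) (branch α 0 0 (shadow α β 0))
  unfold charSym
  rw [e1, e2]
  set q := branch α 0 0 (shadow α β 0)
  have h0 := ar_pos h.ne
  have hl := h.ar_lt
  have h1 := h.ar_shadow_zero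
  have h1' : 0 < ar β α / 2 ^ per α := by positivity
  rw [ar_symm hne.symm] at h1
  have h2 := codeP_cases α q
  rw [hq1, hq2] at h2
  simp only [zero_ne_one, false_and, or_false, true_and] at h2
  obtain ⟨h2, h2'⟩ := h2
  have h3 := ar_pos_cases α (dotPt α) q
  have h4 := pos_nonneg α q
  have a1 := dbl_eq_self_iff_pos.1 (dbl_dotPt h.periodic)
  have h5 : ar α (shadow α β 0) ≤ 1 := (ar_lt_one _ _).le
  have h6 : ar β α / 2 ^ per α ≤ ar β α := div_le_self h0.le (one_le_pow₀ one_le_two)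
  rcases a1 with a1 | a1
  · have hc : codeP α (dotPt α) = 0 := by rw [codeP, a1, if_pos (by norm_num)]
    rw [hc, if_neg]
    · rfl
    · rw [a1] at h3
      rw [hd]
      rcases h3 with ⟨h3, h3'⟩ | ⟨h3, h3'⟩ <;> rintro (h7 | h7) <;> linarith
  · have hc : codeP α (dotPt α) = 1 := by rw [codeP, a1, if_neg (by norm_num)]
    rw [hc, if_pos]
    · rfl
    · rw [hd]
      right
      rw [a1] at h3
      rcases h3 with ⟨h3, h3'⟩ | ⟨h3, h3'⟩ <;> linarith

lemma companionSeq_eq (h : PrePair α β) (k : ℕ) : companionSeq α k = shadow α β k := by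
  rw [companionSeq, h.charSym_eq]
  exact h.branchWord_shadow 0 k

lemma tendsto_companionSeq (h : PrePair α β) : Tendsto (companionSeq α) atTop (𝓝 β) := by
  have e : companionSeq α = shadow α β := funext h.companionSeq_eq
  rw [e]
  have hn := per_pos h.periodic
  have h1 : Tendsto (fun k : ℕ => ar β α / 2 ^ (per α * (k + 1))) atTop (𝓝 0) := by
    refine tendsto_const_nhds.div_atTop ?_
    refine (tendsto_pow_atTop_atTop_of_one_lt one_lt_two).comp ?_
    refine tendsto_atTop_mono (fun k => ?_) tendsto_id
    have : 1 * (k + 1) ≤ per α * (k + 1) := Nat.mul_le_mul_right _ hn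
    simp only [id]; omega
  have h2 : Tendsto (fun r : ℝ => β + (r : Angle)) (𝓝 0) (𝓝 (β + ((0 : ℝ) : Angle))) := by
    refine Continuous.tendsto ?_ 0
    exact continuous_const.add (AddCircle.continuous_mk' 1)
  rw [AddCircle.coe_zero, add_zero] at h2
  exact h2.comp h1

/-! ### The itinerary of `α` seen from below -/

lemma KM_self_periodic (α : Angle) (i : ℕ) : KM α α (per α + i) = KM α α i := by
  rw [← KM_iter, iter_per]

/-- A point that follows `α` from below for many periods is trapped just below `α`: pulling back
along the branch from below contracts towards `α`. The strict positivity is what later excludes `α`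
itself. -/
lemma ar_lt_of_KP_prefix (h : PrePair α β) (k : ℕ) {η : Angle}
    (hη : ∀ i < per α * (k + 1), KP α η i = KM α α i) :
    0 < ar η α ∧ 2 ^ (per α * k) * ar η α < ar β α := by
  have hn := per_pos h.periodic
  have h0 := ar_pos h.ne
  induction k generalizing η with
  | zero =>
    have hcode : ∀ i < per α - 1, KP α η i = KP α (shadow α β 0) i := by
      intro i hi
      rw [hη i (by omega), h.KP_shadow (by omega)]
      refine codeM_eq_codeP ?_
      rw [← Function.iterate_succ_apply' dbl, Ne, iter_eq_self_iff]
      intro h'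
      have := Nat.le_of_dvd (by omega) h'
      omega
    have h1 := ar_lt_ar_iter (α := α) (p := shadow α β 0) (q := η) (r := α) (per α - 1) hcode
      (fun i hi => (h.KP_shadow (by omega)).symm)
    have h2 := h.iter_shadow 0
    rw [zero_add, mul_one] at h2
    rw [h2] at h1
    have h3 : codeP α (dbl^[per α - 1] η) = codeM α (dotPt α) := hη (per α - 1) (by omega)
    have h4 := codeM_ne_codeP (dbl_dotPt h.periodic)
    rw [← h3] at h4
    -- The last symbol is not that of `dotPt α` from above, so the image lies in the semicircle from
    -- `ddotPt α` up to, but excluding, `dotPt α`. Pulled back, `η` lies from the shadow point up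
    -- to, but excluding, `α`.
    have h5 : ar (ddotPt α) (dbl^[per α - 1] η) < ar (ddotPt α) (dotPt α) := by
      have a1 := dbl_eq_self_iff_pos.1 (dbl_dotPt h.periodic)
      have a2 := dbl_eq_self_iff_pos.1 (dbl_ddotPt α)
      have a3 : pos α (dotPt α) ≠ pos α (ddotPt α) := fun h' => dotPt_ne_ddotPt α (pos_inj h')
      have c1 := ar_pos_cases α (ddotPt α) (dotPt α)
      have c2 := ar_pos_cases α (ddotPt α) (dbl^[per α - 1] η)
      have b1 := pos_nonneg α (dbl^[per α - 1] η)
      have b2 := pos_lt_one α (dbl^[per α - 1] η)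
      rcases codeP_cases α (dbl^[per α - 1] η) with ⟨k, k1, -⟩ | ⟨k, k1, -⟩ <;>
      rcases codeP_cases α (dotPt α) with ⟨l, l1, -⟩ | ⟨l, l1, -⟩ <;> rw [k, l] at h4 <;>
      first | exact absurd rfl h4 | skip
      all_goals
        rcases a1 with a1 | a1 <;> rcases a2 with a2 | a2 <;> rw [a1, a2] at a3 c1 <;>
        rw [a1] at l1 <;> rw [a2] at c2 <;>
        first | exact absurd rfl a3 | skip
      all_goals
        rcases c1 with ⟨c1, c1'⟩ | ⟨c1, c1'⟩ <;> rcases c2 with ⟨c2, c2'⟩ | ⟨c2, c2'⟩ <;> linarith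
    have h6 := h1.2 h5
    have h7 := ar_cases (shadow α β 0) η α
    have h8 := h.ar_shadow_zero
    have h9 : 0 < ar β α / 2 ^ per α := by positivity
    have h10 := ar_nonneg (shadow α β 0) η
    rw [mul_zero, pow_zero, one_mul]
    rcases h7 with ⟨h7, h7'⟩ | ⟨h7, h7'⟩ <;> constructor <;> linarith
  | succ k ih =>
    have hK : ∀ i < per α * (k + 1), KP α (dbl^[per α] η) i = KM α α i := by
      intro i hi
      rw [KP_iter, hη _ (by nlinarith), KM_self_periodic]
    obtain ⟨h1, h2⟩ := ih hK
    set δ := ar (dbl^[per α] η) α with hδ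
    have hδ1 : δ < ar β α := by
      have : (1 : ℝ) ≤ 2 ^ (per α * k) := one_le_pow₀ one_le_two
      nlinarith
    have e : (2 : ℝ) ^ per α * (δ / 2 ^ per α) = δ := by field_simp
    have hlt := ar_lt_one β α
    have h3 : α - ((δ / 2 ^ per α : ℝ) : Angle) = η := by
      refine eq_of_iter_of_KP (α := α) (per α) ?_ fun i hi => ?_
      · rw [iter_dbl_sub, iter_per, e, sub_eq_iff_eq_add, hδ, add_ar]
      · rw [h.KP_sub dvd_rfl (by positivity) (by rw [e]; exact hδ1) hi, hη i (by nlinarith)]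
    -- The distance is divided by `2 ^ n` because `η` is the affine pullback of its image.
    have h4 : ar η α = δ / 2 ^ per α := by
      rw [← h3]
      refine ar_sub_coe α (by positivity) ?_
      calc δ / 2 ^ per α ≤ δ := div_le_self h1.le (one_le_pow₀ one_le_two)
        _ < 1 := hδ1.trans hlt
    rw [h4]
    refine ⟨by positivity, ?_⟩
    have : per α * (k + 1) = per α * k + per α := by ring
    rw [this, pow_add, mul_assoc, e]
    exact h2

lemma le_pow_per (hper : α ∈ Function.periodicPts dbl) {δ : ℝ} (hδ : 0 ≤ δ) (k : ℕ) :
    2 ^ k * δ ≤ 2 ^ (per α * k) * δ :=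
  two_pow_mul_le hδ (Nat.le_mul_of_pos_left k (per_pos hper))

/-- Such a point would be at positive distance below `α`, yet closer than every bound of
`ar_lt_of_KP_prefix`. -/
lemma KP_ne (h : PrePair α β) (η : Angle) : KP α η ≠ KM α α := by
  intro h'
  have h1 := fun k => h.ar_lt_of_KP_prefix k (η := η) fun i _ => congrFun h' i
  obtain ⟨k, hk⟩ := exists_lt_two_pow_mul (C := 1) (h1 0).1
  have := le_pow_per h.periodic (ar_nonneg η α) k
  linarith [(h1 k).2, ar_lt_one β α]

/-- Points just below `η` see the prefix from above, so they are arbitrarily close to `α`. -/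
lemma eq_of_KM_eq (h : PrePair α β) {η : Angle} (h' : KM α η = KM α α) : η = α := by
  by_contra hne
  obtain ⟨k, hk⟩ := exists_lt_two_pow_mul (C := 1) (ar_pos hne)
  have hr : 0 < 1 - ar η α := by linarith [ar_lt_one η α]
  obtain ⟨ε, ⟨h1, h2⟩, h3⟩ := ((((eventually_agree_sub α η (per α * (k + 1))).and
    (eventually_lt_const_mul (C := 1) hr))).and self_mem_nhdsWithin).exists
  have h3 : 0 < ε := h3
  have h4 := (h.ar_lt_of_KP_prefix k (η := η - (ε : Angle))
    fun i hi => (h1 i hi).1.trans (congrFun h' i)).2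
  have h5 : ar (η - (ε : Angle)) α = ar η α + ε := by
    have h6 : α = η - (ε : Angle) + ((ar η α + ε : ℝ) : Angle) := by
      rw [AddCircle.coe_add, add_comm (ar η α : Angle), ← add_assoc, sub_add_cancel, add_ar]
    conv_lhs => rw [h6]
    exact ar_add_of_mem (by linarith [ar_nonneg η α]) (by linarith)
  rw [h5] at h4
  have h6 := le_pow_per h.periodic (δ := ar η α + ε) (by linarith [ar_nonneg η α]) k
  have h7 : 2 ^ k * ar η α ≤ 2 ^ k * (ar η α + ε) := by gcongr; linarith
  linarith [ar_lt_one β α]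

lemma KM_iter_eq_iff (h : PrePair α β) {θ : Angle} {k : ℕ} :
    (∀ i, KM α θ (k + i) = KM α α i) ↔ dbl^[k] θ = α := by
  constructor
  · intro h'
    refine h.eq_of_KM_eq (funext fun i => ?_)
    rw [KM_iter, h']
  · intro h' i
    rw [← KM_iter, h']

end PrePair

/-! ### The normal form of a sequence -/

open Classical in
/-- If `s` ends with `u'`, first at index `k`, replace this tail by `u` and change the preceding
symbol. -/
def collapse (u u' : Seq2) (s : Seq2) : Seq2 :=
  if h : ∃ k, ∀ i, s (k + i) = u' i then
    fun i => if i + 1 < Nat.find h then s i else if i + 1 = Nat.find h then 1 - s i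
      else u (i - Nat.find h)
  else s

namespace PrePair

/-- Both itineraries of `θ` have the itinerary from above as their normal form. -/
lemma collapse_eq (h : PrePair α β) {θ : Angle} {s : Seq2} (hs : KP α θ = s ∨ KM α θ = s) :
    collapse (KP α α) (KM α α) s = KP α θ := by
  rcases hs with rfl | rfl
  · rw [collapse, dif_neg]
    rintro ⟨k, hk⟩
    refine h.KP_ne (dbl^[k] θ) (funext fun i => ?_)
    rw [KP_iter, hk]
  · by_cases hk : ∃ k, ∀ i, KM α θ (k + i) = KM α α i
    · classical
      rw [collapse, dif_pos hk]
      -- The first index with this tail is the first time the orbit hits `α`. The two itineraries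
      -- agree until two steps before it, differ one step before it, and from then on are those of
      -- `α`.
      have h1 := h.KM_iter_eq_iff.1 (Nat.find_spec hk)
      have h2 := fun m (hm : m < Nat.find hk) => fun h' => Nat.find_min hk hm
        (h.KM_iter_eq_iff.2 h')
      funext i
      split_ifs with c1 c2
      · refine codeM_eq_codeP ?_
        rw [← Function.iterate_succ_apply' dbl]
        exact h2 _ c1
      · rw [← c2, Function.iterate_succ_apply'] at h1
        have h3 : KM α θ i ≠ KP α θ i := codeM_ne_codeP h1
        omega
      · have h3 : i = Nat.find hk + (i - Nat.find hk) := by omega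
        conv_rhs => rw [h3, ← KP_iter, h1]
    · rw [collapse, dif_neg hk]
      refine KM_eq_KP_of_not_isPreimage ?_
      rintro ⟨k, hk'⟩
      exact hk ⟨k, h.KM_iter_eq_iff.2 hk'⟩

lemma KP_eq_of_common (h : PrePair α β) {a b : Angle} {s : Seq2}
    (ha : KP α a = s ∨ KM α a = s) (hb : KP α b = s ∨ KM α b = s) : KP α a = KP α b :=
  (h.collapse_eq ha).symm.trans (h.collapse_eq hb)

/-- The endpoints of a chord of the limit lamination have equal itineraries. -/
lemma KP_eq_of_mem_limitLam (h : PrePair α β) {a b : Angle} (hab : s(a, b) ∈ limitLam α) :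
    KP α a = KP α b := by
  obtain ⟨a', b', x, y, hab', hinj, hmem, hx, hy⟩ := hab
  wlog hcase : a = a' ∧ b = b' generalizing a b
  · rcases Sym2.eq_iff.1 hab' with h1 | h1
    · exact absurd h1 hcase
    · exact (this (a := b) (b := a) (by rw [Sym2.eq_swap]; exact hab') ⟨h1.2, h1.1⟩).symm
  obtain ⟨rfl, rfl⟩ := hcase
  have key : ∀ N, ∀ᶠ i in atTop, (∀ j < N, KP α (x i) j = KP α (y i) j) ∨
      ∀ j < N, KM α (x i) j = KM α (y i) j := by
    intro N
    -- Finitely many chords have words shorter than `N`, so pairwise distinct chords eventually have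
    -- longer words, and their ends share the first `N` symbols.
    have hfin : {c : Sym2 Angle | ∃ t w, w.length < N ∧ c = chordS α t w}.Finite := by
      have h1 := (Set.finite_univ (α := Fin 2)).prod (List.finite_length_lt (Fin 2) N)
      refine (h1.image fun p => chordS α p.1 p.2).subset ?_
      rintro c ⟨t, w, hw, rfl⟩
      exact ⟨(t, w), ⟨Set.mem_univ _, hw⟩, rfl⟩
    have h2 := hinj.tendsto_cofinite.eventually hfin.compl_mem_cofinite
    rw [Nat.cofinite_eq_atTop] at h2
    filter_upwards [h2] with i hi
    obtain ⟨t, w, hw⟩ := hmem i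
    have hlen : N ≤ w.length := by
      by_contra! hc
      exact hi ⟨t, w, hc, hw⟩
    have hd := codeM_ne_codeP (dbl_dotPt h.periodic)
    have ht : t = codeP α (dotPt α) ∨ t = codeM α (dotPt α) := by omega
    rw [chordS, Sym2.eq_iff] at hw
    rcases ht with rfl | rfl
    · left
      intro j hj
      rcases hw with ⟨e1, e2⟩ | ⟨e1, e2⟩ <;>
        rw [e1, e2, KP_branchWord h.periodic _ _ _ (by omega),
          KP_branchWord h.periodic _ _ _ (by omega)]
    · right
      intro j hj
      rcases hw with ⟨e1, e2⟩ | ⟨e1, e2⟩ <;>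
        rw [e1, e2, KM_branchWord h.periodic _ _ _ (by omega),
          KM_branchWord h.periodic _ _ _ (by omega)]
  -- Near a limit point a prefix is that of one of its two itineraries. One of the four pairings
  -- survives for all lengths, and a common itinerary forces equal normal forms.
  have key2 : ∀ N, ((∀ j < N, KP α a j = KP α b j) ∨ (∀ j < N, KP α a j = KM α b j)) ∨
      ((∀ j < N, KM α a j = KP α b j) ∨ (∀ j < N, KM α a j = KM α b j)) := by
    intro N
    obtain ⟨i, ⟨h1, h2⟩, h3⟩ := ((hx.eventually (eventually_agree α a N)).and
      (hy.eventually (eventually_agree α b N))).and (key N) |>.exists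
    have hA : ∃ u, (u = KP α a ∨ u = KM α a) ∧ ∃ v, (v = KP α b ∨ v = KM α b) ∧
        ∀ j < N, u j = v j := by
      have side : ∀ {c z : Angle}, (z = c ∨ Agree α N (KP α c) z ∨ Agree α N (KM α c) z) →
          (∃ u, (u = KP α c ∨ u = KM α c) ∧ ∀ j < N, KP α z j = u j) ∧
          (∃ u, (u = KP α c ∨ u = KM α c) ∧ ∀ j < N, KM α z j = u j) := by
        rintro c z (rfl | hz | hz)
        · exact ⟨⟨_, .inl rfl, fun _ _ => rfl⟩, ⟨_, .inr rfl, fun _ _ => rfl⟩⟩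
        · exact ⟨⟨_, .inl rfl, fun j hj => (hz j hj).1⟩, ⟨_, .inl rfl, fun j hj => (hz j hj).2⟩⟩
        · exact ⟨⟨_, .inr rfl, fun j hj => (hz j hj).1⟩, ⟨_, .inr rfl, fun j hj => (hz j hj).2⟩⟩
      rcases h3 with h3 | h3
      · obtain ⟨u, hu, hu'⟩ := (side h1).1
        obtain ⟨v, hv, hv'⟩ := (side h2).1
        exact ⟨u, hu, v, hv, fun j hj => by rw [← hu' j hj, h3 j hj, hv' j hj]⟩
      · obtain ⟨u, hu, hu'⟩ := (side h1).2
        obtain ⟨v, hv, hv'⟩ := (side h2).2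
        exact ⟨u, hu, v, hv, fun j hj => by rw [← hu' j hj, h3 j hj, hv' j hj]⟩
    obtain ⟨u, rfl | rfl, v, rfl | rfl, huv⟩ := hA
    · exact .inl (.inl huv)
    · exact .inl (.inr huv)
    · exact .inr (.inl huv)
    · exact .inr (.inr huv)
  have mono : ∀ u v : Seq2, ∀ m n, m ≤ n → (∀ j < n, u j = v j) → ∀ j < m, u j = v j :=
    fun u v m n hmn hj j hjm => hj j (by omega)
  have fin : ∀ u v : Seq2, (∀ N, ∀ j < N, u j = v j) → u = v :=
    fun u v huv => funext fun j => huv (j + 1) j (by omega)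
  rcases forall_or_of_forall_or (fun m n hmn => Or.imp (mono _ _ m n hmn) (mono _ _ m n hmn))
    (fun m n hmn => Or.imp (mono _ _ m n hmn) (mono _ _ m n hmn)) key2 with h1 | h1
  · rcases forall_or_of_forall_or (mono _ _) (mono _ _) h1 with h2 | h2
    · exact fin _ _ h2
    · exact h.KP_eq_of_common (.inl rfl) (.inr (fin _ _ h2).symm)
  · rcases forall_or_of_forall_or (mono _ _) (mono _ _) h1 with h2 | h2
    · exact h.KP_eq_of_common (.inr (fin _ _ h2)) (.inl rfl)
    · exact h.KP_eq_of_common (.inr rfl) (.inr (fin _ _ h2).symm)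

end PrePair

/-! ### Finiteness of the fibres of the itinerary -/

namespace PrePair

/-- When the arc is at least `1 / 2`, its doubled remainder passes `α`. If it starts outside the arc
of the pair, the part up to `α` is long enough; if it starts inside, so does it end there, by
non-separation, and the remainder is almost a full turn. -/
lemma min_le_ar_dbl (h : PrePair α β) {p q : Angle} (hpq : KP α p = KP α q) :
    min (2 * ar p q) (ar β α) ≤ ar (dbl p) (dbl q) := by
  rcases ar_dbl_cases p q with ⟨_, h1⟩ | ⟨h1, h1'⟩
  · exact (min_le_left _ _).trans h1.ge
  · refine (min_le_right _ _).trans ?_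
    have hV := h.between_iff_of_KP_eq (a := dbl p) (b := dbl q) (by
      funext i
      have := congrFun hpq (i + 1)
      exact this)
    rw [between_iff h.ne, between_iff h.ne] at hV
    have hc : codeP α p = codeP α q := congrFun hpq 0
    have h2 := ar_pos_cases α p q
    have h3 := codeP_cases α p
    have h4 := codeP_cases α q
    have h5 := ar_nonneg α (dbl q)
    have h6 := ar_lt_one α (dbl p)
    have h7 := pos_lt_one α q
    have h8 := pos_nonneg α p
    have hl := h.ar_lt
    rw [hc] at h3
    by_cases hp : 1 - ar β α < ar α (dbl p)
    · have hq := hV.1 hp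
      grind
    · grind

lemma min_le_ar_iter (h : PrePair α β) {p q : Angle} (hpq : KP α p = KP α q) (k : ℕ) :
    min (2 ^ k * ar p q) (ar β α) ≤ ar (dbl^[k] p) (dbl^[k] q) := by
  induction k with
  | zero => simp
  | succ k ih =>
    have h1 := h.min_le_ar_dbl (p := dbl^[k] p) (q := dbl^[k] q) (by
      funext i; rw [KP_iter, KP_iter, hpq])
    rw [Function.iterate_succ_apply', Function.iterate_succ_apply']
    refine le_trans (le_min ?_ (min_le_right _ _)) h1
    have h0 := ar_nonneg β α
    rw [pow_succ]
    rcases min_cases (2 ^ k * ar p q) (ar β α) with ⟨h2, h3⟩ | ⟨h2, h3⟩ <;>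
    rcases min_cases (2 ^ k * 2 * ar p q) (ar β α) with ⟨h4, h5⟩ | ⟨h4, h5⟩ <;>
    rw [h4] <;> rw [h2] at ih <;> linarith

/-- Points of one fibre are expanded until any two are at least `ar β α` apart; only boundedly many
fit on the circle. -/
lemma finite_fiber (h : PrePair α β) (s : Seq2) : {p : Angle | KP α p = s}.Finite := by
  by_contra hinf
  have hl := ar_pos h.ne
  obtain ⟨t, hts, hcard⟩ := Set.Infinite.exists_subset_card_eq hinf (⌊1 / ar β α⌋₊ + 2)
  have hk : ∃ k : ℕ, ∀ p ∈ t, ∀ q ∈ t, p ≠ q → 1 < 2 ^ k * ar p q := by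
    have h1 : ∀ᶠ k : ℕ in atTop, ∀ p ∈ t, ∀ q ∈ t, p ≠ q → 1 < 2 ^ k * ar p q := by
      rw [Filter.eventually_all_finset]
      intro p _
      rw [Filter.eventually_all_finset]
      intro q _
      by_cases hpq : p = q
      · exact Eventually.of_forall fun k hk => absurd hpq hk
      · obtain ⟨m, hm⟩ := exists_lt_two_pow_mul (C := 1) (ar_pos hpq)
        filter_upwards [eventually_ge_atTop m] with k hk _
        exact hm.trans_le (two_pow_mul_le (ar_nonneg _ _) hk)
    exact h1.exists
  obtain ⟨k, hk⟩ := hk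
  have hsep : ∀ p ∈ t, ∀ q ∈ t, p ≠ q → ar β α ≤ ar (dbl^[k] p) (dbl^[k] q) := by
    intro p hp q hq hpq
    have h1 := h.min_le_ar_iter ((hts hp : KP α p = s).trans (hts hq : KP α q = s).symm) k
    rwa [min_eq_right (by linarith [hk p hp q hq hpq, ar_lt_one β α])] at h1
  let f : Angle → ℕ := fun p => ⌊ar 0 (dbl^[k] p) / ar β α⌋₊
  -- The circle is cut into cells of length `ar β α`, one fewer than the chosen points, so two of
  -- them share a cell.
  have hmaps : Set.MapsTo f t (Finset.range (⌊1 / ar β α⌋₊ + 1)) := by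
    intro p _
    rw [Finset.coe_range, Set.mem_Iio, Nat.lt_succ_iff]
    exact Nat.floor_le_floor (by gcongr; exact (ar_lt_one _ _).le)
  obtain ⟨p, hp, q, hq, hpq, hf⟩ := Finset.exists_ne_map_eq_of_card_lt_of_maps_to
    (by rw [Finset.card_range, hcard]; omega) hmaps
  have key : ∀ p ∈ t, ∀ q ∈ t, p ≠ q → f p = f q →
      ar 0 (dbl^[k] p) ≤ ar 0 (dbl^[k] q) → False := by
    intro p hp q hq hpq hf hle
    have h1 := hsep p hp q hq hpq
    rcases ar_cases 0 (dbl^[k] p) (dbl^[k] q) with ⟨_, h2⟩ | ⟨h2, _⟩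
    · have h3 : (f p : ℝ) ≤ ar 0 (dbl^[k] p) / ar β α :=
        Nat.floor_le (div_nonneg (ar_nonneg _ _) hl.le)
      have h4 : ar 0 (dbl^[k] q) / ar β α < f q + 1 := Nat.lt_floor_add_one _
      rw [div_lt_iff₀ hl] at h4
      rw [le_div_iff₀ hl, hf] at h3
      linarith
    · linarith
  rcases le_total (ar 0 (dbl^[k] p)) (ar 0 (dbl^[k] q)) with hle | hle
  · exact key p hp q hq hpq hf hle
  · exact key q hq p hp hpq.symm hf.symm hle

end PrePair

/-! ### Gaps of the cylinder sets -/

/-- The lower end `x` of a gap carries its symbol from below, so it may be the excluded upper end of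
the semicircle; order is still preserved there. -/
lemma ar_lt_ar_dbl_of_codeM {x y q : Angle} {s : Fin 2} (hx : codeM α x = s)
    (hy : codeP α y = s) (hq : codeP α q = s) :
    ar x q < ar x y ↔ ar (dbl x) (dbl q) < ar (dbl x) (dbl y) := by
  by_cases h : dbl x = α
  · have hp := dbl_eq_self_iff_pos.1 h
    rw [h]
    have h1 := ar_pos_cases α x q
    have h2 := ar_pos_cases α x y
    have h3 := codeP_cases α q
    have h4 := codeP_cases α y
    have h5 := codeM_cases α x
    have h6 := pos_lt_one α q
    have h7 := pos_lt_one α y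
    have h8 := pos_nonneg α q
    have h9 := pos_nonneg α y
    rw [hq] at h3
    rw [hy] at h4
    rw [hx] at h5
    rcases fin2_cases s with rfl | rfl <;> simp at h3 h4 h5 <;> grind
  · rw [codeM_eq_codeP h] at hx
    exact ar_lt_ar_dbl (hq.trans hx.symm) (hy.trans hx.symm)

/-- A gap around `α` lifts to one that leaves the semicircle at its upper end and reenters at its
lower end, so it swallows the whole opposite semicircle. -/
lemma ar_lt_ar_of_codeP_ne {x y q : Angle} {s : Fin 2} (hx : codeM α x = s)
    (hy : codeP α y = s) (hq : codeP α q ≠ s)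
    (h : dbl x = α ∨ ar α (dbl y) < ar α (dbl x)) : ar x q < ar x y := by
  have h1 := ar_pos_cases α x q
  have h2 := ar_pos_cases α x y
  have h3 := codeP_cases α q
  have h4 := codeP_cases α y
  have h6 := pos_lt_one α q
  have h7 := pos_lt_one α y
  have h8 := pos_nonneg α q
  have h9 := pos_nonneg α y
  have h10 := pos_nonneg α x
  by_cases hα : dbl x = α
  · have hp := dbl_eq_self_iff_pos.1 hα
    have h5 := codeM_cases α x
    rw [hy] at h4
    rw [hx] at h5
    rcases fin2_cases s with rfl | rfl <;> rcases fin2_cases (codeP α q) with h0 | h0 <;>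
      rw [h0] at h3 hq <;> simp at h3 h4 h5 hq <;> grind
  · have h := h.resolve_left hα
    rw [codeM_eq_codeP hα] at hx
    have h5 := codeP_cases α x
    rw [hy] at h4
    rw [hx] at h5
    rcases fin2_cases s with rfl | rfl <;> rcases fin2_cases (codeP α q) with h0 | h0 <;>
      rw [h0] at h3 hq <;> simp at h3 h4 h5 hq <;> grind

/-- `x` and `y` are the endpoints of the chord given by `w`, with the codes from below for `x`
and from above for `y`. -/
def IsGapChord (α x y : Angle) : Prop :=
  ∃ w : List (Fin 2),
    (x = branchWord α (codeM α (dotPt α)) w (dotPt α) ∧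
      y = branchWord α (codeP α (dotPt α)) w (ddotPt α)) ∨
    (x = branchWord α (codeM α (dotPt α)) w (ddotPt α) ∧
      y = branchWord α (codeP α (dotPt α)) w (dotPt α))

lemma branchWord_ddotPt (hper : α ∈ Function.periodicPts dbl) (t t' : Fin 2)
    (w : List (Fin 2)) : branchWord α t w (ddotPt α) = branchWord α t' w (ddotPt α) := by
  induction w with
  | nil => rfl
  | cons s w ih =>
    change branch α t s (branchWord α t w (ddotPt α)) =
      branch α t' s (branchWord α t' w (ddotPt α))
    have hne : branchWord α t' w (ddotPt α) ≠ α := by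
      intro h'
      have := iter_branchWord hper t' w (ddotPt α)
      rw [h'] at this
      exact iter_ne_ddotPt hper _ this
    rw [ih, branch, branch, if_neg hne, if_neg hne]

lemma IsGapChord.mem_lam (hper : α ∈ Function.periodicPts dbl) {x y : Angle}
    (h : IsGapChord α x y) : s(x, y) ∈ lam α := by
  obtain ⟨w, ⟨rfl, rfl⟩ | ⟨rfl, rfl⟩⟩ := h
  · exact ⟨codeM α (dotPt α), w, by
      rw [chordS, branchWord_ddotPt hper (codeP α (dotPt α)) (codeM α (dotPt α))]⟩
  · exact ⟨codeP α (dotPt α), w, by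
      rw [chordS, branchWord_ddotPt hper (codeM α (dotPt α)) (codeP α (dotPt α)),
        Sym2.eq_swap]⟩

/-- Every point outside of a cylinder set lies in a gap that is bounded by a chord of the
lamination. -/
lemma exists_gap (hper : α ∈ Function.periodicPts dbl) (k : ℕ) (s : Seq2) {p : Angle}
    (hp : ¬ ∀ i < k, KP α p i = s i) :
    ∃ x y, ar x p < ar x y ∧ IsGapChord α x y ∧ (∀ i < k, KM α x i = s i) ∧
      (∀ i < k, KP α y i = s i) ∧ ∀ q, ar x q < ar x y → ¬ ∀ i < k, KP α q i = s i := by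
  induction k generalizing s p with
  | zero => exact absurd (by simp) hp
  | succ k ih =>
    set t := codeP α (dotPt α) with ht
    set e := codeM α (dotPt α) with he
    have hKP : ∀ (θ : Angle) (c : Fin 2), (∀ i < k + 1, KP α θ i = s i) ↔
        codeP α θ = s 0 ∧ ∀ i < k, KP α (dbl θ) i = shift s i := by
      intro θ _
      constructor
      · exact fun h => ⟨h 0 (by omega), fun i hi => h (i + 1) (by omega)⟩
      · rintro ⟨h0, h⟩ (_ | i) hi
        · exact h0
        · exact h i (by omega)
    have hKM : ∀ (θ : Angle), codeM α θ = s 0 → (∀ i < k, KM α (dbl θ) i = shift s i) →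
        ∀ i < k + 1, KM α θ i = s i := by
      rintro θ h0 h (_ | i) hi
      · exact h0
      · exact h i (by omega)
    have lift : ∀ x' y', IsGapChord α x' y' → IsGapChord α (branch α e (s 0) x')
        (branch α t (s 0) y') := by
      rintro x' y' ⟨w, ⟨rfl, rfl⟩ | ⟨rfl, rfl⟩⟩
      · exact ⟨s 0 :: w, .inl ⟨rfl, rfl⟩⟩
      · exact ⟨s 0 :: w, .inr ⟨rfl, rfl⟩⟩
    have wrap : ∀ x' y', (∀ i < k, KM α x' i = shift s i) → (∀ i < k, KP α y' i = shift s i) →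
        (∀ q, ar x' q < ar x' y' → ¬ ∀ i < k, KP α q i = shift s i) →
        (∀ i < k + 1, KM α (branch α e (s 0) x') i = s i) ∧
        (∀ i < k + 1, KP α (branch α t (s 0) y') i = s i) ∧
        ∀ q, ar (branch α e (s 0) x') q < ar (branch α e (s 0) x') (branch α t (s 0) y') →
          ¬ ∀ i < k + 1, KP α q i = s i := by
      intro x' y' hx' hy' hgap
      refine ⟨hKM _ (codeM_branch hper _ _) (by rwa [dbl_branch hper]),
        (hKP _ 0).2 ⟨codeP_branch hper _ _, by rwa [dbl_branch hper]⟩, fun q hq hq' => ?_⟩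
      rw [hKP _ 0] at hq'
      rw [ar_lt_ar_dbl_of_codeM (codeM_branch hper _ _) (codeP_branch hper _ _) hq'.1,
        dbl_branch hper, dbl_branch hper] at hq
      exact hgap _ hq hq'.2
    by_cases hc : codeP α p = s 0
    · obtain ⟨x', y', h1, h2, h3, h4, h5⟩ := ih (shift s) (p := dbl p)
        fun h' => hp ((hKP _ 0).2 ⟨hc, h'⟩)
      refine ⟨_, _, ?_, lift _ _ h2, wrap _ _ h3 h4 h5⟩
      rwa [ar_lt_ar_dbl_of_codeM (codeM_branch hper _ _) (codeP_branch hper _ _) hc,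
        dbl_branch hper, dbl_branch hper]
    -- Now `p` is in the wrong semicircle, and the gap sought is the lift of the gap around `α`.
    · by_cases h1 : ∀ i < k, KP α α i = shift s i
      · by_cases h2 : ∀ i < k, KM α α i = shift s i
        -- Both sides of `α` fit the shifted prefix: the degenerate gap at `α` lifts to the long
        -- chord itself.
        · have hd := codeM_ne_codeP (dbl_dotPt hper)
          have hb : ∀ c d, branch α c d α = if c = d then dotPt α else ddotPt α :=
            fun c d => if_pos rfl
          refine ⟨branch α e (s 0) α, branch α t (s 0) α, ?_, ⟨[], ?_⟩,
            wrap α α h2 h1 (by intro q hq; rw [ar_self] at hq; linarith [ar_nonneg α q])⟩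
          · exact ar_lt_ar_of_codeP_ne (codeM_branch hper _ _) (codeP_branch hper _ _) hc
              (.inl (dbl_branch hper _ _ _))
          · rw [hb, hb]
            change (_ = dotPt α ∧ _ = ddotPt α) ∨ (_ = ddotPt α ∧ _ = dotPt α)
            by_cases h0 : e = s 0
            · rw [if_pos h0, if_neg (fun h' => hd (h0.trans h'.symm))]
              exact .inl ⟨rfl, rfl⟩
            · have : t = s 0 := by omega
              rw [if_neg h0, if_pos this]
              exact .inr ⟨rfl, rfl⟩
        -- Only the upper side of `α` fits, so points just below `α` are in a gap, and its upper end
        -- is `α`.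
        · obtain ⟨ε, hε, hε'⟩ := mem_nhdsGT_iff_exists_Ioo_subset.1 (eventually_agree_sub α α k)
          have hε : 0 < ε := hε
          set δ := min (ε / 2) (1 / 2)
          have hδ0 : 0 < δ := lt_min (by linarith) (by norm_num)
          have hδ1 : δ < ε := (min_le_left _ _).trans_lt (by linarith)
          have hδ2 : δ < 1 := (min_le_right _ _).trans_lt (by norm_num)
          have near : ∀ r, 0 < r → r ≤ δ → ¬ ∀ i < k, KP α (α - (r : Angle)) i = shift s i := by
            intro r hr hr' h'
            refine h2 fun i hi => ?_
            have : Agree α k (KM α α) (α - (r : Angle)) := hε' ⟨hr, by linarith⟩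
            rw [← h' i hi, (this i hi).1]
          obtain ⟨x', y', g1, g2, g3, g4, g5⟩ := ih (shift s) (near δ hδ0 le_rfl)
          have hα : ¬ ar x' α < ar x' y' := fun h' => g5 α h' h1
          have hy : y' = α := by
            by_contra hne
            have a0 := ar_sub_coe α hδ0.le hδ2
            have a1 := ar_cases x' (α - (δ : Angle)) α
            have a2 := ar_cases x' y' α
            have a3 := ar_pos hne
            have a4 := ar_lt_one x' α
            have a5 := ar_nonneg x' α
            have a6 := ar_lt_one x' y'
            refine near (ar y' α) a3 ?_ ?_
            · grind
            · have : α - ((ar y' α : ℝ) : Angle) = y' := by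
                rw [sub_eq_iff_eq_add, add_ar]
              rw [this]
              exact g4
          refine ⟨_, _, ?_, lift _ _ g2, wrap _ _ g3 g4 g5⟩
          refine ar_lt_ar_of_codeP_ne (codeM_branch hper _ _) (codeP_branch hper _ _) hc ?_
          rw [dbl_branch hper, dbl_branch hper, hy, ar_self]
          by_cases hx : x' = α
          · exact .inl hx
          · exact .inr (ar_pos (Ne.symm hx))
      · obtain ⟨x', y', g1, g2, g3, g4, g5⟩ := ih (shift s) h1
        refine ⟨_, _, ?_, lift _ _ g2, wrap _ _ g3 g4 g5⟩
        refine ar_lt_ar_of_codeP_ne (codeM_branch hper _ _) (codeP_branch hper _ _) hc ?_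
        rw [dbl_branch hper, dbl_branch hper]
        by_cases hx : x' = α
        · exact .inl hx
        · right
          rw [ar_symm (Ne.symm hx)] at g1
          have := ar_cases α x' y'
          have := ar_lt_one α y'
          grind

/-! ### From equal itineraries to chains of limit chords -/

namespace PrePair

/-- Neighbouring points with equal itineraries span a chord of the limit lamination. -/
lemma mem_limitLam (h : PrePair α β) {a b : Angle} (hab : KP α a = KP α b) (hne : a ≠ b)
    (hcons : ∀ c, Between a b c → KP α c ≠ KP α a) : s(a, b) ∈ limitLam α := by
  set c := ar a b with hc
  have hc0 : 0 < c := ar_pos hne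
  have hc1 : c < 1 := ar_lt_one _ _
  have hb : a + (c : Angle) = b := add_ar a b
  set p := a + ((c / 2 : ℝ) : Angle) with hp
  have hap : ar a p = c / 2 := ar_add_of_mem (by linarith) (by linarith)
  have hpne : KP α p ≠ KP α a := hcons p ⟨by rw [hap]; linarith, by rw [hap]; linarith⟩
  obtain ⟨K, hK⟩ := Function.ne_iff.1 hpne
  -- The midpoint of the arc leaves the cylinder of the fibre at level `K + 1`. At every later level
  -- its gap avoids `a` and `b`, so it stays inside the arc from `a` to `b`.
  have hgap : ∀ k, ∃ x y, IsGapChord α x y ∧ (∀ i < K + 1 + k, KM α x i = KP α a i) ∧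
      (∀ i < K + 1 + k, KP α y i = KP α a i) ∧ 0 < ar a x ∧ ar a x ≤ c / 2 ∧
      c / 2 < ar a y ∧ ar a y ≤ c := by
    intro k
    obtain ⟨x, y, h1, h2, h3, h4, h5⟩ := exists_gap h.periodic (K + 1 + k) (KP α a)
      (fun h' => hK (h' K (by omega)))
    have ha : ¬ ar x a < ar x y := fun h' => h5 a h' fun i _ => rfl
    have hb : ¬ ar x b < ar x y := fun h' => h5 b h' fun i _ => by rw [hab]
    refine ⟨x, y, h2, h3, h4, ?_⟩
    have b1 := ar_cases a x p
    have b2 := ar_cases a x y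
    have b3 := ar_cases a x b
    have b4 := ar_cases a x a
    have b5 := ar_nonneg a x
    have b6 := ar_lt_one x y
    have b7 := ar_nonneg a y
    have b8 := ar_lt_one a y
    have b9 := ar_lt_one a x
    rw [ar_self] at b4
    rw [hap] at b1
    grind
  choose x y hch hx hy hx0 hx1 hy0 hy1 using hgap
  obtain ⟨⟨ξ, η⟩, ⟨⟨mξ0, mη0⟩, mξ1, mη1⟩, φ, hφ, hlim⟩ :=
    (isCompact_Icc (a := ((0 : ℝ), c / 2)) (b := (c / 2, c))).tendsto_subseq
    (x := fun k => (ar a (x k), ar a (y k)))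
    (fun k => ⟨⟨(hx0 k).le, (hy0 k).le⟩, ⟨hx1 k, hy1 k⟩⟩)
  simp only at mξ0 mη0 mξ1 mη1
  have lx : Tendsto (fun k => ar a (x (φ k))) atTop (𝓝 ξ) := (continuous_fst.tendsto _).comp hlim
  have ly : Tendsto (fun k => ar a (y (φ k))) atTop (𝓝 η) := (continuous_snd.tendsto _).comp hlim
  have hcont : Continuous fun r : ℝ => a + (r : Angle) :=
    continuous_const.add (AddCircle.continuous_mk' 1)
  have lX : Tendsto (fun k => x (φ k)) atTop (𝓝 (a + (ξ : Angle))) := by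
    have := (hcont.tendsto ξ).comp lx
    simpa only [Function.comp_def, add_ar] using this
  have lY : Tendsto (fun k => y (φ k)) atTop (𝓝 (a + (η : Angle))) := by
    have := (hcont.tendsto η).comp ly
    simpa only [Function.comp_def, add_ar] using this
  have hX : KP α (a + (ξ : Angle)) = KP α a := by
    refine h.KP_eq_of_common (s := KP α a) (KP_or_KM_of_tendsto lX fun N => ?_) (.inl rfl)
    filter_upwards [eventually_ge_atTop N] with k hk
    exact .inr fun i hi => hx _ i (by have := hφ.id_le k; simp only [id] at this; omega)
  have hY : KP α (a + (η : Angle)) = KP α a := by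
    refine h.KP_eq_of_common (s := KP α a) (KP_or_KM_of_tendsto lY fun N => ?_) (.inl rfl)
    filter_upwards [eventually_ge_atTop N] with k hk
    exact .inl fun i hi => hy _ i (by have := hφ.id_le k; simp only [id] at this; omega)
  -- Limits of gap ends belong to the fibre, which has no point strictly between `a` and `b`.
  have hξ : ξ = 0 := by
    by_contra hne
    have e : ar a (a + (ξ : Angle)) = ξ := ar_add_of_mem mξ0 (by linarith)
    exact hcons _ ⟨by rw [e]; exact lt_of_le_of_ne mξ0 (Ne.symm hne), by rw [e]; linarith⟩ hX
  have hη : η = c := by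
    by_contra hne
    have e : ar a (a + (η : Angle)) = η := ar_add_of_mem (by linarith) (by linarith)
    exact hcons _ ⟨by rw [e]; linarith, by rw [e]; exact lt_of_le_of_ne mη1 hne⟩ hY
  rw [hξ, AddCircle.coe_zero, add_zero] at lX
  rw [hη, hb] at lY
  rw [hξ] at lx
  -- The distances from `a` to `x` are positive and tend to zero, so a subsequence has strictly
  -- increasing inverses and gives distinct chords.
  have linv : Tendsto (fun k => (ar a (x (φ k)))⁻¹) atTop atTop :=
    tendsto_inv_nhdsGT_zero.comp (tendsto_nhdsWithin_iff.2 ⟨lx, Eventually.of_forall fun k => hx0 _⟩)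
  obtain ⟨ψ, hψ, hmono⟩ := strictMono_subseq_of_tendsto_atTop linv
  refine ⟨a, b, fun k => x (φ (ψ k)), fun k => y (φ (ψ k)), rfl, ?_,
    fun k => (hch _).mem_lam h.periodic, lX.comp hψ.tendsto_atTop, lY.comp hψ.tendsto_atTop⟩
  intro i j hij
  rcases Sym2.eq_iff.1 hij with ⟨h1, -⟩ | ⟨h1, -⟩
  · refine hmono.injective ?_
    exact congrArg (fun z => (ar a z)⁻¹) h1
  · have := hx1 (φ (ψ i))
    have h2 : ar a (x (φ (ψ i))) = ar a (y (φ (ψ j))) := congrArg (ar a) h1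
    linarith [hy0 (φ (ψ j))]

/-- Induction on the number of fibre points strictly between `a` and `b`, finite by `finite_fiber`:
consecutive ones are joined by a limit chord. -/
lemma juliaEquiv_of_KP_eq (h : PrePair α β) {a b : Angle} (hab : KP α a = KP α b) :
    JuliaEquiv α a b := by
  have key : ∀ n : ℕ, ∀ a b, KP α a = KP α b →
      {c | KP α c = KP α a ∧ Between a b c}.ncard ≤ n → JuliaEquiv α a b := by
    intro n
    have hfin : ∀ a b, {c | KP α c = KP α a ∧ Between a b c}.Finite :=
      fun a b => (h.finite_fiber (KP α a)).subset fun c hc => hc.1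
    induction n with
    | zero =>
      intro a b hab hn
      by_cases hne : a = b
      · rw [hne]; exact Relation.ReflTransGen.refl
      · refine Relation.ReflTransGen.single (h.mem_limitLam hab hne fun c hc hc' => ?_)
        rw [Nat.le_zero, Set.ncard_eq_zero (hfin a b)] at hn
        exact (hn ▸ (show c ∈ {c | KP α c = KP α a ∧ Between a b c} from ⟨hc', hc⟩) :
          c ∈ (∅ : Set Angle)).elim
    | succ n ih =>
      intro a b hab hn
      by_cases hne : a = b
      · rw [hne]; exact Relation.ReflTransGen.refl
      by_cases hex : ∃ c, KP α c = KP α a ∧ Between a b c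
      · obtain ⟨c, hc, hc'⟩ := hex
        have b1 := hc'.1
        have b2 := hc'.2
        have l1 : {d | KP α d = KP α a ∧ Between a c d}.ncard <
            {d | KP α d = KP α a ∧ Between a b d}.ncard := by
          refine Set.ncard_lt_ncard ?_ (hfin a b)
          refine ⟨fun d hd => ⟨hd.1, hd.2.1, hd.2.2.trans b2⟩, fun hsub => ?_⟩
          exact lt_irrefl _ (hsub ⟨hc, hc'⟩ : _ ∧ Between a c c).2.2
        have l2 : {d | KP α d = KP α c ∧ Between c b d}.ncard <
            {d | KP α d = KP α a ∧ Between a b d}.ncard := by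
          refine Set.ncard_lt_ncard ?_ (hfin a b)
          refine ⟨fun d hd => ⟨hd.1.trans hc, ?_⟩, fun hsub => ?_⟩
          · obtain ⟨_, h1, h2⟩ := hd
            have := ar_cases a c d
            have := ar_cases a c b
            have := ar_nonneg a d
            have := ar_lt_one a b
            have := ar_lt_one a d
            unfold Between
            grind
          · have := (hsub ⟨hc, hc'⟩ : _ ∧ Between c b c).2.1
            rw [ar_self] at this
            exact lt_irrefl _ this
        exact (ih a c hc.symm (by omega)).trans (ih c b (hc.trans hab) (by omega))
      · refine Relation.ReflTransGen.single (h.mem_limitLam hab hne fun c hc hc' => ?_)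
        exact hex ⟨c, hc', hc⟩
  exact key _ a b hab le_rfl

/-- Julia equivalence is equality of itineraries. -/
lemma juliaEquiv_iff (h : PrePair α β) {a b : Angle} :
    JuliaEquiv α a b ↔ KP α a = KP α b := by
  refine ⟨fun h' => ?_, h.juliaEquiv_of_KP_eq⟩
  induction h' with
  | refl => rfl
  | tail _ h2 ih => exact ih.trans (h.KP_eq_of_mem_limitLam h2)

end PrePair

/-! ### Reflection of laminations and companions -/

lemma dotPt_neg (α : Angle) : dotPt (-α) = -dotPt α := by
  rw [dotPt, per_neg, iter_dbl_neg, dotPt]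

lemma ddotPt_neg (hper : α ∈ Function.periodicPts dbl) : ddotPt (-α) = -ddotPt α := by
  refine (eq_ddotPt (periodic_neg hper) ?_ ?_).symm
  · rw [dbl_neg, dbl_ddotPt]
  · rw [dotPt_neg]
    exact fun h => dotPt_ne_ddotPt α (neg_injective h).symm

lemma branch_neg (hper : α ∈ Function.periodicPts dbl) (h0 : α ≠ 0) (t s : Fin 2) (θ : Angle) :
    branch (-α) t s (-θ) = -branch α t s θ := by
  by_cases h : θ = α
  · rw [branch, branch, if_pos (by rw [h]), if_pos h]
    split_ifs
    · exact dotPt_neg α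
    · exact ddotPt_neg hper
  · refine eq_of_dbl_of_codeP (α := -α) ?_ ?_
    · rw [dbl_branch (periodic_neg hper), dbl_neg, dbl_branch hper]
    · rw [codeP_branch_of_ne _ _ fun h' => h (neg_injective h'), codeP_neg h0,
        codeM_eq_codeP (by rwa [dbl_branch hper]), codeP_branch_of_ne _ _ h]

lemma branchWord_neg (hper : α ∈ Function.periodicPts dbl) (h0 : α ≠ 0) (t : Fin 2)
    (w : List (Fin 2)) (θ : Angle) : branchWord (-α) t w (-θ) = -branchWord α t w θ := by
  induction w with
  | nil => rfl
  | cons s w ih =>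
    change branch (-α) t s (branchWord (-α) t w (-θ)) = -branch α t s (branchWord α t w θ)
    rw [ih, branch_neg hper h0]

lemma repWord_neg (h0 : α ≠ 0) : repWord (-α) = repWord α := by
  rw [repWord_eq, repWord_eq, per_neg, KP_neg h0]
  refine List.map_congr_left fun i hi => ?_
  rw [List.mem_range] at hi
  refine codeM_eq_codeP ?_
  rw [← Function.iterate_succ_apply' dbl, Ne, iter_eq_self_iff]
  intro h'
  have := Nat.le_of_dvd (by omega) h'
  omega

lemma charSym_neg (hper : α ∈ Function.periodicPts dbl) (h0 : α ≠ 0) :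
    charSym (-α) = charSym α := by
  unfold charSym
  rw [repWord_neg h0, dotPt_neg, ddotPt_neg hper, branchWord_neg hper h0,
    branchWord_neg hper h0, dist_neg_neg]

lemma companionSeq_neg (hper : α ∈ Function.periodicPts dbl) (h0 : α ≠ 0) (k : ℕ) :
    companionSeq (-α) k = -companionSeq α k := by
  unfold companionSeq
  rw [repWord_neg h0, charSym_neg hper h0, ddotPt_neg hper, branchWord_neg hper h0]

lemma neg_mem_lam (hper : α ∈ Function.periodicPts dbl) (h0 : α ≠ 0) {x y : Angle}
    (h : s(x, y) ∈ lam α) : s(-x, -y) ∈ lam (-α) := by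
  obtain ⟨t, w, hw⟩ := h
  refine ⟨t, w, ?_⟩
  have := congrArg (Sym2.map Neg.neg) hw
  rw [chordS, Sym2.map_mk, Sym2.map_mk] at this
  rw [chordS, dotPt_neg, ddotPt_neg hper, branchWord_neg hper h0, branchWord_neg hper h0]
  exact this

lemma neg_mem_limitLam (hper : α ∈ Function.periodicPts dbl) (h0 : α ≠ 0) {x y : Angle}
    (h : s(x, y) ∈ limitLam α) : s(-x, -y) ∈ limitLam (-α) := by
  obtain ⟨a, b, u, v, hab, hinj, hmem, hu, hv⟩ := h
  refine ⟨-a, -b, fun i => -u i, fun i => -v i, ?_, ?_, fun i => neg_mem_lam hper h0 (hmem i),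
    hu.neg, hv.neg⟩
  · exact congrArg (Sym2.map Neg.neg) hab
  · intro i j hij
    have := congrArg (Sym2.map Neg.neg) hij
    simp only [Sym2.map_mk, neg_neg] at this
    exact hinj this

lemma juliaEquiv_neg_of (hper : α ∈ Function.periodicPts dbl) (h0 : α ≠ 0) {a b : Angle}
    (h : JuliaEquiv α a b) : JuliaEquiv (-α) (-a) (-b) := by
  induction h with
  | refl => exact Relation.ReflTransGen.refl
  | tail _ h2 ih => exact ih.tail (neg_mem_limitLam hper h0 h2)

lemma juliaEquiv_neg (hper : α ∈ Function.periodicPts dbl) (h0 : α ≠ 0) {a b : Angle} :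
    JuliaEquiv (-α) (-a) (-b) ↔ JuliaEquiv α a b := by
  refine ⟨fun h => ?_, juliaEquiv_neg_of hper h0⟩
  have := juliaEquiv_neg_of (periodic_neg hper) (neg_ne_zero.2 h0) h
  rwa [neg_neg, neg_neg, neg_neg] at this

/-! ### The two itineraries of a pair -/

namespace PrePair

lemma tendsto_companionSeq_right (h : PrePair α β) :
    Tendsto (companionSeq β) atTop (𝓝 α) := by
  have h1 := h.neg.tendsto_companionSeq.neg
  rw [neg_neg] at h1
  refine h1.congr fun k => ?_
  rw [companionSeq_neg h.periodic_right h.ne_zero_right, neg_neg]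

lemma juliaEquiv_iff_right (h : PrePair α β) {a b : Angle} :
    JuliaEquiv β a b ↔ KM β a = KM β b := by
  rw [← juliaEquiv_neg h.periodic_right h.ne_zero_right, h.neg.juliaEquiv_iff,
    KP_neg h.ne_zero_right, KP_neg h.ne_zero_right]

lemma KM_right (h : PrePair α β) : KM β β = KP α α := by
  rw [h.KM_eq_of_not_between h.not_between', h.KP_eq]

lemma KP_right (h : PrePair α β) : KP β β = KM α α := by
  have h1 := h.KM_right
  funext i
  have h2 : codeM β (dbl^[i] β) = codeP α (dbl^[i] α) := congrFun h1 i
  change codeP β (dbl^[i] β) = codeM α (dbl^[i] α)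
  have h3 := codeM_eq_codeP_iff (α := α) (θ := dbl^[i] α)
  have h4 := codeM_eq_codeP_iff (α := β) (θ := dbl^[i] β)
  have h5 : dbl (dbl^[i] β) = β ↔ dbl (dbl^[i] α) = α := by
    rw [← Function.iterate_succ_apply' dbl, ← Function.iterate_succ_apply' dbl,
      iter_eq_self_iff, iter_eq_self_iff, h.per_eq]
  by_cases h6 : dbl (dbl^[i] α) = α
  · have h7 : ¬ _ := fun h' => h3.1 h' h6
    have h8 : ¬ _ := fun h' => h4.1 h' (h5.2 h6)
    rw [h2] at h8
    omega
  · rw [h3.2 h6, ← h2, h4.2 (fun h' => h6 (h5.1 h'))]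

lemma collapse_eq_right (h : PrePair α β) {θ : Angle} {s : Seq2}
    (hs : KP β θ = s ∨ KM β θ = s) : collapse (KP α α) (KM α α) s = KM β θ := by
  have h0 := h.ne_zero_right
  have h1 := h.neg.collapse_eq (θ := -θ) (s := s) (by rw [KP_neg h0, KM_neg h0]; exact hs.symm)
  rwa [KP_neg h0, KM_neg h0, KP_neg h0, h.KM_right, h.KP_right] at h1

/-- The symbols change exactly over the arc of the pair, and points with equal itineraries enter it
at the same times. -/
lemma KM_right_eq_of_KP_eq (h : PrePair α β) {a b : Angle} (hab : KP α a = KP α b) :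
    KM β a = KM β b := by
  funext i
  have h1 := h.codeM_eq_iff (θ := dbl^[i] a)
  have h2 := h.codeM_eq_iff (θ := dbl^[i] b)
  have h3 : codeP α (dbl^[i] a) = codeP α (dbl^[i] b) := congrFun hab i
  have h4 : Between β α (dbl (dbl^[i] a)) ↔ Between β α (dbl (dbl^[i] b)) := by
    rw [← Function.iterate_succ_apply' dbl, ← Function.iterate_succ_apply' dbl]
    refine h.between_iff_of_KP_eq ?_
    funext j
    rw [KP_iter, KP_iter, hab]
  change codeM β (dbl^[i] a) = codeM β (dbl^[i] b)
  rw [← h3, ← h4] at h2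
  by_cases h5 : Between β α (dbl (dbl^[i] a))
  · have h6 : ¬ _ := fun h' => h1.1 h' h5
    have h7 : ¬ _ := fun h' => h2.1 h' h5
    omega
  · rw [h1.2 h5, h2.2 h5]

lemma KP_eq_iff (h : PrePair α β) {a b : Angle} : KP α a = KP α b ↔ KM β a = KM β b := by
  refine ⟨h.KM_right_eq_of_KP_eq, fun hab => ?_⟩
  have := h.neg.KM_right_eq_of_KP_eq (a := -a) (b := -b)
    (by rwa [KP_neg h.ne_zero_right, KP_neg h.ne_zero_right])
  rwa [KM_neg h.ne_zero, KM_neg h.ne_zero] at this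

/-! ### Exchanging the two itineraries -/

/-- The preimages of the arc of the pair lie at the upper ends of the two semicircles, and no orbit
point of the pair lies in them. Such an end strip is thus on the same side of an orbit chord as the
opposite semicircle. -/
lemma between_iff_of_between_dbl (h : PrePair α β) {j : ℕ} {y z : Angle}
    (hy : Between β α (dbl y)) (hz : codeP α z ≠ codeP α (dbl^[j] α)) :
    Between (dbl^[j] β) (dbl^[j] α) y ↔ Between (dbl^[j] β) (dbl^[j] α) z := by
  have hc : codeP α (dbl^[j] β) = codeP α (dbl^[j] α) := congrFun h.KP_eq j
  by_cases hyc : codeP α y = codeP α (dbl^[j] α)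
  · have hp := h.not_between' (j + 1)
    have hq := h.not_between (j + 1)
    rw [Function.iterate_succ_apply', between_iff h.ne] at hp hq
    rw [between_iff h.ne] at hy
    have a1 := codeP_cases α (dbl^[j] β)
    have a2 := codeP_cases α (dbl^[j] α)
    have a3 := codeP_cases α y
    have a4 := codeP_cases α z
    have b1 := ar_pos_cases α (dbl^[j] β) y
    have b2 := ar_pos_cases α (dbl^[j] β) z
    have b3 := ar_pos_cases α (dbl^[j] β) (dbl^[j] α)
    have c1 := pos_nonneg α z
    have c2 := pos_lt_one α z
    have c3 := pos_nonneg α (dbl^[j] α)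
    have c4 := pos_lt_one α y
    have d1 : dbl^[j] β ≠ y := by rintro rfl; exact hp hy
    have d2 : dbl^[j] β ≠ z := by rintro rfl; exact hz hc
    have e1 := ar_pos d1
    have e2 := ar_pos d2
    unfold Between
    rw [hc] at a1
    rw [hyc] at a3
    rcases fin2_cases (codeP α (dbl^[j] α)) with k | k <;> rw [k] at a1 a2 a3 hz <;>
      rcases fin2_cases (codeP α z) with l | l <;> rw [l] at a4 hz <;>
      simp at a1 a2 a3 a4 hz <;> grind
  · exact between_iff_of_codeP_ne hc.symm (by rwa [hc]) (by rwa [hc])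

/-- Changing the symbol over the arc of the pair does not change the side of any orbit chord: if the
symbol changes, one of the two points is in an end strip and the other is opposite to the chord; if
not, the claim is inherited from the doubles. -/
lemma between_iff_of_flip (h : PrePair α β) {y y' : Angle}
    (hd : ∀ j, Between (dbl^[j] β) (dbl^[j] α) (dbl y) ↔
      Between (dbl^[j] β) (dbl^[j] α) (dbl y'))
    (hc : codeP α y' = codeP α y ↔ ¬ Between β α (dbl y)) (j : ℕ) :
    Between (dbl^[j] β) (dbl^[j] α) y ↔ Between (dbl^[j] β) (dbl^[j] α) y' := by
  have hcj : codeP α (dbl^[j] β) = codeP α (dbl^[j] α) := congrFun h.KP_eq j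
  by_cases hV : Between β α (dbl y)
  · have hV' : Between β α (dbl y') := (hd 0).1 hV
    have hne : ¬ _ := fun h' => hc.1 h' hV
    by_cases hz : codeP α y' = codeP α (dbl^[j] α)
    · exact (h.between_iff_of_between_dbl hV' (by rw [← hz]; exact Ne.symm hne)).symm
    · exact h.between_iff_of_between_dbl hV hz
  · have hyy := hc.2 hV
    by_cases hz : codeP α y = codeP α (dbl^[j] α)
    · rw [between_dbl hcj.symm (by rw [hz, hcj]), between_dbl hcj.symm (by rw [hyy, hz, hcj]),
        ← Function.iterate_succ_apply' dbl, ← Function.iterate_succ_apply' dbl]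
      exact hd (j + 1)
    · exact between_iff_of_codeP_ne hcj.symm (by rwa [hcj]) (by rwa [hyy, hcj])

/-- Going back from the common image, both orbits keep to the same sides of all orbit chords. They
therefore enter the arc of the pair simultaneously, so the flips are undone when the other coding is
read. -/
lemma KM_right_of_flip (h : PrePair α β) {θ θ' : Angle} {k : ℕ} (hk : dbl^[k] θ' = dbl^[k] θ)
    (hθ : ∀ i < k, KP α θ' i = KM β θ i) : ∀ i < k, KM β θ' i = KP α θ i := by
  have hflip : ∀ y y' : Angle, codeP α y' = codeM β y →
      (codeP α y' = codeP α y ↔ ¬ Between β α (dbl y)) := by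
    intro y y' hy
    rw [hy, h.codeM_eq_iff]
  have key : ∀ m i, i + m = k → ∀ j, Between (dbl^[j] β) (dbl^[j] α) (dbl^[i] θ) ↔
      Between (dbl^[j] β) (dbl^[j] α) (dbl^[i] θ') := by
    intro m
    induction m with
    | zero =>
      rintro i rfl j
      rw [add_zero] at hk
      rw [hk]
    | succ m ih =>
      intro i hi
      refine h.between_iff_of_flip ?_ (hflip _ _ (hθ i (by omega)))
      rw [← Function.iterate_succ_apply' dbl, ← Function.iterate_succ_apply' dbl]
      exact ih (i + 1) (by omega)
  intro i hi
  have h1 := key (k - (i + 1)) (i + 1) (by omega) 0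
  rw [Function.iterate_succ_apply', Function.iterate_succ_apply'] at h1
  have h2 : codeP α (dbl^[i] θ') = codeM β (dbl^[i] θ) := hθ i hi
  have h3 := h.codeM_eq_iff (θ := dbl^[i] θ)
  have h4 := h.codeM_eq_iff (θ := dbl^[i] θ')
  change codeM β (dbl^[i] θ') = codeP α (dbl^[i] θ)
  change Between β α _ ↔ Between β α _ at h1
  rw [← h1, h2] at h4
  by_cases hV : Between β α (dbl (dbl^[i] θ))
  · have h5 : ¬ _ := fun h' => h3.1 h' hV
    have h6 : ¬ _ := fun h' => h4.1 h' hV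
    omega
  · rw [h4.2 hV, h3.2 hV]

/-- Some angle has the two itineraries of `θ` exchanged. -/
lemma exists_exchange (h : PrePair α β) (θ : Angle) :
    ∃ θ', KP α θ' = KM β θ ∧ KM β θ' = KP α θ := by
  -- The image after `k` steps is pulled back along the first `k` symbols of the other itinerary;
  -- accumulation points realise the exchange.
  choose x hx hx' using fun k => exists_KP α (dbl^[k] θ) (KM β θ) k
  obtain ⟨θ', -, φ, hφ, hlim⟩ := isCompact_univ.tendsto_subseq (x := x) fun _ => Set.mem_univ _
  have h1 : KP α θ' = KM β θ ∨ KM α θ' = KM β θ := by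
    refine KP_or_KM_of_tendsto hlim fun N => ?_
    filter_upwards [eventually_ge_atTop N] with k hk
    exact .inl fun i hi => hx' (φ k) i (by have := hφ.id_le k; simp only [id] at this; omega)
  have h2 : KP β θ' = KP α θ ∨ KM β θ' = KP α θ := by
    refine KP_or_KM_of_tendsto hlim fun N => ?_
    filter_upwards [eventually_ge_atTop N] with k hk
    exact .inr fun i hi => h.KM_right_of_flip (hx (φ k)) (hx' (φ k)) i
      (by have := hφ.id_le k; simp only [id] at this; omega)
  exact ⟨θ', (h.collapse_eq h1).symm.trans (h.collapse_eq_right (.inr rfl)),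
    (h.collapse_eq_right h2).symm.trans (h.collapse_eq (.inl rfl))⟩

lemma exists_ne (h : PrePair α β) : ∃ θ, KP α θ ≠ KM β θ := by
  have h0 := ar_pos h.ne
  have h1 := ar_lt_one β α
  set p := β + ((ar β α / 2 : ℝ) : Angle) with hp
  have h2 : ar β p = ar β α / 2 := ar_add_of_mem (by linarith) (by linarith)
  refine ⟨half0 p, fun h' => ?_⟩
  have h3 : codeM β (half0 p) = codeP α (half0 p) := (congrFun h' 0).symm
  rw [h.codeM_eq_iff, dbl_half0] at h3
  exact h3 ⟨by rw [h2]; linarith, by rw [h2]; linarith⟩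

end PrePair

/-! ### Companions -/

/-- `k` selects one of the two itineraries of each angle, `nf` maps both to the selected one,
and Julia equivalence is equality of the selected itineraries. -/
structure Canonical (γ : Angle) (k : Angle → Seq2) (nf : Seq2 → Seq2) : Prop where
  nf_eq : ∀ {θ : Angle} {s : Seq2}, KP γ θ = s ∨ KM γ θ = s → nf s = k θ
  eq_or : ∀ θ, KP γ θ = k θ ∨ KM γ θ = k θ
  julia : ∀ {a b : Angle}, JuliaEquiv γ a b ↔ k a = k b
  shift_eq : ∀ θ, shift (k θ) = k (dbl θ)

namespace Canonical

variable {γ : Angle} {k : Angle → Seq2} {nf : Seq2 → Seq2}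

lemma nf_self (h : Canonical γ k nf) (θ : Angle) : nf (k θ) = k θ := h.nf_eq (h.eq_or θ)

lemma nf_of_hasItin (h : Canonical γ k nf) {ξ : MarkedAngle} {s : Seq2} (hs : HasItin γ ξ s) :
    nf s = k ξ.angle := h.nf_eq (KP_or_KM_of_hasItin hs)

lemma exists_eq (h : Canonical γ k nf) (s : Seq2) :
    ∃ θ, nf s = k θ ∧ nf (shift s) = k (dbl θ) := by
  obtain ⟨θ, hθ⟩ := exists_KP_or_KM γ s
  refine ⟨θ, h.nf_eq hθ, h.nf_eq ?_⟩
  rcases hθ with rfl | rfl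
  · exact .inl rfl
  · exact .inr rfl

lemma seqEquiv_iff (h : Canonical γ k nf) {s t : Seq2} : SeqEquiv γ s t ↔ nf s = nf t := by
  constructor
  · rintro ⟨ξ, -, η, -, h1, h2, h3⟩
    rw [h.nf_of_hasItin h1, h.nf_of_hasItin h2]
    exact h.julia.1 h3
  · intro hst
    obtain ⟨θ, hθ⟩ := exists_KP_or_KM γ s
    obtain ⟨η, hη⟩ := exists_KP_or_KM γ t
    obtain ⟨ξ, hξ, e1, h1⟩ := exists_hasItin γ hθ
    obtain ⟨ζ, hζ, e2, h2⟩ := exists_hasItin γ hη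
    refine ⟨ξ, hξ, ζ, hζ, h1, h2, h.julia.2 ?_⟩
    rw [e1, e2, ← h.nf_eq hθ, ← h.nf_eq hη, hst]

lemma equivalence (h : Canonical γ k nf) : Equivalence (SeqEquiv γ) where
  refl _ := h.seqEquiv_iff.2 rfl
  symm h' := h.seqEquiv_iff.2 (h.seqEquiv_iff.1 h').symm
  trans h1 h2 := h.seqEquiv_iff.2 ((h.seqEquiv_iff.1 h1).trans (h.seqEquiv_iff.1 h2))

lemma mk_eq_iff (h : Canonical γ k nf) {s t : Seq2} :
    SeqQuot.mk γ s = SeqQuot.mk γ t ↔ nf s = nf t :=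
  ⟨fun h' => h.seqEquiv_iff.1 (h.equivalence.eqvGen_iff.1 (Quot.eqvGen_exact h')),
    fun h' => Quot.sound (h.seqEquiv_iff.2 h')⟩

end Canonical

/-- Two angles with canonical itineraries that determine each other and can be exchanged. -/
structure Companions (α β : Angle) (k l : Angle → Seq2) (nf : Seq2 → Seq2) : Prop where
  left : Canonical α k nf
  right : Canonical β l nf
  eq_iff : ∀ {a b}, k a = k b ↔ l a = l b
  exchange : ∀ θ, ∃ θ', k θ' = l θ ∧ l θ' = k θ
  exists_ne : ∃ θ, k θ ≠ l θ
  tendsto_left : Tendsto (companionSeq α) atTop (𝓝 β)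
  tendsto_right : Tendsto (companionSeq β) atTop (𝓝 α)

lemma PrePair.companions (h : PrePair α β) :
    Companions α β (KP α) (KM β) (collapse (KP α α) (KM α α)) where
  left := ⟨h.collapse_eq, fun _ => .inl rfl, h.juliaEquiv_iff, fun _ => rfl⟩
  right := ⟨h.collapse_eq_right, fun _ => .inr rfl, h.juliaEquiv_iff_right, fun _ => rfl⟩
  eq_iff := h.KP_eq_iff
  exchange := h.exists_exchange
  exists_ne := h.exists_ne
  tendsto_left := h.tendsto_companionSeq
  tendsto_right := h.tendsto_companionSeq_right

namespace Companions

variable {k l : Angle → Seq2} {nf : Seq2 → Seq2}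

lemma symm (h : Companions α β k l nf) : Companions β α l k nf where
  left := h.right
  right := h.left
  eq_iff := h.eq_iff.symm
  exchange θ := by
    obtain ⟨θ', h1, h2⟩ := h.exchange θ
    exact ⟨θ', h2, h1⟩
  exists_ne := by
    obtain ⟨θ, h1⟩ := h.exists_ne
    exact ⟨θ, h1.symm⟩
  tendsto_left := h.tendsto_right
  tendsto_right := h.tendsto_left

lemma companion_eq (h : Companions α β k l nf) : companion α = β := h.tendsto_left.limUnder_eq

/-- The map of sequences that replaces the itinerary of an angle with respect to `α` by the
itinerary with respect to `β`. -/
def conv (h : Companions α β k l nf) (s : Seq2) : Seq2 := l (h.left.exists_eq s).choose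

lemma conv_eq (h : Companions α β k l nf) {s : Seq2} {θ : Angle} (hs : nf s = k θ) :
    h.conv s = l θ :=
  h.eq_iff.1 ((h.left.exists_eq s).choose_spec.1.symm.trans hs)

lemma nf_conv (h : Companions α β k l nf) (s : Seq2) : nf (h.conv s) = h.conv s :=
  h.right.nf_self _

/-- A second application may be evaluated at an angle with exchanged itineraries. -/
lemma conv_conv (h : Companions α β k l nf) (s : Seq2) : h.conv (h.conv s) = nf s := by
  obtain ⟨θ, h1, -⟩ := h.left.exists_eq s
  obtain ⟨θ', h2, h3⟩ := h.exchange θ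
  rw [h.conv_eq (s := h.conv s) (θ := θ'), h3, h1]
  rw [h.nf_conv, h.conv_eq h1, h2]

/-- The map of the quotient that `conv` induces. -/
def quotConv (h : Companions α β k l nf) : SeqQuot α → SeqQuot α :=
  Quot.map h.conv fun s t hst => by
    rw [h.left.seqEquiv_iff] at hst ⊢
    obtain ⟨θ, h1, -⟩ := h.left.exists_eq t
    rw [h.conv_eq h1, h.conv_eq (hst.trans h1)]

lemma quotConv_mk (h : Companions α β k l nf) (s : Seq2) :
    h.quotConv (SeqQuot.mk α s) = SeqQuot.mk α (h.conv s) := rfl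

lemma quotConv_involutive (h : Companions α β k l nf) : Function.Involutive h.quotConv := by
  rintro ⟨s⟩
  change h.quotConv (h.quotConv (SeqQuot.mk α s)) = SeqQuot.mk α s
  rw [quotConv_mk, quotConv_mk, h.left.mk_eq_iff, h.conv_conv]
  obtain ⟨θ, h1, -⟩ := h.left.exists_eq s
  rw [h1, h.left.nf_self]

/-- The map of the quotient that the shift induces. -/
def quotShift (h : Companions α β k l nf) : SeqQuot α → SeqQuot α :=
  Quot.map shift fun s t hst => by
    rw [h.left.seqEquiv_iff] at hst ⊢
    obtain ⟨θ, h1, h2⟩ := h.left.exists_eq s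
    obtain ⟨η, h3, h4⟩ := h.left.exists_eq t
    rw [h2, h4, ← h.left.shift_eq, ← h.left.shift_eq, ← h1, ← h3, hst]

lemma quotShift_mk (h : Companions α β k l nf) (s : Seq2) :
    h.quotShift (SeqQuot.mk α s) = SeqQuot.mk α (shift s) := rfl

lemma quotConv_quotShift (h : Companions α β k l nf) (x : SeqQuot α) :
    h.quotConv (h.quotShift x) = h.quotShift (h.quotConv x) := by
  obtain ⟨s, rfl⟩ : ∃ s, SeqQuot.mk α s = x := Quot.exists_rep x
  rw [quotShift_mk, quotConv_mk, quotConv_mk, quotShift_mk]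
  obtain ⟨θ, h1, h2⟩ := h.left.exists_eq s
  rw [h.conv_eq h1, h.conv_eq h2, h.right.shift_eq]

lemma exists_phiRel (h : Companions α β k l nf) (s : Seq2) : ∃ t, PhiRel α s t := by
  unfold PhiRel
  rw [h.companion_eq]
  obtain ⟨θ, hθ⟩ := exists_KP_or_KM α s
  -- For a preimage of either angle the same marker serves both codings; otherwise no marker is
  -- needed.
  by_cases hp : IsPreimage α θ ∨ IsPreimage β θ
  · rcases hθ with hθ | hθ
    · exact ⟨KP β θ, .plus θ, hp, hasItin_plus.2 hθ, hasItin_plus.2 rfl⟩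
    · exact ⟨KM β θ, .minus θ, hp, hasItin_minus.2 hθ, hasItin_minus.2 rfl⟩
  · rw [not_or] at hp
    rw [KM_eq_KP_of_not_isPreimage hp.1, or_self] at hθ
    exact ⟨KP β θ, .plain θ, .inl hp.1, hasItin_plain.2 ⟨fun i h' => hp.1 ⟨_, h'⟩, hθ⟩,
      hasItin_plain.2 ⟨fun i h' => hp.2 ⟨_, h'⟩, rfl⟩⟩

lemma quotConv_eq_of_phiRel (h : Companions α β k l nf) {s t : Seq2} (hst : PhiRel α s t) :
    h.quotConv (SeqQuot.mk α s) = SeqQuot.mk α t := by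
  obtain ⟨ξ, -, h1, h2⟩ := hst
  rw [h.companion_eq] at h2
  rw [quotConv_mk, h.left.mk_eq_iff, h.conv_eq (h.left.nf_of_hasItin h1),
    h.right.nf_of_hasItin h2, h.right.nf_self]

/-- By the exchange, converting back from `β` to `α` induces the same map as converting forward, as
an involution requires. -/
lemma quotConv_eq_of_phiRel_right (h : Companions α β k l nf) {s t : Seq2}
    (hst : PhiRel β s t) : h.quotConv (SeqQuot.mk α s) = SeqQuot.mk α t := by
  obtain ⟨ξ, -, h1, h2⟩ := hst
  rw [h.symm.companion_eq] at h2
  obtain ⟨θ', h3, h4⟩ := h.exchange ξ.angle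
  rw [quotConv_mk, h.left.mk_eq_iff, h.conv_eq ((h.right.nf_of_hasItin h1).trans h3.symm), h4,
    h.left.nf_of_hasItin h2, h.left.nf_self]

lemma orderOf_quotConv (h : Companions α β k l nf) :
    orderOf h.quotConv_involutive.toPerm = 2 := by
  refine orderOf_eq_prime ?_ fun h' => ?_
  · ext x
    exact h.quotConv_involutive x
  · obtain ⟨θ, hθ⟩ := h.exists_ne
    have h1 : h.quotConv (SeqQuot.mk α (k θ)) = SeqQuot.mk α (k θ) :=
      congrArg (fun e : Equiv.Perm (SeqQuot α) => e (SeqQuot.mk α (k θ))) h'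
    rw [quotConv_mk, h.left.mk_eq_iff, h.nf_conv, h.conv_eq (h.left.nf_self θ),
      h.left.nf_self] at h1
    exact hθ h1.symm

end Companions

lemma exists_companions (hper : α ∈ Function.periodicPts dbl) (h0 : α ≠ 0) :
    ∃ β k l nf, Companions α β k l nf := by
  obtain ⟨β, h | h⟩ := exists_prePair hper h0
  · exact ⟨β, _, _, _, h.companions⟩
  · exact ⟨β, _, _, _, h.companions.symm⟩

end QuadLam

end

theorem theorem6 (α : Angle) (hα : α ≠ 0) (hper : α ∈ Function.periodicPts dbl) :
    -- the limit that defines the companion angle exists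
    Tendsto (companionSeq α) atTop (𝓝 (companion α)) ∧
    -- the itinerary is a well-defined map from the extended angles onto the sequences
    (∀ ξ ∈ extAngles α, ∃! s : Seq2, HasItin α ξ s) ∧
    (∀ s : Seq2, ∃ ξ ∈ extAngles α, HasItin α ξ s) ∧
    -- the relation on sequences does not depend on the choice of extended angles, is an
    -- equivalence relation, and is the same for the two companion angles
    (∀ ξ ∈ extAngles α, ∀ η ∈ extAngles α, ∀ s t : Seq2, HasItin α ξ s → HasItin α η t →
      (SeqEquiv α s t ↔ JuliaEquiv α ξ.angle η.angle)) ∧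
    Equivalence (SeqEquiv α) ∧
    (∀ s t : Seq2, SeqEquiv (companion α) s t ↔ SeqEquiv α s t) ∧
    -- the multivalued maps for the two companion angles are defined on all sequences
    (∀ s : Seq2, ∃ t, PhiRel α s t) ∧
    (∀ s : Seq2, ∃ t, PhiRel (companion α) s t) ∧
    -- they descend to maps of the quotient, inverse to each other and of order two, that
    -- commute with the map induced by the shift
    ∃ (Φ : Equiv.Perm (SeqQuot α)) (σ : SeqQuot α → SeqQuot α),
      (∀ s t : Seq2, PhiRel α s t → Φ (SeqQuot.mk α s) = SeqQuot.mk α t) ∧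
      (∀ s t : Seq2, PhiRel (companion α) s t →
        Φ.symm (SeqQuot.mk α s) = SeqQuot.mk α t) ∧
      (∀ s : Seq2, σ (SeqQuot.mk α s) = SeqQuot.mk α (shift s)) ∧
      orderOf Φ = 2 ∧
      (∀ x, Φ (σ x) = σ (Φ x)) := by
  obtain ⟨β, k, l, nf, h⟩ := exists_companions hper hα
  have hβ := h.companion_eq
  refine ⟨by rw [hβ]; exact h.tendsto_left, fun ξ hξ => existsUnique_hasItin hξ, fun s => ?_,
    fun ξ _ η _ s t hs ht => ?_, h.left.equivalence, fun s t => ?_, h.exists_phiRel, ?_,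
    h.quotConv_involutive.toPerm, h.quotShift, fun s t => h.quotConv_eq_of_phiRel,
    fun s t hst => ?_, h.quotShift_mk, h.orderOf_quotConv, h.quotConv_quotShift⟩
  · obtain ⟨θ, hθ⟩ := exists_KP_or_KM α s
    obtain ⟨ξ, hξ, -, hs⟩ := exists_hasItin α hθ
    exact ⟨ξ, hξ, hs⟩
  · rw [h.left.seqEquiv_iff, h.left.nf_of_hasItin hs, h.left.nf_of_hasItin ht, h.left.julia]
  -- Both relations are equality of the same normal form.
  · rw [hβ, h.left.seqEquiv_iff, h.right.seqEquiv_iff]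
  · rw [hβ]
    exact h.symm.exists_phiRel
  · rw [hβ] at hst
    exact h.quotConv_eq_of_phiRel_right hst
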